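/- **Proposition 4 (conditional second moment).** There exists $\beta_0>0$ such that the following holds for all $0<\beta\le\beta_0$ and all $h>0$. *Model.* For each $N$ let $g=(g_{ij})_{1\le i,j\le N}$ be i.i.d. centered Gaussian variables with variance $1/N$ on a probability space $(\Omega,\mathcal F,\mathbb P)$, and let $$Z_N:=2^{-N}\sum_{\sigma\in\{-1,1\}^N}\exp\Big[\frac{\beta}{\sqrt2}\sum_{i,j=1}^N g_{ij}\sigma_i\sigma_j+h\sum_{i=1}^N\sigma_i\Big],$$ $$\operatorname{RS}(\beta,h):=\inf_{t\ge0}\Big[E\log\cosh(h+\beta\sqrt t\,Z)+\frac{\beta^2(1-t)^2}{4}\Big],$$ where $Z,Z',Z''$ denote independent standard Gaussian variables and $E$ the expectation with respect to them. Let $q=q(\beta,h)\geq 0$ be the unique solution of $q=E\tanh^2(h+\beta\sqrt q\,Z)$. *Sequences.* Put $\operatorname{Th}(x)=\tanh(h+\beta x)$, $\psi(t)=E\operatorname{Th}(\sqrt tZ+\sqrt{q-t}Z')\operatorname{Th}(\sqrt tZ+\sqrt{q-t}Z'')$ for $0\le t\le q$, $\gamma_1=E\operatorname{Th}(\sqrt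 qZ)$, $\rho_1=\sqrt q\,\gamma_1$, and for $k\ge2$ $$\rho_k=\psi(\rho_{k-1}),\qquad \gamma_k=\frac{\rho_k-\Gamma_{k-1}^2}{\sqrt{q-\Gamma_{k-1}^2}},\qquad \Gamma_{k}^2:=\sum_{j=1}^{k}\gamma_j^2\quad(\Gamma_0^2:=0).$$ *The $\sigma$-fields.* On $\mathbb R^N$ let $\langle x,y\rangle=\frac1N\sum_i x_iy_i$, $\|x\|=\sqrt{\langle x,x\rangle}$, $(a\otimes b)_{ij}=a_ib_j/N$. Put $g^{(1)}=g$, $\phi^{(1)}=\mathbf 1$ and, for $1\le k<N$, $$\xi^{(k)}=g^{(k)}\phi^{(k)},\quad \eta^{(k)}=(g^{(k)})^T\phi^{(k)},\quad \zeta^{(k)}=\frac{\xi^{(k)}+\eta^{(k)}}{\sqrt2},$$ $$m^{(k+1)}=\tanh\Big(h\mathbf 1+\beta\sum_{s=1}^{k-1}\gamma_s\zeta^{(s)}+\beta\sqrt{q-\Gamma_{k-1}^2}\,\zeta^{(k)}\Big)\ \text{(componentwise)},$$ $$\phi^{(k+1)}=\frac{m^{(k+1)}-\sum_{s=1}^k\langle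 m^{(k+1)},\phi^{(s)}\rangle\phi^{(s)}}{\big\|m^{(k+1)}-\sum_{s=1}^k\langle m^{(k+1)},\phi^{(s)}\rangle\phi^{(s)}\big\|},$$ $$g^{(k+1)}=g^{(k)}-\Big(\xi^{(k)}\otimes\phi^{(k)}+\phi^{(k)}\otimes\eta^{(k)}-\langle\phi^{(k)},\xi^{(k)}\rangle\,\phi^{(k)}\otimes\phi^{(k)}\Big).$$ Let $\mathcal G_k=\sigma(\xi^{(m)},\eta^{(m)}:m\le k)$. *Conclusion.* $$\lim_{k\to\infty}\limsup_{N\to\infty}\mathbb E\left|\frac1N\log\mathbb E\big(Z_N^2\,\big|\,\mathcal G_k\big)-2\operatorname{RS}(\beta,h)\right|\le0,$$ i.e. this limit exists and equals $0$. -/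

import Mathlib

open MeasureTheory ProbabilityTheory Filter Topology
open scoped Matrix NNReal

namespace SKModel

noncomputable section

/-! ### The Hamiltonian and the partition function -/

/-- `H(σ) = (β/√2) ∑_{i,j} g_{ij} σ_i σ_j + h ∑_i σ_i` for `σ ∈ {-1, 1}^N`. -/
def hamiltonian (β h : ℝ) {N : ℕ} (g : Matrix (Fin N) (Fin N) ℝ) (σ : Fin N → ℤˣ) : ℝ :=
  β / √2 * ∑ i, ∑ j, g i j * ((σ i : ℤ) : ℝ) * ((σ j : ℤ) : ℝ) + h * ∑ i, ((σ i : ℤ) : ℝ)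

/-- `Z_N = 2^{-N} ∑_σ exp H(σ)`. -/
def partitionFn (β h : ℝ) {N : ℕ} (g : Matrix (Fin N) (Fin N) ℝ) : ℝ :=
  ((2 : ℝ) ^ N)⁻¹ * ∑ σ : Fin N → ℤˣ, Real.exp (hamiltonian β h g σ)

/-- The random matrix `g` has i.i.d. centered Gaussian entries with variance `1/N`
(all `N²` entries, without symmetry). -/
structure IsDisorder {Ω : Type*} [MeasurableSpace Ω] (P : Measure Ω) {N : ℕ}
    (g : Ω → Matrix (Fin N) (Fin N) ℝ) : Prop where
  measurable : ∀ i j, Measurable fun ω => g ω i j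
  indep : iIndepFun (fun (p : Fin N × Fin N) ω => g ω p.1 p.2) P
  law : ∀ i j, P.map (fun ω => g ω i j) = gaussianReal 0 ((N : ℝ≥0)⁻¹)

/-! ### The replica symmetric formula and the numerical sequences -/

/-- `RS(β, h) = inf_{t ≥ 0} [E log cosh (h + β √t Z) + β² (1 - t)² / 4]`. -/
def RS (β h : ℝ) : ℝ :=
  ⨅ t : ℝ≥0, (∫ x, Real.log (Real.cosh (h + β * √(t : ℝ) * x)) ∂(gaussianReal 0 1)
    + β ^ 2 * (1 - (t : ℝ)) ^ 2 / 4)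

/-- `q = q(β, h)`: the solution `q ≥ 0` of `q = E tanh² (h + β √q Z)`, which exists and is unique
for `h ≠ 0`. -/
def overlap (β h : ℝ) : ℝ :=
  sInf {t : ℝ | 0 ≤ t ∧ t = ∫ x, Real.tanh (h + β * √t * x) ^ 2 ∂(gaussianReal 0 1)}

/-- `ψ(t) = E Th(√t Z + √(q-t) Z') Th(√t Z + √(q-t) Z'')` with `Th(x) = tanh (h + β x)` and
`Z, Z', Z''` independent standard Gaussians. -/
def psi (β h t : ℝ) : ℝ :=
  ∫ z, ∫ z', ∫ z'',
      Real.tanh (h + β * (√t * z + √(overlap β h - t) * z')) *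
        Real.tanh (h + β * (√t * z + √(overlap β h - t) * z''))
    ∂(gaussianReal 0 1) ∂(gaussianReal 0 1) ∂(gaussianReal 0 1)

/-- `γ₁ = E tanh (h + β √q Z)`. -/
def gammaOne (β h : ℝ) : ℝ :=
  ∫ x, Real.tanh (h + β * √(overlap β h) * x) ∂(gaussianReal 0 1)

/-- The sequence `ρ₁ = √q γ₁`, `ρ_{k+1} = ψ(ρ_k)`, numbered from zero: `rhoSeq β h k` is
`ρ_{k+1}`. -/
def rhoSeq (β h : ℝ) : ℕ → ℝ
  | 0 => √(overlap β h) * gammaOne β h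
  | k + 1 => psi β h (rhoSeq β h k)

/-- The sequence `γ_k = (ρ_k - ∑_{j<k} γ_j²) / √(q - ∑_{j<k} γ_j²)` for `k ≥ 2`, with `γ₁` as
above, numbered from zero: `gammaSeq β h k` is `γ_{k+1}`. -/
def gammaSeq (β h : ℝ) : ℕ → ℝ
  | 0 => gammaOne β h
  | k + 1 =>
    (rhoSeq β h (k + 1) - ∑ j : Fin (k + 1), gammaSeq β h j ^ 2) /
      √(overlap β h - ∑ j : Fin (k + 1), gammaSeq β h j ^ 2)
  decreasing_by all_goals exact j.2

/-! ### The recursive modification of the interaction matrix -/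

/-- `⟨x, y⟩ = N⁻¹ ∑_i x_i y_i`. -/
def inner {N : ℕ} (x y : Fin N → ℝ) : ℝ := (∑ i, x i * y i) / N

/-- `‖x‖ = √⟨x, x⟩`. -/
def nrm {N : ℕ} (x : Fin N → ℝ) : ℝ := √(inner x x)

/-- `(a ⊗ b)_{ij} = a_i b_j / N`. -/
def tensor {N : ℕ} (a b : Fin N → ℝ) : Matrix (Fin N) (Fin N) ℝ :=
  Matrix.of fun i j => a i * b j / N

/-- `ζ = (G φ + Gᵀ φ) / √2`. -/
def zetaOf {N : ℕ} (G : Matrix (Fin N) (Fin N) ℝ) (φ : Fin N → ℝ) : Fin N → ℝ :=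
  (√2)⁻¹ • (G *ᵥ φ + Gᵀ *ᵥ φ)

/-- `G - (ξ ⊗ φ + φ ⊗ η - ⟨φ, ξ⟩ φ ⊗ φ)` with `ξ = G φ` and `η = Gᵀ φ`. -/
def nextMatrix {N : ℕ} (G : Matrix (Fin N) (Fin N) ℝ) (φ : Fin N → ℝ) :
    Matrix (Fin N) (Fin N) ℝ :=
  G - (tensor (G *ᵥ φ) φ + tensor φ (Gᵀ *ᵥ φ) - inner φ (G *ᵥ φ) • tensor φ φ)

/-- The vector `m = tanh (h 1 + β ∑_{s<k} γ_s ζ_s + β √(q - ∑_{s<k} γ_s²) ζ_k)`, computed from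
`ζ_0, …, ζ_k` (numbered from zero). -/
def nextMean (β h : ℝ) {N : ℕ} (k : ℕ) (ζ : Fin (k + 1) → Fin N → ℝ) : Fin N → ℝ := fun i =>
  Real.tanh (h + β * ∑ s : Fin k, gammaSeq β h s * ζ s.castSucc i +
    β * √(overlap β h - ∑ s : Fin k, gammaSeq β h s ^ 2) * ζ (Fin.last k) i)

/-- `m - ∑_s ⟨m, φ_s⟩ φ_s`. -/
def residual {N k : ℕ} (m : Fin N → ℝ) (φ : Fin k → Fin N → ℝ) : Fin N → ℝ :=
  m - ∑ s, inner m (φ s) • φ s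

/-- The pairs `(g^{(k)}, φ^{(k)})`, numbered from zero: `iter β h g k` is
`(g^{(k+1)}, φ^{(k+1)})`. -/
def iter (β h : ℝ) {N : ℕ} (g : Matrix (Fin N) (Fin N) ℝ) :
    ℕ → Matrix (Fin N) (Fin N) ℝ × (Fin N → ℝ)
  | 0 => (g, fun _ => 1)
  | k + 1 =>
    let m : Fin N → ℝ := nextMean β h k fun s : Fin (k + 1) =>
      zetaOf (iter β h g s).1 (iter β h g s).2
    let r : Fin N → ℝ := residual m fun s : Fin (k + 1) => (iter β h g s).2
    (nextMatrix (iter β h g k).1 (iter β h g k).2, (nrm r)⁻¹ • r)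
  decreasing_by all_goals first | exact s.2 | exact Nat.lt_succ_self _

/-- `gIter β h g k` is `g^{(k+1)}`. -/
def gIter (β h : ℝ) {N : ℕ} (g : Matrix (Fin N) (Fin N) ℝ) (k : ℕ) :
    Matrix (Fin N) (Fin N) ℝ := (iter β h g k).1

/-- `phi β h g k` is `φ^{(k+1)}`. -/
def phi (β h : ℝ) {N : ℕ} (g : Matrix (Fin N) (Fin N) ℝ) (k : ℕ) : Fin N → ℝ :=
  (iter β h g k).2

/-- `xi β h g k` is `ξ^{(k+1)} = g^{(k+1)} φ^{(k+1)}`. -/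
def xi (β h : ℝ) {N : ℕ} (g : Matrix (Fin N) (Fin N) ℝ) (k : ℕ) : Fin N → ℝ :=
  gIter β h g k *ᵥ phi β h g k

/-- `eta β h g k` is `η^{(k+1)} = (g^{(k+1)})ᵀ φ^{(k+1)}`. -/
def eta (β h : ℝ) {N : ℕ} (g : Matrix (Fin N) (Fin N) ℝ) (k : ℕ) : Fin N → ℝ :=
  (gIter β h g k)ᵀ *ᵥ phi β h g k

/-- `zeta β h g k` is `ζ^{(k+1)} = (ξ^{(k+1)} + η^{(k+1)}) / √2`. -/
def zeta (β h : ℝ) {N : ℕ} (g : Matrix (Fin N) (Fin N) ℝ) (k : ℕ) : Fin N → ℝ :=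
  (√2)⁻¹ • (xi β h g k + eta β h g k)

/-- `mean β h g k` is `m^{(k+2)}`. -/
def mean (β h : ℝ) {N : ℕ} (g : Matrix (Fin N) (Fin N) ℝ) (k : ℕ) : Fin N → ℝ :=
  nextMean β h k fun s => zeta β h g s

theorem gIter_zero (β h : ℝ) {N : ℕ} (g : Matrix (Fin N) (Fin N) ℝ) : gIter β h g 0 = g := by
  simp [gIter, iter]

theorem phi_zero (β h : ℝ) {N : ℕ} (g : Matrix (Fin N) (Fin N) ℝ) :
    phi β h g 0 = fun _ => 1 := by
  simp [phi, iter]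

theorem gIter_succ (β h : ℝ) {N : ℕ} (g : Matrix (Fin N) (Fin N) ℝ) (k : ℕ) :
    gIter β h g (k + 1) = gIter β h g k -
      (tensor (xi β h g k) (phi β h g k) + tensor (phi β h g k) (eta β h g k) -
        inner (phi β h g k) (xi β h g k) • tensor (phi β h g k) (phi β h g k)) := by
  rw [gIter, iter]
  rfl

theorem phi_succ (β h : ℝ) {N : ℕ} (g : Matrix (Fin N) (Fin N) ℝ) (k : ℕ) :
    phi β h g (k + 1) =
      (nrm (mean β h g k - ∑ s : Fin (k + 1), inner (mean β h g k) (phi β h g s) • phi β h g s))⁻¹ •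
        (mean β h g k - ∑ s : Fin (k + 1), inner (mean β h g k) (phi β h g s) • phi β h g s) := by
  rw [phi, iter]
  rfl

/-- The `σ`-field `𝒢_k` generated by the random vectors `ξ^{(m)}, η^{(m)}`, `1 ≤ m ≤ k`. -/
@[reducible] def sigmaField (β h : ℝ) {Ω : Type*} {N : ℕ} (g : Ω → Matrix (Fin N) (Fin N) ℝ) (k : ℕ) :
    MeasurableSpace Ω :=
  ⨆ s : Fin k, (MeasurableSpace.comap (fun ω => xi β h (g ω) s) inferInstance ⊔
    MeasurableSpace.comap (fun ω => eta β h (g ω) s) inferInstance)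

end

end SKModel

/-! Freeze the first k steps and average over everything else. The directions φ are orthonormal (or
zero), and the modified matrix is the compression P g P of the disorder to the orthogonal complement
of the directions already used (`gIter_eq_proj`). For Gaussian g, this compression may be replaced
by that of an independent copy: neither the law of the matrix (`lintegral_resample`) nor the vectors
ξ, η of the first k steps (`xi_resample`, `eta_resample`) change. Conditioning on the σ-field is
therefore integration over the copy (`condExp_partitionFn_sq`), an explicit Gaussian integral whose
value is a sum over two replicas (`condMoment`, `replicaSum`).

Let a be coefficients with Σ a_s² = q. Expanding the replica exponent around ⟨φ_s, σ⟩ = a_s produces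
a linear part given by the effective field h + β Σ a_s ζ_s, the constant β²(1-q)²/4, and a remainder
made of quadratic deviations and negligible diagonal terms (`replicaExp_eq`). The coupling of the
replicas is quadratic too: once the frozen directions are subtracted, the overlap of σ and τ
consists of fluctuations only (`crossTerm_sq_le`). Under the product measure with the effective
field the centered spins are sub-Gaussian, so for small β the exponential of a quadratic fluctuation
has expectation bounded uniformly in N (`gibbs_exp_sq_le`); Jensen's inequality gives the matching
lower bound. Up to a deterministic bias the free energy is thus that of two independent product
measures (`abs_log_replicaSum_sub_le`).

The bias is evaluated by a law of large numbers. Given the past, ζ_k is a standard Gaussian vector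
up to a perturbation of finite rank, so empirical averages over sites of pseudo-Lipschitz functions
of the fields converge to expectations over independent standard Gaussians (`tendsto_emp`). Hence
the overlaps of the mean vectors converge to the ρ's, the Gram–Schmidt coefficients to the γ's
(`tendsto_inner_mean_phi`), and the residual norms to positive limits, which in turn keeps the
directions from degenerating (`nonDegenerate`). With a taken from the field of the last mean vector,
every empirical quantity has the desired limit except one: the overlap with the last direction tends
to γ_K instead of √(q - Γ_K²) (`tendsto_biasTerm`; here Γ_K² is `gammaSum β h K`). This mismatch
vanishes as K → ∞ because ψ contracts towards q, which forces Γ_K² → q and γ_K → 0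
(`tendsto_gammaSum`).

What survives is 2 E log cosh(h + β√q Z) + β²(1-q)²/2, equal to 2 RS because at small β the infimum
is attained at q (`RS_eq`). Convergence in probability is upgraded to convergence in mean by a bound
on the second moment of the free energy that is uniform in N (`lintegral_crudeBound_sq_le`). -/

namespace SKModel

noncomputable section

/-! ### Gaussian product measures -/

/-- The product of centered Gaussian measures of variance `v`. -/
abbrev gauss (ι : Type*) [Fintype ι] (v : ℝ≥0) : Measure (ι → ℝ) :=
  Measure.pi fun _ => gaussianReal 0 v

theorem integral_cexp_gaussianReal (v : ℝ≥0) (t : ℝ) :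
    ∫ x, Complex.exp ((t * x : ℝ) * Complex.I) ∂(gaussianReal 0 v) =
      Complex.exp ((-(v * t ^ 2) / 2 : ℝ)) := by
  have h := charFun_gaussianReal (μ := 0) (v := v) t
  rw [charFun_apply_real] at h
  push_cast
  rw [h]
  congr 1
  push_cast
  ring

theorem integral_cexp_gauss {ι : Type*} [Fintype ι] (v : ℝ≥0) (c : ι → ℝ) :
    ∫ x, Complex.exp ((∑ i, c i * x i : ℝ) * Complex.I) ∂(gauss ι v) =
      Complex.exp ((-(v * ∑ i, c i ^ 2) / 2 : ℝ)) := by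
  have h : ∀ x : ι → ℝ, Complex.exp ((∑ i, c i * x i : ℝ) * Complex.I) =
      ∏ i, Complex.exp ((c i * x i : ℝ) * Complex.I) := fun x => by
    rw [← Complex.exp_sum]; congr 1; push_cast; rw [Finset.sum_mul]
  simp_rw [h]
  rw [integral_fintype_prod_eq_prod (f := fun i (x : ℝ) => Complex.exp ((c i * x : ℝ) * Complex.I))]
  simp_rw [integral_cexp_gaussianReal]
  rw [← Complex.exp_sum]
  congr 1
  push_cast
  rw [Finset.mul_sum, ← Finset.sum_neg_distrib, Finset.sum_div]

theorem measurable_cexp_linearForm {κ : Type*} [Fintype κ] (c : κ → ℝ) :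
    Measurable fun x : κ → ℝ => Complex.exp ((∑ i, c i * x i : ℝ) * Complex.I) := by
  have h : Measurable fun x : κ → ℝ => ∑ i, c i * x i := by fun_prop
  exact ((Complex.measurable_ofReal.comp h).mul_const _).cexp

theorem ext_of_integral_cexp {ι : Type*} [Fintype ι] {μ ν : Measure (ι → ℝ)}
    [IsFiniteMeasure μ] [IsFiniteMeasure ν]
    (h : ∀ c : ι → ℝ, ∫ x, Complex.exp ((∑ i, c i * x i : ℝ) * Complex.I) ∂μ =
      ∫ x, Complex.exp ((∑ i, c i * x i : ℝ) * Complex.I) ∂ν) : μ = ν := by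
  classical
  refine Measure.ext_of_charFunDual (funext fun L => ?_)
  rw [charFunDual_apply, charFunDual_apply]
  have hL : ∀ x, L x = ∑ i, L (fun j => if i = j then 1 else 0) * x i := fun x => by
    rw [show L x = (L : (ι → ℝ) →ₗ[ℝ] ℝ) x from rfl, LinearMap.pi_apply_eq_sum_univ]
    simp [mul_comm]
  have h1 := h fun i => L fun j => if i = j then 1 else 0
  simp_rw [← hL] at h1
  exact h1

/-- The image of a product of two Gaussian measures under a linear map is determined by the
covariance. -/
theorem map_gauss_prod_gauss {ι ι' κ : Type*} [Fintype ι] [Fintype ι'] [Fintype κ] {v w u : ℝ≥0}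
    {f : (ι → ℝ) × (ι' → ℝ) → κ → ℝ} (hf : Measurable f)
    (a : (κ → ℝ) → ι → ℝ) (b : (κ → ℝ) → ι' → ℝ)
    (hab : ∀ c p, ∑ k, c k * f p k = ∑ i, a c i * p.1 i + ∑ i, b c i * p.2 i)
    (hcov : ∀ c, (v : ℝ) * ∑ i, a c i ^ 2 + w * ∑ i, b c i ^ 2 = u * ∑ k, c k ^ 2) :
    ((gauss ι v).prod (gauss ι' w)).map f = gauss κ u := by
  have : IsProbabilityMeasure (((gauss ι v).prod (gauss ι' w)).map f) :=
    Measure.isProbabilityMeasure_map hf.aemeasurable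
  refine ext_of_integral_cexp fun c => ?_
  rw [integral_map hf.aemeasurable (measurable_cexp_linearForm c).aestronglyMeasurable,
    integral_cexp_gauss]
  simp_rw [hab, Complex.ofReal_add, add_mul, Complex.exp_add]
  rw [integral_prod_mul (fun x : ι → ℝ => Complex.exp ((∑ i, a c i * x i : ℝ) * Complex.I))
    (fun x : ι' → ℝ => Complex.exp ((∑ i, b c i * x i : ℝ) * Complex.I)),
    integral_cexp_gauss, integral_cexp_gauss, ← Complex.exp_add, ← Complex.ofReal_add, ← hcov]
  congr 2
  ring

theorem map_gauss {ι κ : Type*} [Fintype ι] [Fintype κ] {v u : ℝ≥0}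
    {f : (ι → ℝ) → κ → ℝ} (hf : Measurable f) (a : (κ → ℝ) → ι → ℝ)
    (hab : ∀ c p, ∑ k, c k * f p k = ∑ i, a c i * p i)
    (hcov : ∀ c, (v : ℝ) * ∑ i, a c i ^ 2 = u * ∑ k, c k ^ 2) :
    (gauss ι v).map f = gauss κ u := by
  have : IsProbabilityMeasure ((gauss ι v).map f) :=
    Measure.isProbabilityMeasure_map hf.aemeasurable
  refine ext_of_integral_cexp fun c => ?_
  rw [integral_map hf.aemeasurable (measurable_cexp_linearForm c).aestronglyMeasurable,
    integral_cexp_gauss]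
  simp_rw [hab]
  rw [integral_cexp_gauss, hcov]

/-- A linear form of a Gaussian vector. -/
theorem map_linearForm_gauss {ι : Type*} [Fintype ι] (v : ℝ≥0) (c : ι → ℝ) (u : ℝ≥0)
    (hu : (u : ℝ) = v * ∑ i, c i ^ 2) :
    (gauss ι v).map (fun x => ∑ i, c i * x i) = gaussianReal 0 u := by
  have hm : Measurable fun x : ι → ℝ => ∑ i, c i * x i := by fun_prop
  have : IsProbabilityMeasure ((gauss ι v).map (fun x => ∑ i, c i * x i)) :=
    Measure.isProbabilityMeasure_map hm.aemeasurable
  refine Measure.ext_of_charFun (funext fun t => ?_)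
  rw [charFun_apply_real, charFun_apply_real, integral_map hm.aemeasurable (by fun_prop)]
  have h1 := integral_cexp_gauss v fun i => t * c i
  have h2 := integral_cexp_gaussianReal u t
  push_cast at h1 h2 ⊢
  rw [h2]
  simp_rw [Finset.mul_sum, ← mul_assoc]
  rw [h1]
  congr 1
  rw [show (u : ℂ) = ((u : ℝ) : ℂ) from rfl, hu]
  push_cast
  simp_rw [mul_pow]
  rw [← Finset.mul_sum]
  ring

theorem integral_gaussianReal_sq (v : ℝ≥0) : ∫ x, x ^ 2 ∂(gaussianReal 0 v) = v := by
  have h := variance_fun_id_gaussianReal (μ := 0) (v := v)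
  rw [variance_of_integral_eq_zero (by fun_prop) integral_id_gaussianReal] at h
  exact h

theorem integrable_sq_gaussianReal (v : ℝ≥0) :
    Integrable (fun x : ℝ => x ^ 2) (gaussianReal 0 v) :=
  (memLp_id_gaussianReal (μ := 0) (v := v) 2).integrable_sq

theorem integrable_sq_linearForm_gauss {ι : Type*} [Fintype ι] (v : ℝ≥0) (c : ι → ℝ) :
    Integrable (fun x : ι → ℝ => (∑ i, c i * x i) ^ 2) (gauss ι v) := by
  have hu : 0 ≤ (v : ℝ) * ∑ i, c i ^ 2 := by positivity
  have hm : Measurable fun x : ι → ℝ => ∑ i, c i * x i := by fun_prop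
  have h := integrable_sq_gaussianReal ⟨_, hu⟩
  rw [← map_linearForm_gauss v c ⟨_, hu⟩ rfl] at h
  exact h.comp_measurable hm

theorem integral_sq_linearForm_gauss {ι : Type*} [Fintype ι] (v : ℝ≥0) (c : ι → ℝ) :
    ∫ x, (∑ i, c i * x i) ^ 2 ∂(gauss ι v) = v * ∑ i, c i ^ 2 := by
  have hu : 0 ≤ (v : ℝ) * ∑ i, c i ^ 2 := by positivity
  have hm : Measurable fun x : ι → ℝ => ∑ i, c i * x i := by fun_prop
  have h := integral_gaussianReal_sq ⟨_, hu⟩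
  rw [← map_linearForm_gauss v c ⟨_, hu⟩ rfl, integral_map hm.aemeasurable (by fun_prop)] at h
  exact h

theorem integral_exp_gauss {ι : Type*} [Fintype ι] (v : ℝ≥0) (c : ι → ℝ) :
    ∫ x, Real.exp (∑ i, c i * x i) ∂(gauss ι v) = Real.exp (v * (∑ i, c i ^ 2) / 2) := by
  simp_rw [Real.exp_sum]
  rw [integral_fintype_prod_eq_prod (f := fun i (x : ℝ) => Real.exp (c i * x)),
    Finset.mul_sum, Finset.sum_div, Real.exp_sum]
  refine Finset.prod_congr rfl fun i _ => ?_
  have h := congrFun (mgf_fun_id_gaussianReal (μ := 0) (v := v)) (c i)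
  rw [mgf] at h
  rw [h]
  congr 1
  ring

theorem integrable_exp_gauss {ι : Type*} [Fintype ι] (v : ℝ≥0) (c : ι → ℝ) :
    Integrable (fun x => Real.exp (∑ i, c i * x i)) (gauss ι v) := by
  simp_rw [Real.exp_sum]
  exact Integrable.fintype_prod (f := fun i (x : ℝ) => Real.exp (c i * x))
    fun i => integrable_exp_mul_gaussianReal (c i)

theorem integrable_exp_mul_sq_gaussianReal {l : ℝ} (hl : l < 1 / 2) :
    Integrable (fun x => Real.exp (l * x ^ 2)) (gaussianReal 0 1) := by
  rw [gaussianReal_of_var_ne_zero 0 one_ne_zero]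
  refine (integrable_withDensity_iff (by fun_prop) (by simp [gaussianPDF])).2 ?_
  have h := (integrable_exp_neg_mul_sq (b := 1 / 2 - l) (by linarith)).const_mul
    ((√(2 * Real.pi * 1))⁻¹)
  refine h.congr (ae_of_all _ fun x => ?_)
  simp only [toReal_gaussianPDF, gaussianPDFReal]
  rw [mul_left_comm, ← Real.exp_add]
  simp only [NNReal.coe_one]
  congr 2
  ring

/-! ### Random matrices -/

instance {N : ℕ} : MeasurableSpace (Matrix (Fin N) (Fin N) ℝ) :=
  inferInstanceAs (MeasurableSpace (Fin N → Fin N → ℝ))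

theorem measurable_matrix {α : Type*} [MeasurableSpace α] {N : ℕ}
    {f : α → Matrix (Fin N) (Fin N) ℝ} (h : ∀ i j, Measurable fun x => f x i j) : Measurable f :=
  measurable_pi_lambda (δ := Fin N) (X := fun _ => Fin N → ℝ) f
    fun i => measurable_pi_lambda _ fun j => h i j

theorem measurable_entry {N : ℕ} (i j : Fin N) :
    Measurable fun A : Matrix (Fin N) (Fin N) ℝ => A i j :=
  (measurable_pi_apply (X := fun _ : Fin N => ℝ) j).comp
    (measurable_pi_apply (X := fun _ : Fin N => Fin N → ℝ) i)

theorem measurable_entry_of {α : Type*} [MeasurableSpace α] {N : ℕ}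
    {f : α → Matrix (Fin N) (Fin N) ℝ} (h : Measurable f) (i j : Fin N) :
    Measurable fun x => f x i j := (measurable_entry i j).comp h

/-- The matrix with given entries. -/
def ofEntries {N : ℕ} (x : Fin N × Fin N → ℝ) : Matrix (Fin N) (Fin N) ℝ :=
  Matrix.of fun i j => x (i, j)

theorem measurable_ofEntries {N : ℕ} : Measurable (ofEntries (N := N)) :=
  measurable_matrix fun _ _ => measurable_pi_apply _

/-- The law of a matrix with independent centered Gaussian entries of variance `1/N`. -/
def matrixLaw (N : ℕ) : Measure (Matrix (Fin N) (Fin N) ℝ) :=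
  (gauss (Fin N × Fin N) (N : ℝ≥0)⁻¹).map ofEntries

instance (N : ℕ) : IsProbabilityMeasure (matrixLaw N) :=
  Measure.isProbabilityMeasure_map measurable_ofEntries.aemeasurable

theorem IsDisorder.measurable_fun {Ω : Type*} [MeasurableSpace Ω] {P : Measure Ω} {N : ℕ}
    {g : Ω → Matrix (Fin N) (Fin N) ℝ} (hg : IsDisorder P g) : Measurable g :=
  measurable_matrix hg.measurable

theorem IsDisorder.map_eq {Ω : Type*} [MeasurableSpace Ω] {P : Measure Ω} [IsProbabilityMeasure P]
    {N : ℕ} {g : Ω → Matrix (Fin N) (Fin N) ℝ} (hg : IsDisorder P g) : P.map g = matrixLaw N := by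
  have h := (iIndepFun_iff_map_fun_eq_pi_map
    (fun p : Fin N × Fin N => (hg.measurable p.1 p.2).aemeasurable)).1 hg.indep
  simp_rw [hg.law] at h
  rw [matrixLaw, gauss, ← h, Measure.map_map measurable_ofEntries
    (measurable_pi_lambda _ fun p => hg.measurable p.1 p.2)]
  rfl

/-- `∑_{i,j} c_{ij} g_{ij}`. -/
def pairing {N : ℕ} (c g : Matrix (Fin N) (Fin N) ℝ) : ℝ := ∑ i, ∑ j, c i j * g i j

theorem pairing_ofEntries {N : ℕ} (c : Matrix (Fin N) (Fin N) ℝ) (x : Fin N × Fin N → ℝ) :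
    pairing c (ofEntries x) = ∑ p : Fin N × Fin N, c p.1 p.2 * x p := by
  rw [Fintype.sum_prod_type]; rfl

theorem measurable_pairing {N : ℕ} (c : Matrix (Fin N) (Fin N) ℝ) : Measurable (pairing c) := by
  unfold pairing
  exact Finset.measurable_sum _ fun i _ => Finset.measurable_sum _ fun j _ =>
    (measurable_entry i j).const_mul _

theorem integral_exp_pairing {N : ℕ} (c : Matrix (Fin N) (Fin N) ℝ) :
    ∫ g, Real.exp (pairing c g) ∂(matrixLaw N) = Real.exp ((N : ℝ)⁻¹ * pairing c c / 2) := by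
  rw [matrixLaw, integral_map measurable_ofEntries.aemeasurable
    (measurable_pairing c).exp.aestronglyMeasurable]
  simp_rw [pairing_ofEntries]
  rw [integral_exp_gauss]
  congr 3
  rw [Fintype.sum_prod_type]
  simp [pairing, sq]

theorem integrable_exp_pairing {N : ℕ} (c : Matrix (Fin N) (Fin N) ℝ) :
    Integrable (fun g => Real.exp (pairing c g)) (matrixLaw N) := by
  rw [matrixLaw, integrable_map_measure (measurable_pairing c).exp.aestronglyMeasurable
    measurable_ofEntries.aemeasurable]
  simp_rw [Function.comp_def, pairing_ofEntries]
  exact integrable_exp_gauss _ _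

/-- A linear map of two independent Gaussian matrices that preserves the covariance. -/
theorem map_matrixLaw_prod {N : ℕ}
    {f : Matrix (Fin N) (Fin N) ℝ × Matrix (Fin N) (Fin N) ℝ → Matrix (Fin N) (Fin N) ℝ}
    (hf : Measurable f) (a b : Matrix (Fin N) (Fin N) ℝ → Matrix (Fin N) (Fin N) ℝ)
    (hab : ∀ c p, pairing c (f p) = pairing (a c) p.1 + pairing (b c) p.2)
    (hcov : ∀ c, pairing (a c) (a c) + pairing (b c) (b c) = pairing c c) :
    ((matrixLaw N).prod (matrixLaw N)).map f = matrixLaw N := by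
  let vec : Matrix (Fin N) (Fin N) ℝ → Fin N × Fin N → ℝ := fun A p => A p.1 p.2
  have hvec : Measurable vec := measurable_pi_lambda _ fun p => measurable_entry p.1 p.2
  have key := map_gauss_prod_gauss (v := (N : ℝ≥0)⁻¹) (w := (N : ℝ≥0)⁻¹) (u := (N : ℝ≥0)⁻¹)
    (f := fun p : (Fin N × Fin N → ℝ) × (Fin N × Fin N → ℝ) =>
      vec (f (ofEntries p.1, ofEntries p.2)))
    (hvec.comp (hf.comp ((measurable_ofEntries.comp measurable_fst).prodMk
      (measurable_ofEntries.comp measurable_snd))))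
    (fun c => vec (a (ofEntries c))) (fun c => vec (b (ofEntries c))) (fun c p => by
      have h := hab (ofEntries c) (ofEntries p.1, ofEntries p.2)
      rw [pairing_ofEntries, pairing_ofEntries] at h
      rw [← h, pairing, ← Fintype.sum_prod_type']
      rfl) (fun c => by
      have h := hcov (ofEntries c)
      rw [← mul_add]
      congr 1
      rw [pairing, pairing, pairing] at h
      simp_rw [← sq] at h
      rw [Fintype.sum_prod_type, Fintype.sum_prod_type, Fintype.sum_prod_type]
      exact h)
  have key2 := congrArg (Measure.map ofEntries) key
  have hm : Measurable fun p : (Fin N × Fin N → ℝ) × (Fin N × Fin N → ℝ) =>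
      vec (f (ofEntries p.1, ofEntries p.2)) :=
    hvec.comp (hf.comp (measurable_ofEntries.prodMap measurable_ofEntries))
  rw [Measure.map_map measurable_ofEntries hm] at key2
  rw [matrixLaw, Measure.map_prod_map _ _ measurable_ofEntries measurable_ofEntries,
    Measure.map_map hf (measurable_ofEntries.prodMap measurable_ofEntries)]
  exact key2

/-- A linear map from Gaussian matrices to standard Gaussian vectors. -/
theorem map_matrixLaw_vec {N : ℕ} {f : Matrix (Fin N) (Fin N) ℝ → Fin N → ℝ}
    (hf : Measurable f) (a : (Fin N → ℝ) → Matrix (Fin N) (Fin N) ℝ)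
    (hab : ∀ c A, ∑ i, c i * f A i = pairing (a c) A)
    (hcov : ∀ c, (N : ℝ)⁻¹ * pairing (a c) (a c) = ∑ i, c i ^ 2) :
    (matrixLaw N).map f = gauss (Fin N) 1 := by
  rw [matrixLaw, Measure.map_map hf measurable_ofEntries]
  refine map_gauss (hf.comp measurable_ofEntries) (fun c p => a c p.1 p.2)
    (fun c p => ?_) fun c => ?_
  · rw [← pairing_ofEntries, ← hab]; rfl
  · rw [NNReal.coe_one, one_mul, ← hcov, Fintype.sum_prod_type]
    simp [pairing, sq]

/-! ### The normalized inner product and rank-one matrices -/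

section Inner

variable {N : ℕ}

theorem inner_comm (x y : Fin N → ℝ) : inner x y = inner y x := by
  simp [inner, mul_comm]

theorem inner_add_left (x y z : Fin N → ℝ) : inner (x + y) z = inner x z + inner y z := by
  simp [inner, add_mul, Finset.sum_add_distrib, add_div]

theorem inner_smul_left (c : ℝ) (x z : Fin N → ℝ) : inner (c • x) z = c * inner x z := by
  simp only [inner, Pi.smul_apply, smul_eq_mul, mul_assoc, ← Finset.mul_sum, mul_div_assoc]

theorem inner_sub_left (x y z : Fin N → ℝ) : inner (x - y) z = inner x z - inner y z := by
  simp [inner, sub_mul, Finset.sum_sub_distrib, sub_div]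

theorem inner_sum_left {ι : Type*} (s : Finset ι) (f : ι → Fin N → ℝ) (z : Fin N → ℝ) :
    inner (∑ i ∈ s, f i) z = ∑ i ∈ s, inner (f i) z := by
  classical
  induction s using Finset.induction_on with
  | empty => simp [inner]
  | insert a s ha ih => rw [Finset.sum_insert ha, Finset.sum_insert ha, inner_add_left, ih]

theorem inner_add_right (x y z : Fin N → ℝ) : inner z (x + y) = inner z x + inner z y := by
  rw [inner_comm, inner_add_left, inner_comm x, inner_comm y]

theorem inner_smul_right (c : ℝ) (x z : Fin N → ℝ) : inner z (c • x) = c * inner z x := by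
  rw [inner_comm, inner_smul_left, inner_comm x]

theorem inner_sub_right (x y z : Fin N → ℝ) : inner z (x - y) = inner z x - inner z y := by
  rw [inner_comm, inner_sub_left, inner_comm x, inner_comm y]

theorem inner_sum_right {ι : Type*} (s : Finset ι) (f : ι → Fin N → ℝ) (z : Fin N → ℝ) :
    inner z (∑ i ∈ s, f i) = ∑ i ∈ s, inner z (f i) := by
  rw [inner_comm, inner_sum_left]
  exact Finset.sum_congr rfl fun i _ => inner_comm _ _

@[simp] theorem inner_zero_left (z : Fin N → ℝ) : inner 0 z = 0 := by simp [inner]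

@[simp] theorem inner_zero_right (z : Fin N → ℝ) : inner z 0 = 0 := by simp [inner]

theorem inner_self_nonneg (x : Fin N → ℝ) : 0 ≤ inner x x :=
  div_nonneg (Finset.sum_nonneg fun i _ => mul_self_nonneg (x i)) (Nat.cast_nonneg N)

theorem nrm_sq (x : Fin N → ℝ) : nrm x ^ 2 = inner x x := Real.sq_sqrt (inner_self_nonneg x)

theorem tensor_mulVec (a b x : Fin N → ℝ) : tensor a b *ᵥ x = inner b x • a := by
  ext i
  simp only [Matrix.mulVec, dotProduct, tensor, Matrix.of_apply, Pi.smul_apply, smul_eq_mul, inner]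
  rw [Finset.sum_div, Finset.sum_mul]
  exact Finset.sum_congr rfl fun j _ => by ring

theorem transpose_tensor (a b : Fin N → ℝ) : (tensor a b)ᵀ = tensor b a := by
  ext i j
  simp [tensor, mul_comm]

theorem mul_tensor (A : Matrix (Fin N) (Fin N) ℝ) (a b : Fin N → ℝ) :
    A * tensor a b = tensor (A *ᵥ a) b := by
  ext i j
  simp only [Matrix.mul_apply, tensor, Matrix.of_apply, Matrix.mulVec, dotProduct]
  rw [Finset.sum_mul, Finset.sum_div]
  exact Finset.sum_congr rfl fun k _ => by ring

theorem tensor_mul (A : Matrix (Fin N) (Fin N) ℝ) (a b : Fin N → ℝ) :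
    tensor a b * A = tensor a (Aᵀ *ᵥ b) := by
  rw [← Matrix.transpose_inj, Matrix.transpose_mul, transpose_tensor, mul_tensor, transpose_tensor]

theorem smul_tensor (c : ℝ) (a b : Fin N → ℝ) : tensor (c • a) b = c • tensor a b := by
  ext i j
  simp [tensor, mul_assoc, mul_div_assoc]

theorem inner_mulVec (A : Matrix (Fin N) (Fin N) ℝ) (x y : Fin N → ℝ) :
    inner x (A *ᵥ y) = inner (Aᵀ *ᵥ x) y := by
  have h := Matrix.dotProduct_mulVec x A y
  rw [← Matrix.mulVec_transpose] at h
  exact congrArg (· / (N : ℝ)) h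

end Inner

/-! ### Orthogonality of the directions -/

section Directions

variable (β h : ℝ) {N : ℕ} (g : Matrix (Fin N) (Fin N) ℝ)

/-- Since `0⁻¹ = 0`, normalizing a zero residual gives the zero vector. This dichotomy lets the
linear algebra below hold for every matrix, with no nondegeneracy assumption. -/
theorem inner_self_smul_residual (r : Fin N → ℝ) :
    (nrm r)⁻¹ • r = 0 ∨ inner ((nrm r)⁻¹ • r) ((nrm r)⁻¹ • r) = 1 := by
  rcases eq_or_ne (nrm r) 0 with h0 | h0
  · left; simp [h0]
  · right
    rw [inner_smul_left, inner_smul_right, ← nrm_sq]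
    field_simp

theorem phi_eq_zero_or (k : ℕ) : phi β h g k = 0 ∨ inner (phi β h g k) (phi β h g k) = 1 := by
  cases k with
  | zero =>
    rw [phi_zero]
    rcases Nat.eq_zero_or_pos N with rfl | hN
    · left; exact funext fun i => i.elim0
    · right
      have : (N : ℝ) ≠ 0 := by positivity
      simp [inner, this]
  | succ k => rw [phi_succ]; exact inner_self_smul_residual _

theorem inner_phi_self_le (k : ℕ) : inner (phi β h g k) (phi β h g k) ≤ 1 := by
  rcases phi_eq_zero_or β h g k with h0 | h0
  · simp [h0]
  · exact h0.le

/-- The substitute for ‖φ‖ = 1 that remains valid when the direction vanishes. -/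
theorem inner_phi_self_smul (k : ℕ) :
    inner (phi β h g k) (phi β h g k) • phi β h g k = phi β h g k := by
  rcases phi_eq_zero_or β h g k with h0 | h0 <;> simp [h0]

/-- Gram–Schmidt by strong induction: in the subtracted sum only the term of index s survives, and
it reproduces ⟨φ_s, m⟩ even if φ_s = 0. -/
theorem inner_phi_of_lt {s t : ℕ} (hst : s < t) : inner (phi β h g s) (phi β h g t) = 0 := by
  induction t using Nat.strong_induction_on generalizing s with
  | _ t ih =>
    obtain ⟨t, rfl⟩ := Nat.exists_eq_add_of_lt (Nat.zero_lt_of_lt hst)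
    rw [zero_add] at *
    have hsum : ∑ j : Fin (t + 1), inner (phi β h g s) (inner (mean β h g t) (phi β h g j) •
        phi β h g j) = inner (phi β h g s) (mean β h g t) := by
      rw [Finset.sum_eq_single (⟨s, hst⟩ : Fin (t + 1))]
      · have := congrArg (fun x => inner x (mean β h g t)) (inner_phi_self_smul β h g s)
        simp only [inner_smul_left] at this
        rw [inner_smul_right, inner_comm (mean β h g t), mul_comm, this]
      · intro j _ hj
        rw [inner_smul_right]
        rcases lt_trichotomy (j : ℕ) s with h1 | h1 | h1
        · rw [inner_comm (phi β h g s), ih s hst h1, mul_zero]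
        · exact absurd (Fin.ext h1) hj
        · rw [ih j j.2 h1, mul_zero]
      · simp
    rw [phi_succ, inner_smul_right, inner_sub_right, inner_sum_right, hsum, sub_self, mul_zero]

theorem inner_phi_of_ne {s t : ℕ} (hst : s ≠ t) : inner (phi β h g s) (phi β h g t) = 0 := by
  rcases lt_or_gt_of_ne hst with h1 | h1
  · exact inner_phi_of_lt β h g h1
  · rw [inner_comm]; exact inner_phi_of_lt β h g h1

/-- The projection to the orthogonal complement of `φ_0, …, φ_{k-1}`. -/
def proj (k : ℕ) : Matrix (Fin N) (Fin N) ℝ :=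
  1 - ∑ s ∈ Finset.range k, tensor (phi β h g s) (phi β h g s)

theorem proj_succ (k : ℕ) :
    proj β h g (k + 1) = proj β h g k - tensor (phi β h g k) (phi β h g k) := by
  rw [proj, proj, Finset.sum_range_succ, sub_sub]

theorem transpose_proj (k : ℕ) : (proj β h g k)ᵀ = proj β h g k := by
  simp [proj, Matrix.transpose_sum, transpose_tensor]

theorem proj_mulVec (k : ℕ) (x : Fin N → ℝ) :
    proj β h g k *ᵥ x = x - ∑ s ∈ Finset.range k, inner (phi β h g s) x • phi β h g s := by
  rw [proj, Matrix.sub_mulVec, Matrix.one_mulVec, Matrix.sum_mulVec]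
  simp_rw [tensor_mulVec]

theorem proj_mulVec_phi_of_le {s k : ℕ} (hsk : k ≤ s) :
    proj β h g k *ᵥ phi β h g s = phi β h g s := by
  rw [proj_mulVec, Finset.sum_eq_zero, sub_zero]
  intro t ht
  rw [inner_phi_of_lt β h g ((Finset.mem_range.1 ht).trans_le hsk), zero_smul]

theorem proj_mulVec_phi_of_lt {s k : ℕ} (hsk : s < k) :
    proj β h g k *ᵥ phi β h g s = 0 := by
  rw [proj_mulVec, Finset.sum_eq_single s, inner_phi_self_smul, sub_self]
  · intro t _ hts
    rw [inner_phi_of_ne β h g hts, zero_smul]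
  · intro hs
    exact absurd (Finset.mem_range.2 hsk) hs

theorem proj_mul_proj_of_le {s k : ℕ} (hsk : s ≤ k) :
    proj β h g k * proj β h g s = proj β h g k := by
  nth_rw 2 [proj]
  rw [mul_sub, mul_one, Finset.mul_sum, Finset.sum_eq_zero, sub_zero]
  intro t ht
  rw [mul_tensor, proj_mulVec_phi_of_lt β h g ((Finset.mem_range.1 ht).trans_le hsk)]
  ext i j
  simp [tensor]

theorem proj_mul_proj_of_le' {s k : ℕ} (hsk : s ≤ k) :
    proj β h g s * proj β h g k = proj β h g k := by
  rw [← Matrix.transpose_inj, Matrix.transpose_mul, transpose_proj, transpose_proj,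
    proj_mul_proj_of_le β h g hsk]

/-- With Q = φ ⊗ φ the rank-one corrections are GQ + QG - QGQ. As P Q = Q P = Q for the current
projection P, subtracting them from P g P gives (P - Q) g (P - Q). -/
theorem gIter_eq_proj (k : ℕ) : gIter β h g k = proj β h g k * g * proj β h g k := by
  induction k with
  | zero => simp [gIter_zero, proj]
  | succ k ih =>
    set φ := phi β h g k with hφ
    set Q := tensor φ φ with hQ
    have hPQ : proj β h g k * Q = Q := by
      rw [hQ, mul_tensor, proj_mulVec_phi_of_le β h g le_rfl]
    have hQP : Q * proj β h g k = Q := by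
      rw [hQ, tensor_mul, transpose_proj, proj_mulVec_phi_of_le β h g le_rfl]
    have h1 : tensor (xi β h g k) φ = gIter β h g k * Q := (mul_tensor _ _ _).symm
    have h2 : tensor φ (eta β h g k) = Q * gIter β h g k := (tensor_mul _ _ _).symm
    have h3 : inner φ (xi β h g k) • Q = Q * gIter β h g k * Q := by
      rw [mul_assoc, hQ, mul_tensor, mul_tensor, tensor_mulVec, smul_tensor]; rfl
    rw [gIter_succ, h1, h2, h3, ih, proj_succ]
    calc _ = proj β h g k * g * proj β h g k - proj β h g k * g * (proj β h g k * Q) -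
          (Q * proj β h g k) * g * proj β h g k +
          (Q * proj β h g k) * g * (proj β h g k * Q) := by noncomm_ring
      _ = _ := by rw [hPQ, hQP]; noncomm_ring

theorem xi_eq (k : ℕ) : xi β h g k = proj β h g k *ᵥ (g *ᵥ phi β h g k) := by
  rw [xi, gIter_eq_proj, ← Matrix.mulVec_mulVec, ← Matrix.mulVec_mulVec,
    proj_mulVec_phi_of_le β h g le_rfl]

theorem eta_eq (k : ℕ) : eta β h g k = proj β h g k *ᵥ (gᵀ *ᵥ phi β h g k) := by
  rw [eta, gIter_eq_proj, Matrix.transpose_mul, Matrix.transpose_mul, transpose_proj,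
    ← Matrix.mulVec_mulVec, ← Matrix.mulVec_mulVec, proj_mulVec_phi_of_le β h g le_rfl]

/-! ### Resampling the part of the matrix that is independent of the first `k` steps -/

/-- Replace the part `gIter k` of `g` by that of an independent matrix `x`. -/
def resample (k : ℕ) (g x : Matrix (Fin N) (Fin N) ℝ) : Matrix (Fin N) (Fin N) ℝ :=
  g - proj β h g k * g * proj β h g k + proj β h g k * x * proj β h g k

variable (x : Matrix (Fin N) (Fin N) ℝ)

theorem resample_mulVec_phi {s k : ℕ} (hsk : s < k) :
    resample β h k g x *ᵥ phi β h g s = g *ᵥ phi β h g s := by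
  simp [resample, Matrix.add_mulVec, Matrix.sub_mulVec, ← Matrix.mulVec_mulVec,
    proj_mulVec_phi_of_lt β h g hsk]

theorem resample_transpose_mulVec_phi {s k : ℕ} (hsk : s < k) :
    (resample β h k g x)ᵀ *ᵥ phi β h g s = gᵀ *ᵥ phi β h g s := by
  simp [resample, Matrix.transpose_add, Matrix.transpose_sub, Matrix.transpose_mul,
    Matrix.add_mulVec, Matrix.sub_mulVec, ← Matrix.mulVec_mulVec, transpose_proj,
    proj_mulVec_phi_of_lt β h g hsk]

theorem proj_congr {g g' : Matrix (Fin N) (Fin N) ℝ} {k : ℕ}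
    (hphi : ∀ s < k, phi β h g s = phi β h g' s) : proj β h g k = proj β h g' k := by
  rw [proj, proj]
  congr 1
  exact Finset.sum_congr rfl fun s hs => by rw [hphi s (Finset.mem_range.1 hs)]

/-- The direction φ_s is a function of g φ_t and gᵀ φ_t for t < s, and the resampled block
annihilates these φ_t. The case s = k is included: φ_k is already determined by the first k steps.
-/
theorem phi_resample {s k : ℕ} (hsk : s ≤ k) : phi β h (resample β h k g x) s = phi β h g s := by
  induction s using Nat.strong_induction_on with
  | _ s ih =>
    cases s with
    | zero => rw [phi_zero, phi_zero]
    | succ s =>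
      have hphi : ∀ t ≤ s, phi β h (resample β h k g x) t = phi β h g t :=
        fun t ht => ih t (Nat.lt_succ_of_le ht) (by omega)
      have hz : ∀ t ≤ s, zeta β h (resample β h k g x) t = zeta β h g t := fun t ht => by
        rw [zeta, zeta, xi_eq, xi_eq, eta_eq, eta_eq, hphi t ht,
          proj_congr β h (g' := g) fun j hj => hphi j (by omega),
          resample_mulVec_phi β h g x (by omega), resample_transpose_mulVec_phi β h g x (by omega)]
      have hm : mean β h (resample β h k g x) s = mean β h g s := by
        rw [mean, mean]
        congr 1
        exact funext fun t => hz t (Nat.le_of_lt_succ t.2)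
      rw [phi_succ, phi_succ, hm]
      have : ∀ t : Fin (s + 1), phi β h (resample β h k g x) t = phi β h g t :=
        fun t => hphi t (Nat.le_of_lt_succ t.2)
      simp_rw [this]

/-- The range reaches k + 1 because `proj` at k + 1 involves only φ_0, …, φ_k. -/
theorem proj_resample {s k : ℕ} (hsk : s ≤ k + 1) :
    proj β h (resample β h k g x) s = proj β h g s :=
  proj_congr β h fun t ht => phi_resample β h g x (by omega)

theorem xi_resample {s k : ℕ} (hsk : s < k) : xi β h (resample β h k g x) s = xi β h g s := by
  rw [xi_eq, xi_eq, phi_resample β h g x hsk.le, proj_resample β h g x (by omega),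
    resample_mulVec_phi β h g x hsk]

theorem eta_resample {s k : ℕ} (hsk : s < k) : eta β h (resample β h k g x) s = eta β h g s := by
  rw [eta_eq, eta_eq, phi_resample β h g x hsk.le, proj_resample β h g x (by omega),
    resample_transpose_mulVec_phi β h g x hsk]

theorem zeta_resample {s k : ℕ} (hsk : s < k) :
    zeta β h (resample β h k g x) s = zeta β h g s := by
  rw [zeta, zeta, xi_resample β h g x hsk, eta_resample β h g x hsk]

theorem xi_resample_self (k : ℕ) :
    xi β h (resample β h k g x) k = proj β h g k *ᵥ (x *ᵥ phi β h g k) := by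
  rw [xi_eq, phi_resample β h g x le_rfl, proj_resample β h g x (by omega), resample]
  have := proj_mulVec_phi_of_le β h g (le_refl k)
  simp [Matrix.add_mulVec, Matrix.sub_mulVec, ← Matrix.mulVec_mulVec, this, Matrix.mulVec_add,
    Matrix.mulVec_sub]
  simp [Matrix.mulVec_mulVec, ← mul_assoc, proj_mul_proj_of_le β h g (le_refl k)]

theorem eta_resample_self (k : ℕ) :
    eta β h (resample β h k g x) k = proj β h g k *ᵥ (xᵀ *ᵥ phi β h g k) := by
  rw [eta_eq, phi_resample β h g x le_rfl, proj_resample β h g x (by omega), resample]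
  have := proj_mulVec_phi_of_le β h g (le_refl k)
  simp [Matrix.transpose_add, Matrix.transpose_sub, Matrix.transpose_mul, transpose_proj,
    Matrix.add_mulVec, Matrix.sub_mulVec, ← Matrix.mulVec_mulVec, this, Matrix.mulVec_add,
    Matrix.mulVec_sub]
  simp [Matrix.mulVec_mulVec, ← mul_assoc, proj_mul_proj_of_le β h g (le_refl k)]

/-- Resampling at level k and then at level k + 1 is one resampling at level k, by a matrix x whose
smaller block has been exchanged with that of y. The smaller projection depends on g only, not on x;
this drives the induction in `lintegral_resample`. -/
theorem resample_succ_resample (k : ℕ) (x y : Matrix (Fin N) (Fin N) ℝ) :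
    resample β h (k + 1) (resample β h k g x) y =
      resample β h k g (x - proj β h g (k + 1) * x * proj β h g (k + 1) +
        proj β h g (k + 1) * y * proj β h g (k + 1)) := by
  have h1 := proj_mul_proj_of_le β h g (Nat.le_succ k)
  have h2 := proj_mul_proj_of_le' β h g (Nat.le_succ k)
  rw [resample, proj_resample β h g x le_rfl, resample, resample]
  set R := proj β h g k
  set S := proj β h g (k + 1)
  calc _ = g - R * g * R + R * x * R - S * g * S + (S * R) * g * (R * S) - (S * R) * x * (R * S)
        + S * y * S := by noncomm_ring
    _ = g - R * g * R + R * x * R - (R * S) * x * (S * R) + (R * S) * y * (S * R) := by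
      rw [h1, h2]; noncomm_ring
    _ = _ := by noncomm_ring

end Directions

/-! ### The hyperbolic tangent -/

theorem hasDerivAt_tanh (x : ℝ) : HasDerivAt Real.tanh (1 - Real.tanh x ^ 2) x := by
  have hc : Real.cosh x ≠ 0 := (Real.cosh_pos x).ne'
  have h := (Real.hasDerivAt_sinh x).div (Real.hasDerivAt_cosh x) hc
  have hf : Real.tanh = fun y => Real.sinh y / Real.cosh y :=
    funext fun y => Real.tanh_eq_sinh_div_cosh y
  rw [hf]
  convert! h using 1
  field_simp

theorem differentiable_tanh : Differentiable ℝ Real.tanh :=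
  fun x => (hasDerivAt_tanh x).differentiableAt

theorem continuous_tanh : Continuous Real.tanh := differentiable_tanh.continuous

theorem measurable_tanh : Measurable Real.tanh := continuous_tanh.measurable

theorem abs_tanh_le_one (x : ℝ) : |Real.tanh x| ≤ 1 := (Real.abs_tanh_lt_one x).le

/-! ### Measurability of the iteration -/

section Measurability

variable (β h : ℝ) {N : ℕ}

theorem measurable_inner {α : Type*} [MeasurableSpace α] {f f' : α → Fin N → ℝ}
    (hf : Measurable f) (hf' : Measurable f') : Measurable fun a => inner (f a) (f' a) := by
  unfold inner
  fun_prop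

theorem measurable_nrm {α : Type*} [MeasurableSpace α] {f : α → Fin N → ℝ}
    (hf : Measurable f) : Measurable fun a => nrm (f a) :=
  (measurable_inner hf hf).sqrt

theorem measurable_mulVec {α : Type*} [MeasurableSpace α] {A : α → Matrix (Fin N) (Fin N) ℝ}
    {f : α → Fin N → ℝ} (hA : Measurable A) (hf : Measurable f) :
    Measurable fun a => A a *ᵥ f a :=
  measurable_pi_lambda _ fun i => by
    simp_rw [Matrix.mulVec, dotProduct]
    exact Finset.measurable_sum _ fun j _ =>
      (measurable_entry_of hA i j).mul ((measurable_pi_apply j).comp hf)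

theorem measurable_mean_of {α : Type*} [MeasurableSpace α] {G : α → Matrix (Fin N) (Fin N) ℝ}
    (k : ℕ) (hz : ∀ s ≤ k, Measurable fun a => zeta β h (G a) s) :
    Measurable fun a => mean β h (G a) k := by
  refine measurable_pi_lambda _ fun i => ?_
  have hz' : ∀ s ≤ k, Measurable fun a => zeta β h (G a) s i := fun s hs =>
    (measurable_pi_apply i).comp (hz s hs)
  refine measurable_tanh.comp (((measurable_const).add ?_).add ?_)
  · exact (Finset.measurable_sum _ fun s _ => (hz' _ (by simp)).const_mul _).const_mul _
  · exact (hz' _ (by simp)).const_mul _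

/-- The domain is kept general so that it can also be Ω with the σ-field generated by the first k
steps, where only ξ_s and η_s with s < k are known to be measurable. -/
theorem measurable_phi_of {α : Type*} [MeasurableSpace α] {G : α → Matrix (Fin N) (Fin N) ℝ}
    {k : ℕ} (hxi : ∀ s < k, Measurable fun a => xi β h (G a) s)
    (heta : ∀ s < k, Measurable fun a => eta β h (G a) s) :
    ∀ s ≤ k, Measurable fun a => phi β h (G a) s := by
  intro s
  induction s using Nat.strong_induction_on with
  | _ s ih =>
    intro hs
    cases s with
    | zero => simp_rw [phi_zero]; exact measurable_const
    | succ s =>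
      have hphi : ∀ t ≤ s, Measurable fun a => phi β h (G a) t :=
        fun t ht => ih t (by omega) (by omega)
      have hm := measurable_mean_of β h (G := G) s fun t ht =>
        ((hxi t (by omega)).add (heta t (by omega))).const_smul (√2)⁻¹
      have hr : Measurable fun a => mean β h (G a) s - ∑ t : Fin (s + 1),
          inner (mean β h (G a) s) (phi β h (G a) t) • phi β h (G a) t := by
        refine hm.sub (Finset.measurable_sum _ fun t _ => ?_)
        have ht := hphi t (Nat.le_of_lt_succ t.2)
        exact (measurable_inner hm ht).smul ht
      simp_rw [phi_succ]
      exact (measurable_nrm hr).inv.smul hr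

theorem measurable_proj_of {α : Type*} [MeasurableSpace α] {G : α → Matrix (Fin N) (Fin N) ℝ}
    {k : ℕ} (hphi : ∀ s < k, Measurable fun a => phi β h (G a) s) :
    Measurable fun a => proj β h (G a) k := by
  refine measurable_matrix fun i j => ?_
  simp only [proj, Matrix.sub_apply, Matrix.sum_apply, tensor, Matrix.of_apply]
  refine measurable_const.sub (Finset.measurable_sum _ fun s hs => ?_)
  have := hphi s (Finset.mem_range.1 hs)
  exact (((measurable_pi_apply i).comp this).mul ((measurable_pi_apply j).comp this)).div_const _

theorem measurable_transpose {α : Type*} [MeasurableSpace α] {A : α → Matrix (Fin N) (Fin N) ℝ}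
    (hA : Measurable A) : Measurable fun a => (A a)ᵀ :=
  measurable_matrix fun i j => measurable_entry_of hA j i

theorem measurable_matrix_mul {α : Type*} [MeasurableSpace α]
    {A B : α → Matrix (Fin N) (Fin N) ℝ} (hA : Measurable A) (hB : Measurable B) :
    Measurable fun a => A a * B a :=
  measurable_matrix fun i j => by
    simp_rw [Matrix.mul_apply]
    exact Finset.measurable_sum _ fun k _ => (measurable_entry_of hA i k).mul (measurable_entry_of hB k j)

theorem measurable_matrix_add {α : Type*} [MeasurableSpace α]
    {A B : α → Matrix (Fin N) (Fin N) ℝ} (hA : Measurable A) (hB : Measurable B) :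
    Measurable fun a => A a + B a :=
  measurable_matrix fun i j => (measurable_entry_of hA i j).add (measurable_entry_of hB i j)

theorem measurable_matrix_sub {α : Type*} [MeasurableSpace α]
    {A B : α → Matrix (Fin N) (Fin N) ℝ} (hA : Measurable A) (hB : Measurable B) :
    Measurable fun a => A a - B a :=
  measurable_matrix fun i j => (measurable_entry_of hA i j).sub (measurable_entry_of hB i j)

theorem measurable_phi_xi_eta (k : ℕ) :
    (Measurable fun g : Matrix (Fin N) (Fin N) ℝ => phi β h g k) ∧
    (Measurable fun g : Matrix (Fin N) (Fin N) ℝ => xi β h g k) ∧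
    (Measurable fun g : Matrix (Fin N) (Fin N) ℝ => eta β h g k) := by
  induction k using Nat.strong_induction_on with
  | _ k ih =>
    have h1 : Measurable fun g : Matrix (Fin N) (Fin N) ℝ => phi β h g k :=
      measurable_phi_of β h (G := id) (fun s hs => (ih s hs).2.1) (fun s hs => (ih s hs).2.2) k le_rfl
    have h2 : Measurable fun g : Matrix (Fin N) (Fin N) ℝ => proj β h g k :=
      measurable_proj_of β h (G := id) fun s hs => (ih s hs).1
    refine ⟨h1, ?_, ?_⟩
    · simp_rw [xi_eq]
      exact measurable_mulVec h2 (measurable_mulVec measurable_id h1)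
    · simp_rw [eta_eq]
      exact measurable_mulVec h2 (measurable_mulVec (measurable_transpose measurable_id) h1)

theorem measurable_phi (k : ℕ) : Measurable fun g : Matrix (Fin N) (Fin N) ℝ => phi β h g k :=
  (measurable_phi_xi_eta β h k).1

theorem measurable_xi (k : ℕ) : Measurable fun g : Matrix (Fin N) (Fin N) ℝ => xi β h g k :=
  (measurable_phi_xi_eta β h k).2.1

theorem measurable_eta (k : ℕ) : Measurable fun g : Matrix (Fin N) (Fin N) ℝ => eta β h g k :=
  (measurable_phi_xi_eta β h k).2.2

theorem measurable_zeta (k : ℕ) : Measurable fun g : Matrix (Fin N) (Fin N) ℝ => zeta β h g k :=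
  ((measurable_xi β h k).add (measurable_eta β h k)).const_smul (√2)⁻¹

theorem measurable_proj (k : ℕ) : Measurable fun g : Matrix (Fin N) (Fin N) ℝ => proj β h g k :=
  measurable_proj_of β h (G := id) fun s _ => measurable_phi β h s

theorem measurable_resample (k : ℕ) :
    Measurable fun p : Matrix (Fin N) (Fin N) ℝ × Matrix (Fin N) (Fin N) ℝ =>
      resample β h k p.1 p.2 := by
  have hp : Measurable fun p : Matrix (Fin N) (Fin N) ℝ × Matrix (Fin N) (Fin N) ℝ =>
    proj β h p.1 k := (measurable_proj β h k).comp measurable_fst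
  exact measurable_matrix_add (measurable_matrix_sub measurable_fst
    (measurable_matrix_mul (measurable_matrix_mul hp measurable_fst) hp))
    (measurable_matrix_mul (measurable_matrix_mul hp measurable_snd) hp)

end Measurability

/-! ### Invariance of the Gaussian law under resampling -/

section Resample

variable (β h : ℝ) {N : ℕ}

theorem pairing_eq_trace (c A : Matrix (Fin N) (Fin N) ℝ) : pairing c A = (cᵀ * A).trace := by
  simp only [pairing, Matrix.trace, Matrix.diag, Matrix.mul_apply, Matrix.transpose_apply]
  exact Finset.sum_comm

theorem pairing_comm (c A : Matrix (Fin N) (Fin N) ℝ) : pairing c A = pairing A c := by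
  simp [pairing, mul_comm]

theorem pairing_add (c A B : Matrix (Fin N) (Fin N) ℝ) :
    pairing c (A + B) = pairing c A + pairing c B := by
  simp [pairing, mul_add, Finset.sum_add_distrib]

theorem pairing_sub (c A B : Matrix (Fin N) (Fin N) ℝ) :
    pairing c (A - B) = pairing c A - pairing c B := by
  simp [pairing, mul_sub, Finset.sum_sub_distrib]

theorem pairing_mul_mul {S T : Matrix (Fin N) (Fin N) ℝ} (hS : Sᵀ = S) (hT : Tᵀ = T)
    (c A : Matrix (Fin N) (Fin N) ℝ) : pairing c (S * A * T) = pairing (S * c * T) A := by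
  rw [pairing_eq_trace, pairing_eq_trace, Matrix.transpose_mul, Matrix.transpose_mul, hS, hT,
    ← mul_assoc, Matrix.trace_mul_comm, ← mul_assoc, ← mul_assoc, ← mul_assoc]

/-- For a symmetric idempotent S the maps c ↦ c - ScS and c ↦ ScS split c orthogonally in the
Frobenius inner product, so the covariance is preserved by Pythagoras. -/
theorem map_resample_two_sided {S : Matrix (Fin N) (Fin N) ℝ} (hS : Sᵀ = S) (hSS : S * S = S) :
    ((matrixLaw N).prod (matrixLaw N)).map (fun p => p.1 - S * p.1 * S + S * p.2 * S) =
      matrixLaw N := by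
  refine map_matrixLaw_prod ?_ (fun c => c - S * c * S) (fun c => S * c * S) (fun c p => ?_)
    fun c => ?_
  · have hm : Measurable fun _ : Matrix (Fin N) (Fin N) ℝ × Matrix (Fin N) (Fin N) ℝ => S :=
      measurable_const
    exact measurable_matrix_add (measurable_matrix_sub measurable_fst
      (measurable_matrix_mul (measurable_matrix_mul hm measurable_fst) hm))
      (measurable_matrix_mul (measurable_matrix_mul hm measurable_snd) hm)
  · rw [pairing_add, pairing_sub, pairing_mul_mul hS hS, pairing_mul_mul hS hS,
      pairing_comm (c - _), pairing_sub, pairing_comm p.1, pairing_comm p.1]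
  · have h1 : S * (S * c * S) * S = S * c * S := by
      rw [← mul_assoc, ← mul_assoc, hSS, mul_assoc, hSS]
    have h2 : pairing (S * c * S) (S * c * S) = pairing c (S * c * S) := by
      rw [pairing_mul_mul hS hS, h1, pairing_comm]
    rw [pairing_sub, pairing_comm _ c, pairing_comm _ (S * c * S), pairing_sub, pairing_sub, h2,
      pairing_comm (S * c * S) c]
    ring

theorem map_resample_right {Q : Matrix (Fin N) (Fin N) ℝ} (hQ : Qᵀ = Q) (hQQ : Q * Q = Q) :
    ((matrixLaw N).prod (matrixLaw N)).map (fun p => p.1 * Q + p.2 * (1 - Q)) =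
      matrixLaw N := by
  have hQ' : (1 - Q)ᵀ = 1 - Q := by rw [Matrix.transpose_sub, hQ, Matrix.transpose_one]
  have hQQ' : (1 - Q) * (1 - Q) = 1 - Q := by noncomm_ring [hQQ]
  have key : ∀ {S : Matrix (Fin N) (Fin N) ℝ} (_ : Sᵀ = S) (c A : Matrix (Fin N) (Fin N) ℝ),
      pairing c (A * S) = pairing (c * S) A := fun hS c A => by
    have := pairing_mul_mul (Matrix.transpose_one) hS c A
    simpa using this
  refine map_matrixLaw_prod ?_ (fun c => c * Q) (fun c => c * (1 - Q)) (fun c p => ?_)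
    fun c => ?_
  · exact measurable_matrix_add (measurable_matrix_mul measurable_fst measurable_const)
      (measurable_matrix_mul measurable_snd measurable_const)
  · rw [pairing_add, key hQ, key hQ']
  · rw [key hQ, key hQ', mul_assoc, mul_assoc, hQQ, hQQ', pairing_comm, pairing_comm _ c,
      ← pairing_add, ← mul_add]
    simp

theorem proj_mul_self (g : Matrix (Fin N) (Fin N) ℝ) (k : ℕ) :
    proj β h g k * proj β h g k = proj β h g k := proj_mul_proj_of_le β h g le_rfl

/-- Resampling the part `gIter k` of a Gaussian matrix does not change its law. -/
theorem lintegral_resample (k : ℕ) {F : Matrix (Fin N) (Fin N) ℝ → ENNReal} (hF : Measurable F) :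
    ∫⁻ g, F g ∂(matrixLaw N) =
      ∫⁻ g, ∫⁻ x, F (resample β h k g x) ∂(matrixLaw N) ∂(matrixLaw N) := by
  induction k generalizing F with
  | zero => simp [resample, proj]
  | succ k ih =>
    have hF' : Measurable fun p : Matrix (Fin N) (Fin N) ℝ × Matrix (Fin N) (Fin N) ℝ =>
        F (resample β h (k + 1) p.1 p.2) := hF.comp (measurable_resample β h (k + 1))
    -- Both sides are averaged at level k first. With g fixed, the projection of level k + 1 is a
    -- constant matrix, and the invariance for deterministic projections applies to x.
    rw [ih hF, ih (F := fun g => ∫⁻ x, F (resample β h (k + 1) g x) ∂(matrixLaw N))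
      hF'.lintegral_prod_right']
    refine lintegral_congr fun g => ?_
    have hg : Measurable fun x => F (resample β h k g x) :=
      hF.comp ((measurable_resample β h k).comp (measurable_const.prodMk measurable_id))
    have hm := map_resample_two_sided (transpose_proj β h g (k + 1)) (proj_mul_self β h g (k + 1))
    have hmeas : Measurable fun p : Matrix (Fin N) (Fin N) ℝ × Matrix (Fin N) (Fin N) ℝ =>
        p.1 - proj β h g (k + 1) * p.1 * proj β h g (k + 1) +
          proj β h g (k + 1) * p.2 * proj β h g (k + 1) :=
      measurable_matrix_add (measurable_matrix_sub measurable_fst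
        (measurable_matrix_mul (measurable_matrix_mul measurable_const measurable_fst)
          measurable_const))
        (measurable_matrix_mul (measurable_matrix_mul measurable_const measurable_snd)
          measurable_const)
    conv_lhs => rw [← hm]
    rw [lintegral_map hg hmeas, lintegral_prod]
    swap
    · exact (hg.comp hmeas).aemeasurable
    simp_rw [resample_succ_resample]

/-- The direction `φ_k`, replaced by the constant vector if it vanishes. -/
def unitDir (k : ℕ) (g : Matrix (Fin N) (Fin N) ℝ) : Fin N → ℝ :=
  open Classical in if phi β h g k = 0 then fun _ => 1 else phi β h g k

theorem inner_unitDir_self (hN : N ≠ 0) (k : ℕ) (g : Matrix (Fin N) (Fin N) ℝ) :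
    inner (unitDir β h k g) (unitDir β h k g) = 1 := by
  have : (N : ℝ) ≠ 0 := by positivity
  rw [unitDir]
  split_ifs with h0
  · simp [inner, this]
  · exact (phi_eq_zero_or β h g k).resolve_left h0

/-- The normalizations agree: a φ with ⟨φ, φ⟩ = 1 has N as its sum of squares, which compensates the
entry variance 1/N. -/
theorem map_mulVec_matrixLaw (φ : Fin N → ℝ) (hφ : inner φ φ = 1) :
    (matrixLaw N).map (fun A => A *ᵥ φ) = gauss (Fin N) 1 := by
  refine map_matrixLaw_vec (measurable_mulVec measurable_id measurable_const)
    (fun c => Matrix.of fun i j => c i * φ j) (fun c A => ?_) fun c => ?_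
  · simp only [pairing, Matrix.mulVec, dotProduct, Finset.mul_sum, Matrix.of_apply]
    exact Finset.sum_congr rfl fun i _ => Finset.sum_congr rfl fun j _ => by ring
  · have : pairing (Matrix.of fun i j => c i * φ j) (Matrix.of fun i j => c i * φ j) =
        (∑ i, c i ^ 2) * ∑ j, φ j * φ j := by
      rw [Finset.sum_mul]
      simp only [pairing, Matrix.of_apply, Finset.mul_sum]
      exact Finset.sum_congr rfl fun i _ => Finset.sum_congr rfl fun j _ => by ring
    rw [this, mul_left_comm, inv_mul_eq_div]
    rw [inner] at hφ
    rw [hφ, mul_one]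

theorem map_transpose_mulVec_matrixLaw (φ : Fin N → ℝ) (hφ : inner φ φ = 1) :
    (matrixLaw N).map (fun A => Aᵀ *ᵥ φ) = gauss (Fin N) 1 := by
  refine map_matrixLaw_vec (measurable_mulVec (measurable_transpose measurable_id) measurable_const)
    (fun c => Matrix.of fun i j => φ i * c j) (fun c A => ?_) fun c => ?_
  · simp only [pairing, Matrix.mulVec, dotProduct, Finset.mul_sum, Matrix.of_apply,
      Matrix.transpose_apply]
    rw [Finset.sum_comm]
    exact Finset.sum_congr rfl fun i _ => Finset.sum_congr rfl fun j _ => by ring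
  · have : pairing (Matrix.of fun i j => φ i * c j) (Matrix.of fun i j => φ i * c j) =
        (∑ i, c i ^ 2) * ∑ j, φ j * φ j := by
      rw [mul_comm, Finset.sum_mul]
      simp only [pairing, Matrix.of_apply, Finset.mul_sum]
      exact Finset.sum_congr rfl fun i _ => Finset.sum_congr rfl fun j _ => by ring
    rw [this, mul_left_comm, inv_mul_eq_div]
    rw [inner] at hφ
    rw [hφ, mul_one]

/-- `ξ_k` in terms of the first `k` steps and an independent Gaussian vector. -/
def xiRep (k : ℕ) (g : Matrix (Fin N) (Fin N) ℝ) (u : Fin N → ℝ) : Fin N → ℝ :=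
  inner (phi β h g k) (phi β h g k) • proj β h g k *ᵥ u

/-- `η_k` in terms of the first `k` steps and two independent Gaussian vectors. -/
def etaRep (k : ℕ) (g : Matrix (Fin N) (Fin N) ℝ) (u v : Fin N → ℝ) : Fin N → ℝ :=
  inner (phi β h g k) (phi β h g k) • proj β h g k *ᵥ
    (v + (inner (phi β h g k) u - inner (phi β h g k) v) • phi β h g k)

/-- The law of step `k` of the iteration given the previous steps. -/
theorem lintegral_step (hN : N ≠ 0) (k : ℕ) {F : Matrix (Fin N) (Fin N) ℝ → ENNReal}
    (hF : Measurable F)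
    {H : Matrix (Fin N) (Fin N) ℝ → (Fin N → ℝ) × (Fin N → ℝ) → ENNReal}
    (hH : ∀ g, Measurable (H g))
    (hFH : ∀ g x, F (resample β h k g x) =
      H g (xi β h (resample β h k g x) k, eta β h (resample β h k g x) k)) :
    ∫⁻ g, F g ∂(matrixLaw N) =
      ∫⁻ g, ∫⁻ p, H g (xiRep β h k g p.1, etaRep β h k g p.1 p.2)
        ∂((gauss (Fin N) 1).prod (gauss (Fin N) 1)) ∂(matrixLaw N) := by
  rw [lintegral_resample β h k hF]
  refine lintegral_congr fun g => ?_
  -- A vanishing direction is replaced by a dummy unit vector, so that the Gaussian laws below are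
  -- available in every case; the factor ⟨φ_k, φ_k⟩ in `xiRep` and `etaRep` then erases its
  -- contribution.
  set φ := unitDir β h k g with hφ
  have hφ1 := inner_unitDir_self β h hN k g
  -- Write the fresh matrix as p.1 Q + p.2 (1 - Q) with Q = φ ⊗ φ. Its action on φ uses p.1 alone.
  -- Its transpose applied to φ uses p.2, except for the component along φ, which ξ and η share;
  -- this is the correction term in `etaRep`.
  have hm := map_resample_right (transpose_tensor φ φ)
    (by rw [mul_tensor, tensor_mulVec, hφ1, one_smul])
  have hg : Measurable fun x => F (resample β h k g x) :=
    hF.comp ((measurable_resample β h k).comp (measurable_const.prodMk measurable_id))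
  have hmeas : Measurable fun p : Matrix (Fin N) (Fin N) ℝ × Matrix (Fin N) (Fin N) ℝ =>
      p.1 * tensor φ φ + p.2 * (1 - tensor φ φ) :=
    measurable_matrix_add (measurable_matrix_mul measurable_fst measurable_const)
      (measurable_matrix_mul measurable_snd measurable_const)
  conv_lhs => rw [← hm]
  have hu : Measurable fun A : Matrix (Fin N) (Fin N) ℝ => A *ᵥ φ :=
    measurable_mulVec measurable_id measurable_const
  have hv : Measurable fun A : Matrix (Fin N) (Fin N) ℝ => Aᵀ *ᵥ φ :=
    measurable_mulVec (measurable_transpose measurable_id) measurable_const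
  have hproj : ∀ {f : (Fin N → ℝ) × (Fin N → ℝ) → Fin N → ℝ}, Measurable f →
      Measurable fun p => inner (phi β h g k) (phi β h g k) • proj β h g k *ᵥ f p := fun hf =>
    (measurable_mulVec (A := fun _ => proj β h g k) measurable_const hf).fun_const_smul _
  have hrep : Measurable fun p : (Fin N → ℝ) × (Fin N → ℝ) =>
      H g (xiRep β h k g p.1, etaRep β h k g p.1 p.2) := by
    refine (hH g).comp ((hproj measurable_fst).prodMk (hproj ?_))
    exact measurable_snd.add (((measurable_inner measurable_const measurable_fst).sub
      (measurable_inner measurable_const measurable_snd)).smul_const _)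
  have hprod : (gauss (Fin N) 1).prod (gauss (Fin N) 1) = ((matrixLaw N).prod (matrixLaw N)).map
      (Prod.map (fun A => A *ᵥ φ) (fun A => Aᵀ *ᵥ φ)) := by
    rw [← Measure.map_prod_map _ _ hu hv, map_mulVec_matrixLaw φ hφ1,
      map_transpose_mulVec_matrixLaw φ hφ1]
  rw [lintegral_map hg hmeas, hprod, lintegral_map hrep (hu.prodMap hv)]
  refine lintegral_congr fun p => ?_
  rw [hFH, xi_resample_self, eta_resample_self]
  congr 2
  · rcases phi_eq_zero_or β h g k with h0 | h0
    · simp [xiRep, h0]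
    · have hφ2 : φ = phi β h g k := by
        rw [hφ, unitDir, if_neg]; rintro h1; simp [h1] at h0
      rw [xiRep, h0, one_smul, Prod.map_fst, ← hφ2]
      congr 1
      simp [Matrix.add_mulVec, ← Matrix.mulVec_mulVec, Matrix.sub_mulVec, tensor_mulVec, hφ2, h0]
  · rcases phi_eq_zero_or β h g k with h0 | h0
    · simp [etaRep, h0]
    · have hφ2 : φ = phi β h g k := by
        rw [hφ, unitDir, if_neg]; rintro h1; simp [h1] at h0
      rw [etaRep, h0, one_smul, Prod.map_fst, Prod.map_snd, ← hφ2]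
      congr 1
      simp only [Matrix.transpose_add, Matrix.transpose_mul, transpose_tensor, Matrix.add_mulVec,
        ← Matrix.mulVec_mulVec, tensor_mulVec, Matrix.transpose_sub, Matrix.transpose_one,
        Matrix.sub_mulVec, Matrix.one_mulVec, sub_smul]
      rw [inner_mulVec p.1, inner_comm (p.1ᵀ *ᵥ φ)]
      abel

end Resample

/-! ### Elementary inequalities for hyperbolic functions -/

theorem lipschitz_tanh (x y : ℝ) : |Real.tanh x - Real.tanh y| ≤ |x - y| := by
  have h := Convex.norm_image_sub_le_of_norm_deriv_le (f := Real.tanh) (C := 1) (s := Set.univ)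
    (x := y) (y := x) (fun z _ => differentiable_tanh z) (fun z _ => by
      rw [(hasDerivAt_tanh z).deriv, Real.norm_eq_abs, abs_le]
      constructor <;> nlinarith [Real.tanh_sq_lt_one z, sq_nonneg (Real.tanh z)]) convex_univ
    (Set.mem_univ _) (Set.mem_univ _)
  simpa using h

theorem hasDerivAt_log_cosh (x : ℝ) :
    HasDerivAt (fun y => Real.log (Real.cosh y)) (Real.tanh x) x := by
  have h := (Real.hasDerivAt_cosh x).log (Real.cosh_pos x).ne'
  rwa [← Real.tanh_eq_sinh_div_cosh] at h

theorem lipschitz_log_cosh (x y : ℝ) :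
    |Real.log (Real.cosh x) - Real.log (Real.cosh y)| ≤ |x - y| := by
  have h := Convex.norm_image_sub_le_of_norm_deriv_le (f := fun z => Real.log (Real.cosh z))
    (C := 1) (s := Set.univ) (x := y) (y := x)
    (fun z _ => (hasDerivAt_log_cosh z).differentiableAt) (fun z _ => by
      rw [(hasDerivAt_log_cosh z).deriv]
      exact abs_tanh_le_one z) convex_univ (Set.mem_univ _) (Set.mem_univ _)
  simpa using h

theorem continuous_log_cosh : Continuous fun x => Real.log (Real.cosh x) :=
  continuous_iff_continuousAt.2 fun x => (hasDerivAt_log_cosh x).continuousAt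

theorem log_cosh_nonneg (x : ℝ) : 0 ≤ Real.log (Real.cosh x) :=
  Real.log_nonneg (Real.one_le_cosh x)

theorem log_cosh_le (x : ℝ) : Real.log (Real.cosh x) ≤ x ^ 2 / 2 :=
  (Real.log_le_iff_le_exp (Real.cosh_pos x)).2 (Real.cosh_le_exp_half_sq x)

theorem one_add_sq_div_two_le_cosh (y : ℝ) : 1 + y ^ 2 / 2 ≤ Real.cosh y := by
  have h1 : (y / 2) ^ 2 ≤ Real.sinh (y / 2) ^ 2 := by
    rcases le_total 0 (y / 2) with h0 | h0
    · exact pow_le_pow_left₀ h0 (Real.self_le_sinh_iff.2 h0) 2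
    · have h2 : 0 ≤ -(y / 2) := by linarith
      have h3 := pow_le_pow_left₀ h2 (Real.self_le_sinh_iff.2 h2) 2
      rwa [Real.sinh_neg, neg_sq, neg_sq] at h3
  have h4 := Real.cosh_two_mul (y / 2)
  rw [mul_div_cancel₀ y two_ne_zero] at h4
  nlinarith [Real.cosh_sq (y / 2)]

/-- With u = y²/2, this combines cosh y ≥ 1 + u with log(1 + u) ≥ 2u/(u + 2) ≥ u - u²/2. -/
theorem le_log_cosh (y : ℝ) : y ^ 2 / 2 - y ^ 4 / 8 ≤ Real.log (Real.cosh y) := by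
  have h1 : 1 + y ^ 2 / 2 ≤ Real.cosh y := one_add_sq_div_two_le_cosh y
  have h2 : Real.log (1 + y ^ 2 / 2) ≤ Real.log (Real.cosh y) :=
    Real.log_le_log (by positivity) h1
  have h3 := Real.le_log_one_add_of_nonneg (x := y ^ 2 / 2) (by positivity)
  refine le_trans ?_ (h3.trans h2)
  rw [le_div_iff₀ (by positivity)]
  nlinarith [sq_nonneg (y ^ 2), sq_nonneg (y ^ 3)]

theorem one_sub_tanh_sq (x : ℝ) : 1 - Real.tanh x ^ 2 = (Real.cosh x ^ 2)⁻¹ := by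
  have hc : Real.cosh x ≠ 0 := (Real.cosh_pos x).ne'
  rw [Real.tanh_eq_sinh_div_cosh]
  field_simp
  linarith [Real.cosh_sq_sub_sinh_sq x]

theorem cosh_add_mul_cosh_sub (x y : ℝ) :
    Real.cosh (x + y) * Real.cosh (x - y) = Real.cosh x ^ 2 + Real.sinh y ^ 2 := by
  rw [Real.cosh_add, Real.cosh_sub]
  nlinarith [Real.cosh_sq_sub_sinh_sq x, Real.cosh_sq_sub_sinh_sq y]

/-- An exact formula resting on cosh(x+y) cosh(x-y) = cosh² x + sinh² y. It isolates the weight 1 -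
tanh² x, whose Gaussian average becomes 1 - q at the fixed point, and avoids differentiating under
the integral. -/
theorem log_cosh_second_difference (x y : ℝ) :
    Real.log (Real.cosh (x + y)) + Real.log (Real.cosh (x - y)) - 2 * Real.log (Real.cosh x) =
      Real.log (1 + (1 - Real.tanh x ^ 2) * Real.sinh y ^ 2) := by
  have hc := Real.cosh_pos x
  rw [← Real.log_mul (Real.cosh_pos _).ne' (Real.cosh_pos _).ne', cosh_add_mul_cosh_sub,
    show 2 * Real.log (Real.cosh x) = Real.log (Real.cosh x ^ 2) by rw [Real.log_pow]; norm_num,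
    ← Real.log_div (by positivity) (by positivity), one_sub_tanh_sq]
  congr 1
  field_simp

theorem one_sub_tanh_sq_mem (x : ℝ) : 0 ≤ 1 - Real.tanh x ^ 2 ∧ 1 - Real.tanh x ^ 2 ≤ 1 :=
  ⟨by linarith [Real.tanh_sq_lt_one x], by linarith [sq_nonneg (Real.tanh x)]⟩

theorem log_one_add_sinh_sq (y : ℝ) :
    Real.log (1 + Real.sinh y ^ 2) = 2 * Real.log (Real.cosh y) := by
  rw [add_comm, ← Real.cosh_sq, Real.log_pow]; norm_num

/-- Concavity of the logarithm gives log(1 + pS) ≥ p log(1 + S) for p in [0, 1]; with S = sinh² y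
the right side is 2p log cosh y. -/
theorem le_log_cosh_second_difference (x y : ℝ) :
    (1 - Real.tanh x ^ 2) * (y ^ 2 - y ^ 4 / 4) ≤
      Real.log (Real.cosh (x + y)) + Real.log (Real.cosh (x - y)) -
        2 * Real.log (Real.cosh x) := by
  rw [log_cosh_second_difference]
  obtain ⟨h0, h1⟩ := one_sub_tanh_sq_mem x
  set p := 1 - Real.tanh x ^ 2
  have hconc := strictConcaveOn_log_Ioi.concaveOn.2 (x := 1 + Real.sinh y ^ 2) (y := 1)
    (Set.mem_Ioi.2 (by positivity)) (Set.mem_Ioi.2 one_pos) h0 (sub_nonneg.2 h1) (by ring)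
  simp only [smul_eq_mul, Real.log_one, mul_zero, add_zero, mul_one] at hconc
  rw [show p * (1 + Real.sinh y ^ 2) + (1 - p) = 1 + p * Real.sinh y ^ 2 by ring,
    log_one_add_sinh_sq] at hconc
  refine le_trans ?_ hconc
  exact mul_le_mul_of_nonneg_left (by linarith [le_log_cosh y]) h0

/-- For |y| ≤ 1 use log(1 + u) ≤ u and sinh² y ≤ y² + y⁴; for |y| ≥ 1 replace the weight by 1 and
use 2 log cosh y ≤ y² ≤ y⁴. -/
theorem log_cosh_second_difference_le (x y : ℝ) :
    Real.log (Real.cosh (x + y)) + Real.log (Real.cosh (x - y)) - 2 * Real.log (Real.cosh x) ≤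
      (1 - Real.tanh x ^ 2) * y ^ 2 + y ^ 4 := by
  rw [log_cosh_second_difference]
  obtain ⟨h0, h1⟩ := one_sub_tanh_sq_mem x
  set p := 1 - Real.tanh x ^ 2
  have hy : y ^ 4 = (y ^ 2) ^ 2 := by ring
  rcases le_total (y ^ 2) 1 with h2 | h2
  · have h3 : Real.sinh y ^ 2 ≤ y ^ 2 + y ^ 4 := by
      have h4 : Real.cosh y ^ 2 ≤ Real.exp (y ^ 2) := by
        have := pow_le_pow_left₀ (Real.cosh_pos y).le (Real.cosh_le_exp_half_sq y) 2
        rwa [← Real.exp_nat_mul, show ((2 : ℕ) : ℝ) * (y ^ 2 / 2) = y ^ 2 by push_cast; ring]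
          at this
      have h5 := (le_abs_self _).trans
        (Real.abs_exp_sub_one_sub_id_le (x := y ^ 2) (by rwa [abs_of_nonneg (sq_nonneg y)]))
      linarith [Real.cosh_sq y]
    have h6 := Real.log_le_sub_one_of_pos (x := 1 + p * Real.sinh y ^ 2) (by positivity)
    nlinarith [mul_le_mul_of_nonneg_left h3 h0, sq_nonneg (y ^ 2)]
  · have h3 : Real.log (1 + p * Real.sinh y ^ 2) ≤ Real.log (1 + Real.sinh y ^ 2) :=
      Real.log_le_log (by positivity) (by nlinarith [sq_nonneg (Real.sinh y)])
    rw [log_one_add_sinh_sq] at h3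
    nlinarith [log_cosh_le y, mul_nonneg h0 (sq_nonneg y)]

theorem tanh_add_tanh_sub (x y : ℝ) : Real.tanh (x + y) + Real.tanh (x - y) =
    2 * Real.sinh x * Real.cosh x / (Real.cosh x ^ 2 + Real.sinh y ^ 2) := by
  have h1 := (Real.cosh_pos (x + y)).ne'
  have h2 := (Real.cosh_pos (x - y)).ne'
  rw [Real.tanh_eq_sinh_div_cosh, Real.tanh_eq_sinh_div_cosh, div_add_div _ _ h1 h2,
    cosh_add_mul_cosh_sub]
  congr 1
  rw [Real.sinh_add, Real.sinh_sub, Real.cosh_add, Real.cosh_sub]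
  have := Real.cosh_sq_sub_sinh_sq y
  linear_combination (2 * Real.sinh x * Real.cosh x) * this

/-- Around c = tanh x, a² + b² - 2c² = (a-c)² + (b-c)² + 2c(a + b - 2c). The squares are bounded by
the Lipschitz property and the last term is nonpositive. -/
theorem tanh_sq_second_difference_le (x y : ℝ) :
    Real.tanh (x + y) ^ 2 + Real.tanh (x - y) ^ 2 - 2 * Real.tanh x ^ 2 ≤ 2 * y ^ 2 := by
  have h1 : (Real.tanh (x + y) - Real.tanh x) ^ 2 ≤ y ^ 2 := by
    have := lipschitz_tanh (x + y) x
    rw [add_sub_cancel_left] at this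
    exact sq_le_sq.2 this
  have h2 : (Real.tanh (x - y) - Real.tanh x) ^ 2 ≤ y ^ 2 := by
    have := lipschitz_tanh (x - y) x
    rw [sub_sub_cancel_left, abs_neg] at this
    exact sq_le_sq.2 this
  have hc := Real.cosh_pos x
  have h3 : Real.tanh x * (Real.tanh (x + y) + Real.tanh (x - y)) ≤ 2 * Real.tanh x ^ 2 := by
    rw [tanh_add_tanh_sub, Real.tanh_eq_sinh_div_cosh, div_pow]
    have : Real.sinh x / Real.cosh x * (2 * Real.sinh x * Real.cosh x /
        (Real.cosh x ^ 2 + Real.sinh y ^ 2)) =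
        2 * (Real.sinh x ^ 2 / (Real.cosh x ^ 2 + Real.sinh y ^ 2)) := by field_simp
    rw [this]
    gcongr
    nlinarith [sq_nonneg (Real.sinh y)]
  nlinarith

/-- The sub-Gaussian bound for a spin with mean `tanh b`. -/
theorem cosh_add_le (b w : ℝ) :
    Real.cosh (b + w) ≤ Real.cosh b * Real.exp (w * Real.tanh b + w ^ 2 / 2) := by
  -- The logarithmic gap f vanishes at 0 and has derivative w - (tanh(b+w) - tanh b), which has the
  -- sign of w because tanh is 1-Lipschitz; hence 0 is its minimum.
  have hmono : ∀ f : ℝ → ℝ, f = (fun w => w * Real.tanh b + w ^ 2 / 2 + Real.log (Real.cosh b) -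
      Real.log (Real.cosh (b + w))) → ∀ w, 0 ≤ f w := by
    intro f hf w
    have hd : ∀ w, HasDerivAt f (Real.tanh b + w - Real.tanh (b + w)) w := fun w => by
      have h1 := (hasDerivAt_log_cosh (b + w)).comp w ((hasDerivAt_id w).const_add b)
      have h2 := ((((hasDerivAt_id w).mul_const (Real.tanh b)).add
        (((hasDerivAt_id w).pow 2).div_const 2)).add_const (Real.log (Real.cosh b))).sub h1
      rw [hf]
      convert! h2 using 1
      simp
    have hcont : Continuous f := continuous_iff_continuousAt.2 fun w => (hd w).continuousAt
    have h0 : f 0 = 0 := by simp [hf]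
    have hLip := fun w => lipschitz_tanh (b + w) b
    simp only [add_sub_cancel_left] at hLip
    rcases le_total 0 w with hw | hw
    · have := monotoneOn_of_deriv_nonneg (convex_Ici (0 : ℝ)) hcont.continuousOn
        (fun x _ => (hd x).differentiableAt.differentiableWithinAt) (fun x hx => by
          rw [interior_Ici, Set.mem_Ioi] at hx
          rw [(hd x).deriv]
          have := (abs_le.1 (hLip x)).2
          rw [abs_of_pos hx] at this
          linarith)
      rw [← h0]; exact this Set.self_mem_Ici hw hw
    · have := antitoneOn_of_deriv_nonpos (convex_Iic (0 : ℝ)) hcont.continuousOn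
        (fun x _ => (hd x).differentiableAt.differentiableWithinAt) (fun x hx => by
          rw [interior_Iic, Set.mem_Iio] at hx
          rw [(hd x).deriv]
          have := (abs_le.1 (hLip x)).1
          rw [abs_of_neg hx] at this
          linarith)
      rw [← h0]; exact this hw Set.self_mem_Iic hw
  have h := hmono _ rfl w
  calc Real.cosh (b + w) = Real.exp (Real.log (Real.cosh (b + w))) :=
        (Real.exp_log (Real.cosh_pos _)).symm
    _ ≤ Real.exp (Real.log (Real.cosh b) + (w * Real.tanh b + w ^ 2 / 2)) :=
        Real.exp_le_exp.2 (by linarith)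
    _ = _ := by rw [Real.exp_add, Real.exp_log (Real.cosh_pos b)]

/-! ### Laws of linear forms of Gaussian vectors -/

theorem integral_linearForm_gauss {k : ℕ} {a : Fin k → ℝ} {q : ℝ} (hq : ∑ i, a i ^ 2 = q)
    {F : ℝ → ℝ} (hF : Continuous F) :
    ∫ x, F (∑ i, a i * x i) ∂(gauss (Fin k) 1) = ∫ x, F (√q * x) ∂(gaussianReal 0 1) := by
  have hq0 : 0 ≤ q := hq ▸ Finset.sum_nonneg fun i _ => sq_nonneg _
  have h1 := map_linearForm_gauss 1 a (NNReal.mk q hq0) (by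
    rw [NNReal.coe_mk, NNReal.coe_one, one_mul, hq])
  have h2 := gaussianReal_map_const_mul (μ := 0) (v := 1) (√q)
  have h3 : NNReal.mk (√q ^ 2) (sq_nonneg _) = NNReal.mk q hq0 := NNReal.eq (Real.sq_sqrt hq0)
  rw [mul_zero, mul_one, h3] at h2
  rw [← integral_map (f := F) (φ := fun x : Fin k → ℝ => ∑ i, a i * x i)
    (Measurable.aemeasurable (by fun_prop)) hF.aestronglyMeasurable,
    ← integral_map (f := F) (φ := fun x : ℝ => √q * x)
    (Measurable.aemeasurable (by fun_prop)) hF.aestronglyMeasurable, h1, h2]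

/-- Two centered jointly Gaussian variables are determined by three covariances, whatever the number
of coordinates they are built from. This is how pairs of fields are reduced to the three variables
Z, Z', Z'' of ψ. -/
theorem integral_pair_linearForm_gauss {k l : ℕ} {a b : Fin k → ℝ} {a' b' : Fin l → ℝ}
    (haa : ∑ i, a i ^ 2 = ∑ i, a' i ^ 2) (hbb : ∑ i, b i ^ 2 = ∑ i, b' i ^ 2)
    (hab : ∑ i, a i * b i = ∑ i, a' i * b' i) {F : ℝ → ℝ → ℝ}
    (hF : Continuous fun p : ℝ × ℝ => F p.1 p.2) :
    ∫ x, F (∑ i, a i * x i) (∑ i, b i * x i) ∂(gauss (Fin k) 1) =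
      ∫ x, F (∑ i, a' i * x i) (∑ i, b' i * x i) ∂(gauss (Fin l) 1) := by
  have hm : ∀ {k : ℕ} (a b : Fin k → ℝ), Measurable fun x : Fin k → ℝ =>
      (![∑ i, a i * x i, ∑ i, b i * x i] : Fin 2 → ℝ) := fun a b => by
    refine measurable_pi_lambda _ fun i => ?_
    fin_cases i <;> simp <;> fun_prop
  have hcf : ∀ {k : ℕ} (a b : Fin k → ℝ) (c : Fin 2 → ℝ),
      ∫ y, Complex.exp ((∑ i, c i * y i : ℝ) * Complex.I)
        ∂((gauss (Fin k) 1).map fun x => ![∑ i, a i * x i, ∑ i, b i * x i]) =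
      Complex.exp ((-(c 0 ^ 2 * ∑ i, a i ^ 2 + 2 * c 0 * c 1 * ∑ i, a i * b i +
        c 1 ^ 2 * ∑ i, b i ^ 2) / 2 : ℝ)) := fun a b c => by
    rw [integral_map (hm a b).aemeasurable (measurable_cexp_linearForm c).aestronglyMeasurable]
    have h := integral_cexp_gauss 1 fun i => c 0 * a i + c 1 * b i
    have e1 : ∀ x : Fin _ → ℝ, ∑ i, (c 0 * a i + c 1 * b i) * x i =
        ∑ j, c j * (![∑ i, a i * x i, ∑ i, b i * x i] : Fin 2 → ℝ) j := fun x => by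
      simp only [Fin.sum_univ_two, Matrix.cons_val_zero, Matrix.cons_val_one, Finset.mul_sum]
      rw [← Finset.sum_add_distrib]
      exact Finset.sum_congr rfl fun i _ => by ring
    simp_rw [e1] at h
    rw [h]
    congr 4
    simp only [NNReal.coe_one, one_mul, Finset.mul_sum]
    rw [← Finset.sum_add_distrib, ← Finset.sum_add_distrib]
    exact Finset.sum_congr rfl fun i _ => by ring
  have hlaw : (gauss (Fin k) 1).map (fun x => (![∑ i, a i * x i, ∑ i, b i * x i] : Fin 2 → ℝ)) =
      (gauss (Fin l) 1).map (fun x => ![∑ i, a' i * x i, ∑ i, b' i * x i]) := by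
    have i1 := Measure.isProbabilityMeasure_map (μ := gauss (Fin k) 1) (hm a b).aemeasurable
    have i2 := Measure.isProbabilityMeasure_map (μ := gauss (Fin l) 1) (hm a' b').aemeasurable
    refine ext_of_integral_cexp fun c => ?_
    rw [hcf, hcf, haa, hbb, hab]
  have hG : Continuous fun y : Fin 2 → ℝ => F (y 0) (y 1) :=
    Continuous.comp (g := fun p : ℝ × ℝ => F p.1 p.2) (f := fun y : Fin 2 → ℝ => (y 0, y 1)) hF
      (by fun_prop)
  have h := congrArg (fun μ => ∫ y, F (y 0) (y 1) ∂μ) hlaw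
  rwa [integral_map (hm a b).aemeasurable hG.aestronglyMeasurable,
    integral_map (hm a' b').aemeasurable hG.aestronglyMeasurable] at h

theorem map_prod_prod_gaussianReal :
    ((gaussianReal 0 1).prod ((gaussianReal 0 1).prod (gaussianReal 0 1))).map
      (fun p : ℝ × ℝ × ℝ => (![p.1, p.2.1, p.2.2] : Fin 3 → ℝ)) = gauss (Fin 3) 1 := by
  have hm : Measurable fun p : ℝ × ℝ × ℝ => (![p.1, p.2.1, p.2.2] : Fin 3 → ℝ) := by
    refine measurable_pi_lambda _ fun i => ?_
    fin_cases i <;> simp <;> fun_prop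
  have i1 := Measure.isProbabilityMeasure_map (μ := (gaussianReal 0 1).prod
    ((gaussianReal 0 1).prod (gaussianReal 0 1))) hm.aemeasurable
  refine ext_of_integral_cexp fun c => ?_
  rw [integral_map hm.aemeasurable (measurable_cexp_linearForm c).aestronglyMeasurable,
    integral_cexp_gauss]
  have h : ∀ p : ℝ × ℝ × ℝ, Complex.exp ((∑ i, c i * (![p.1, p.2.1, p.2.2] : Fin 3 → ℝ) i : ℝ) *
      Complex.I) = Complex.exp ((c 0 * p.1 : ℝ) * Complex.I) *
      (Complex.exp ((c 1 * p.2.1 : ℝ) * Complex.I) *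
        Complex.exp ((c 2 * p.2.2 : ℝ) * Complex.I)) := fun p => by
    rw [← Complex.exp_add, ← Complex.exp_add]
    congr 1
    simp [Fin.sum_univ_three]
    ring
  simp_rw [h]
  rw [integral_prod_mul (fun z : ℝ => Complex.exp ((c 0 * z : ℝ) * Complex.I))
    (fun z : ℝ × ℝ => Complex.exp ((c 1 * z.1 : ℝ) * Complex.I) *
        Complex.exp ((c 2 * z.2 : ℝ) * Complex.I)),
    integral_prod_mul (fun z : ℝ => Complex.exp ((c 1 * z : ℝ) * Complex.I))
    (fun z : ℝ => Complex.exp ((c 2 * z : ℝ) * Complex.I))]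
  simp_rw [integral_cexp_gaussianReal]
  rw [← Complex.exp_add, ← Complex.exp_add, ← Complex.ofReal_add, ← Complex.ofReal_add]
  congr 2
  simp [Fin.sum_univ_three]
  ring

theorem integral_gauss_three {F : (Fin 3 → ℝ) → ℝ} (hF : Continuous F) {C : ℝ}
    (hC : ∀ x, |F x| ≤ C) :
    ∫ x, F x ∂(gauss (Fin 3) 1) = ∫ z, ∫ z', ∫ z'', F ![z, z', z'']
      ∂(gaussianReal 0 1) ∂(gaussianReal 0 1) ∂(gaussianReal 0 1) := by
  have hm : Continuous fun p : ℝ × ℝ × ℝ => (![p.1, p.2.1, p.2.2] : Fin 3 → ℝ) := by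
    refine continuous_pi fun i => ?_
    fin_cases i <;> simp <;> fun_prop
  rw [← map_prod_prod_gaussianReal, integral_map hm.measurable.aemeasurable
    hF.aestronglyMeasurable, integral_prod (fun p : ℝ × ℝ × ℝ => F ![p.1, p.2.1, p.2.2])
      (Integrable.of_bound (hF.comp hm).aestronglyMeasurable C (ae_of_all _ fun p => hC _))]
  refine integral_congr_ae (ae_of_all _ fun z => ?_)
  have hmz : Continuous fun p : ℝ × ℝ => (![z, p.1, p.2] : Fin 3 → ℝ) :=
    hm.comp (continuous_const.prodMk continuous_id)
  exact integral_prod (fun p : ℝ × ℝ => F ![z, p.1, p.2]) (Integrable.of_bound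
    (hF.comp hmz).aestronglyMeasurable C (ae_of_all _ fun p => hC _))

/-! ### The overlap and the replica symmetric formula -/

section Overlap

variable (β h : ℝ)

/-- `E tanh² (h + β √t Z)`. -/
def tanhSq (t : ℝ) : ℝ := ∫ x, Real.tanh (h + β * √t * x) ^ 2 ∂(gaussianReal 0 1)

/-- `E log cosh (h + β √t Z)`. -/
def logCosh (t : ℝ) : ℝ := ∫ x, Real.log (Real.cosh (h + β * √t * x)) ∂(gaussianReal 0 1)

theorem abs_log_cosh_le (y : ℝ) : |Real.log (Real.cosh y)| ≤ y ^ 2 / 2 := by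
  rw [abs_of_nonneg (log_cosh_nonneg y)]; exact log_cosh_le y

theorem integral_gaussianReal_pow_four : ∫ x, x ^ 4 ∂(gaussianReal 0 1) = 3 := by
  have h1 : HasDerivAt (fun t : ℝ => Real.exp (t ^ 2 / 2)) 0 0 := by
    have := (((hasDerivAt_id (0 : ℝ)).pow 2).div_const 2).exp
    simpa using this
  have h2 := iteratedDeriv_mgf_zero (X := id) (μ := gaussianReal 0 1)
    (by rw [integrableExpSet_id_gaussianReal]; simp) 4
  have h3 : mgf id (gaussianReal 0 1) = fun t => Real.exp (t ^ 2 / 2) := by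
    rw [mgf_id_gaussianReal]; simp
  rw [h3] at h2
  -- Differentiating p(t) e^{t²/2} replaces p by q = p' + t p. Four rounds from p = 1 give 3 + 6t² +
  -- t⁴, whose value at 0 is the fourth moment.
  have d : ∀ (p q : ℝ → ℝ), (∀ t, HasDerivAt p (q t - t * p t) t) →
      deriv (fun t => p t * Real.exp (t ^ 2 / 2)) = fun t => q t * Real.exp (t ^ 2 / 2) := by
    intro p q hp
    funext t
    have he : HasDerivAt (fun t : ℝ => Real.exp (t ^ 2 / 2)) (Real.exp (t ^ 2 / 2) * t) t := by
      have := (((hasDerivAt_id t).pow 2).div_const 2).exp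
      convert! this using 1
      simp
    have hm : HasDerivAt (fun t => p t * Real.exp (t ^ 2 / 2))
        ((q t - t * p t) * Real.exp (t ^ 2 / 2) + p t * (Real.exp (t ^ 2 / 2) * t)) t := (hp t).mul he
    rw [hm.deriv]
    ring
  have e0 : (fun t : ℝ => Real.exp (t ^ 2 / 2)) = fun t => 1 * Real.exp (t ^ 2 / 2) := by simp
  have hpoly : ∀ (a b c d e t : ℝ), HasDerivAt (fun t : ℝ => a + b * t + c * t ^ 2 + d * t ^ 3 +
      e * t ^ 4) (b + 2 * c * t + 3 * d * t ^ 2 + 4 * e * t ^ 3) t := by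
    intro a b c d e t
    have := ((((hasDerivAt_const t a).add ((hasDerivAt_id t).const_mul b)).add
      (((hasDerivAt_id t).pow 2).const_mul c)).add (((hasDerivAt_id t).pow 3).const_mul d)).add
      (((hasDerivAt_id t).pow 4).const_mul e)
    convert! this using 1
    simp
    ring
  rw [iteratedDeriv_eq_iterate] at h2
  simp only [Function.iterate_succ, Function.iterate_zero, Function.comp_apply, id] at h2
  rw [e0, d (fun _ => 1) (fun t => t) (fun t => by
      have := hpoly 1 0 0 0 0 t
      convert! this using 1 <;> [(funext t; ring); ring]),
    d (fun t => t) (fun t => 1 + t ^ 2) (fun t => by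
      have := hpoly 0 1 0 0 0 t
      convert! this using 1 <;> [(funext t; ring); ring]),
    d (fun t => 1 + t ^ 2) (fun t => 3 * t + t ^ 3) (fun t => by
      have := hpoly 1 0 1 0 0 t
      convert! this using 1 <;> [(funext t; ring); ring]),
    d (fun t => 3 * t + t ^ 3) (fun t => 3 + 6 * t ^ 2 + t ^ 4) (fun t => by
      have := hpoly 0 3 0 1 0 t
      convert! this using 1 <;> [(funext t; ring); ring])] at h2
  simpa using h2.symm

theorem integrable_pow_gaussianReal (n : ℕ) : Integrable (fun x : ℝ => x ^ n) (gaussianReal 0 1) := by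
  have := (memLp_id_gaussianReal (μ := 0) (v := 1) n).integrable_norm_pow'
  refine (integrable_norm_iff (by fun_prop)).1 ?_
  simpa using this

/-- A Gaussian variable of variance `t + s` as a sum of two independent ones. -/
theorem integral_add_symm {t s : ℝ} (ht : 0 ≤ t) (hs : 0 ≤ s) {F : ℝ → ℝ} (hF : Continuous F)
    {a b : ℝ} (hb : ∀ x, |F x| ≤ a + b * x ^ 2) :
    ∫ x, F (√(t + s) * x) ∂(gaussianReal 0 1) - ∫ x, F (√t * x) ∂(gaussianReal 0 1) =
      ∫ p, (F (√t * p.1 + √s * p.2) + F (√t * p.1 - √s * p.2) - 2 * F (√t * p.1)) / 2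
        ∂((gaussianReal 0 1).prod (gaussianReal 0 1)) := by
  -- Both signs c = ±√s give the same law; averaging over them produces a symmetric second
  -- difference, in which the first-order term cancels.
  have hlaw : ∀ (c : ℝ), c ^ 2 = s →
      ((gaussianReal 0 1).prod (gaussianReal 0 1)).map (fun p : ℝ × ℝ => √t * p.1 + c * p.2) =
        (gaussianReal 0 1).map (fun x => √(t + s) * x) := by
    intro c hc
    have m1 : Measurable fun p : ℝ × ℝ => √t * p.1 + c * p.2 := by fun_prop
    have m2 : Measurable fun x : ℝ => √(t + s) * x := by fun_prop
    have i1 := Measure.isProbabilityMeasure_map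
      (μ := (gaussianReal 0 1).prod (gaussianReal 0 1)) m1.aemeasurable
    have i2 := Measure.isProbabilityMeasure_map (μ := gaussianReal 0 1) m2.aemeasurable
    refine Measure.ext_of_charFun (funext fun r => ?_)
    rw [charFun_apply_real, charFun_apply_real, integral_map m1.aemeasurable (by fun_prop),
      integral_map m2.aemeasurable (by fun_prop)]
    have e1 : ∀ p : ℝ × ℝ, Complex.exp (r * (√t * p.1 + c * p.2 : ℝ) * Complex.I) =
        Complex.exp ((r * √t * p.1 : ℝ) * Complex.I) *
          Complex.exp ((r * c * p.2 : ℝ) * Complex.I) := fun p => by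
      rw [← Complex.exp_add]; congr 1; push_cast; ring
    have e2 : ∀ x : ℝ, Complex.exp (r * (√(t + s) * x : ℝ) * Complex.I) =
        Complex.exp ((r * √(t + s) * x : ℝ) * Complex.I) := fun x => by
      congr 1; push_cast; ring
    simp_rw [e1, e2]
    rw [integral_prod_mul (fun z : ℝ => Complex.exp ((r * √t * z : ℝ) * Complex.I))
      (fun z : ℝ => Complex.exp ((r * c * z : ℝ) * Complex.I)), integral_cexp_gaussianReal,
      integral_cexp_gaussianReal, integral_cexp_gaussianReal, ← Complex.exp_add,
      ← Complex.ofReal_add]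
    congr 2
    rw [mul_pow, mul_pow, mul_pow, Real.sq_sqrt ht, Real.sq_sqrt (add_nonneg ht hs), hc]
    ring
  have hint : ∀ c : ℝ, Integrable (fun p : ℝ × ℝ => F (√t * p.1 + c * p.2))
      ((gaussianReal 0 1).prod (gaussianReal 0 1)) := by
    intro c
    have h1 : Integrable (fun p : ℝ × ℝ => p.1 ^ 2)
        ((gaussianReal 0 1).prod (gaussianReal 0 1)) :=
      (integrable_sq_gaussianReal 1).comp_fst _
    have h2 : Integrable (fun p : ℝ × ℝ => p.2 ^ 2)
        ((gaussianReal 0 1).prod (gaussianReal 0 1)) :=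
      (integrable_sq_gaussianReal 1).comp_snd _
    refine (((integrable_const |a|).add (h1.const_mul (2 * |b| * √t ^ 2))).add
      (h2.const_mul (2 * |b| * c ^ 2))).mono'
      (hF.comp (by fun_prop)).aestronglyMeasurable (ae_of_all _ fun p => (hb _).trans ?_)
    simp only [Pi.add_apply]
    have h3 : (√t * p.1 + c * p.2) ^ 2 ≤ 2 * (√t ^ 2 * p.1 ^ 2) + 2 * (c ^ 2 * p.2 ^ 2) := by
      nlinarith [sq_nonneg (√t * p.1 - c * p.2)]
    have h4 := mul_le_mul_of_nonneg_left h3 (abs_nonneg b)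
    have h5 := mul_le_mul_of_nonneg_right (le_abs_self b) (sq_nonneg (√t * p.1 + c * p.2))
    nlinarith [le_abs_self a]
  have hE : ∀ c : ℝ, c ^ 2 = s → ∫ p, F (√t * p.1 + c * p.2)
      ∂((gaussianReal 0 1).prod (gaussianReal 0 1)) =
      ∫ x, F (√(t + s) * x) ∂(gaussianReal 0 1) := by
    intro c hc
    rw [← integral_map (f := F) (φ := fun p : ℝ × ℝ => √t * p.1 + c * p.2) (by fun_prop)
      hF.aestronglyMeasurable, hlaw c hc, integral_map (by fun_prop) hF.aestronglyMeasurable]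
  have h0 : ∫ p : ℝ × ℝ, F (√t * p.1) ∂((gaussianReal 0 1).prod (gaussianReal 0 1)) =
      ∫ x, F (√t * x) ∂(gaussianReal 0 1) := by
    rw [integral_fun_fst (fun x => F (√t * x))]; simp
  have hi1 := hint (√s)
  have hi2 := hint (-√s)
  have hi0 := hint 0
  simp only [neg_mul, ← sub_eq_add_neg] at hi2
  simp only [zero_mul, add_zero] at hi0
  have hE1 := hE (√s) (Real.sq_sqrt hs)
  have hE2 := hE (-√s) (by rw [neg_sq, Real.sq_sqrt hs])
  simp only [neg_mul, ← sub_eq_add_neg] at hE2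
  have hi12 : Integrable (fun p : ℝ × ℝ => F (√t * p.1 + √s * p.2) + F (√t * p.1 - √s * p.2))
      ((gaussianReal 0 1).prod (gaussianReal 0 1)) := hi1.add hi2
  rw [integral_div, integral_sub hi12 (hi0.const_mul 2), integral_add hi1 hi2,
    integral_const_mul, hE1, hE2, h0]
  ring

theorem continuous_tanh_affine (c : ℝ) : Continuous fun x => Real.tanh (h + c * x) :=
  continuous_tanh.comp (by fun_prop)

theorem integrable_of_bounded {α : Type*} [MeasurableSpace α] [TopologicalSpace α]
    [OpensMeasurableSpace α] {μ : Measure α} [IsFiniteMeasure μ] {F : α → ℝ}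
    [SecondCountableTopology α] (hF : Continuous F) {C : ℝ} (hC : ∀ x, |F x| ≤ C) :
    Integrable F μ :=
  Integrable.of_bound hF.aestronglyMeasurable C (ae_of_all _ hC)

theorem abs_tanh_sq_le_one (x : ℝ) : |Real.tanh x ^ 2| ≤ 1 := by
  rw [abs_of_nonneg (sq_nonneg _)]; exact (Real.tanh_sq_lt_one x).le

/-! ### The fixed point equation for q. -/

theorem tanhSq_nonneg (t : ℝ) : 0 ≤ tanhSq β h t := integral_nonneg fun _ => sq_nonneg _

theorem tanhSq_le_one (t : ℝ) : tanhSq β h t ≤ 1 := by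
  have h1 : Integrable (fun x => Real.tanh (h + β * √t * x) ^ 2) (gaussianReal 0 1) :=
    integrable_of_bounded ((continuous_tanh_affine h _).pow 2) fun x => abs_tanh_sq_le_one _
  calc tanhSq β h t ≤ ∫ _, (1 : ℝ) ∂(gaussianReal 0 1) :=
        integral_mono h1 (integrable_const _) fun x => (Real.tanh_sq_lt_one _).le
    _ = 1 := by simp

theorem continuous_tanhSq : Continuous (tanhSq β h) := by
  refine continuous_of_dominated (F := fun t x => Real.tanh (h + β * √t * x) ^ 2)
    (bound := fun _ => 1) (fun t => ((continuous_tanh_affine h _).pow 2).aestronglyMeasurable)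
    (fun t => ae_of_all _ fun x => abs_tanh_sq_le_one _) (integrable_const _)
    (ae_of_all _ fun x => (continuous_tanh.comp (by fun_prop)).pow 2)

/-- The set of fixed points is closed, bounded below, and nonempty by the intermediate value theorem
on [0, 1], so its infimum belongs to it. Only this equation is used later, not uniqueness. -/
theorem overlap_mem : 0 ≤ overlap β h ∧ overlap β h = tanhSq β h (overlap β h) := by
  have hne : {t : ℝ | 0 ≤ t ∧ t = tanhSq β h t}.Nonempty := by
    obtain ⟨t, ht, h0⟩ := intermediate_value_Icc' (a := 0) (b := 1) zero_le_one
      (f := fun t => tanhSq β h t - t) ((continuous_tanhSq β h).sub continuous_id).continuousOn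
      (show (0 : ℝ) ∈ _ from ⟨by simpa using tanhSq_le_one β h 1,
        by simpa using tanhSq_nonneg β h 0⟩)
    exact ⟨t, ht.1, (sub_eq_zero.1 h0).symm⟩
  have hcl : IsClosed {t : ℝ | 0 ≤ t ∧ t = tanhSq β h t} :=
    (isClosed_le continuous_const continuous_id).inter
      (isClosed_eq continuous_id (continuous_tanhSq β h))
  exact hcl.csInf_mem hne ⟨0, fun t ht => ht.1⟩

theorem overlap_nonneg : 0 ≤ overlap β h := (overlap_mem β h).1

theorem tanhSq_overlap : tanhSq β h (overlap β h) = overlap β h := (overlap_mem β h).2.symm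

theorem overlap_le_one : overlap β h ≤ 1 := by
  rw [← tanhSq_overlap]; exact tanhSq_le_one β h _

theorem overlap_pos {h : ℝ} (hh : 0 < h) : 0 < overlap β h := by
  refine lt_of_le_of_ne (overlap_nonneg β h) fun h0 => ?_
  have h1 := tanhSq_overlap β h
  rw [← h0, tanhSq] at h1
  simp only [Real.sqrt_zero, mul_zero, zero_mul, add_zero] at h1
  rw [integral_const] at h1
  simp only [probReal_univ, smul_eq_mul, one_mul] at h1
  have h2 := pow_eq_zero_iff (two_ne_zero) |>.1 h1
  rw [Real.tanh_eq_sinh_div_cosh, div_eq_zero_iff] at h2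
  rcases h2 with h2 | h2
  · exact (Real.sinh_pos_iff.2 hh).ne' h2
  · exact (Real.cosh_pos h).ne' h2

theorem integrable_tanh_sq (t : ℝ) :
    Integrable (fun x => Real.tanh (h + β * √t * x) ^ 2) (gaussianReal 0 1) :=
  integrable_of_bounded ((continuous_tanh_affine h _).pow 2) fun _ => abs_tanh_sq_le_one _

theorem integral_one_sub_tanh_sq (t : ℝ) :
    ∫ x, (1 - Real.tanh (h + β * √t * x) ^ 2) ∂(gaussianReal 0 1) = 1 - tanhSq β h t := by
  rw [integral_sub (integrable_const _) (integrable_tanh_sq β h t), tanhSq]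
  simp

theorem abs_log_cosh_affine_le (x : ℝ) :
    |Real.log (Real.cosh (h + β * x))| ≤ h ^ 2 + β ^ 2 * x ^ 2 := by
  refine (abs_log_cosh_le _).trans ?_
  nlinarith [sq_nonneg (h - β * x)]

theorem logCosh_sub {t s : ℝ} (ht : 0 ≤ t) (hs : 0 ≤ s) :
    logCosh β h (t + s) - logCosh β h t =
      ∫ p, (Real.log (Real.cosh (h + β * √t * p.1 + β * √s * p.2)) +
        Real.log (Real.cosh (h + β * √t * p.1 - β * √s * p.2)) -
        2 * Real.log (Real.cosh (h + β * √t * p.1))) / 2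
        ∂((gaussianReal 0 1).prod (gaussianReal 0 1)) := by
  have := integral_add_symm ht hs (F := fun x => Real.log (Real.cosh (h + β * x)))
    (continuous_log_cosh.comp (by fun_prop)) (abs_log_cosh_affine_le β h)
  simp only [← mul_assoc, mul_add, mul_sub, ← add_assoc, ← add_sub_assoc] at this
  exact this

theorem integrable_logCosh_sub (t s : ℝ) :
    Integrable (fun p : ℝ × ℝ => (Real.log (Real.cosh (h + β * √t * p.1 + β * √s * p.2)) +
        Real.log (Real.cosh (h + β * √t * p.1 - β * √s * p.2)) -
        2 * Real.log (Real.cosh (h + β * √t * p.1))) / 2)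
        ((gaussianReal 0 1).prod (gaussianReal 0 1)) := by
  have h2 : Integrable (fun p : ℝ × ℝ => p.2 ^ 2) ((gaussianReal 0 1).prod (gaussianReal 0 1)) :=
    (integrable_sq_gaussianReal 1).comp_snd _
  have h4 : Integrable (fun p : ℝ × ℝ => p.2 ^ 4) ((gaussianReal 0 1).prod (gaussianReal 0 1)) :=
    (integrable_pow_gaussianReal 4).comp_snd _
  refine ((h2.const_mul ((β * √s) ^ 2)).add (h4.const_mul ((β * √s) ^ 4))).mono' ?_
    (ae_of_all _ fun p => ?_)
  · exact (((continuous_log_cosh.comp (by fun_prop)).add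
      (continuous_log_cosh.comp (by fun_prop))).sub
      ((continuous_log_cosh.comp (by fun_prop)).const_mul 2)).div_const 2 |>.aestronglyMeasurable
  · have l := le_log_cosh_second_difference (h + β * √t * p.1) (β * √s * p.2)
    have u := log_cosh_second_difference_le (h + β * √t * p.1) (β * √s * p.2)
    obtain ⟨p0, p1⟩ := one_sub_tanh_sq_mem (h + β * √t * p.1)
    set P := 1 - Real.tanh (h + β * √t * p.1) ^ 2
    have y2 : 0 ≤ (β * √s * p.2) ^ 2 := sq_nonneg _
    have y4 : 0 ≤ (β * √s * p.2) ^ 4 := by positivity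
    simp only [Pi.add_apply, ← mul_pow, Real.norm_eq_abs]
    rw [abs_le]
    constructor <;> nlinarith [mul_nonneg p0 y2, mul_nonneg p0 y4,
      mul_le_mul_of_nonneg_right p1 y2, mul_le_mul_of_nonneg_right p1 y4]

theorem integral_mul_pow {F : ℝ → ℝ} (c : ℝ) (n : ℕ) :
    ∫ p : ℝ × ℝ, F p.1 * (c * p.2) ^ n ∂((gaussianReal 0 1).prod (gaussianReal 0 1)) =
      (∫ x, F x ∂(gaussianReal 0 1)) * (c ^ n * ∫ x, x ^ n ∂(gaussianReal 0 1)) := by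
  rw [← integral_const_mul, ← integral_prod_mul]
  simp_rw [mul_pow]

theorem integrable_mul_pow {F : ℝ → ℝ} (hF : Integrable F (gaussianReal 0 1)) (c : ℝ) (n : ℕ) :
    Integrable (fun p : ℝ × ℝ => F p.1 * (c * p.2) ^ n)
      ((gaussianReal 0 1).prod (gaussianReal 0 1)) := by
  simp_rw [mul_pow]
  exact hF.mul_prod ((integrable_pow_gaussianReal n).const_mul _)

theorem integrable_one_sub_tanh_sq (t : ℝ) :
    Integrable (fun x => 1 - Real.tanh (h + β * √t * x) ^ 2) (gaussianReal 0 1) :=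
  (integrable_const _).sub (integrable_tanh_sq β h t)

/-- Averaging the pointwise second-difference bound with E Z² = 1 and E Z⁴ = 3 gives a first-order
expansion in the variance, with slope β²(1 - `tanhSq`)/2 and an explicit error of order β⁴ s². -/
theorem le_logCosh_sub {t s : ℝ} (ht : 0 ≤ t) (hs : 0 ≤ s) :
    (1 - tanhSq β h t) * (β ^ 2 * s / 2 - 3 * β ^ 4 * s ^ 2 / 8) ≤
      logCosh β h (t + s) - logCosh β h t := by
  rw [logCosh_sub β h ht hs]
  have hi := integrable_one_sub_tanh_sq β h t
  have hi2 := integrable_mul_pow hi (β * √s) 2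
  have hi4 := integrable_mul_pow hi (β * √s) 4
  have e : (1 - tanhSq β h t) * (β ^ 2 * s / 2 - 3 * β ^ 4 * s ^ 2 / 8) =
      ∫ p : ℝ × ℝ, ((1 - Real.tanh (h + β * √t * p.1) ^ 2) * (β * √s * p.2) ^ 2 -
        (1 - Real.tanh (h + β * √t * p.1) ^ 2) * (β * √s * p.2) ^ 4 / 4) / 2
        ∂((gaussianReal 0 1).prod (gaussianReal 0 1)) := by
    rw [integral_div, integral_sub hi2 (hi4.div_const 4), integral_div,
      integral_mul_pow (F := fun x => 1 - Real.tanh (h + β * √t * x) ^ 2),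
      integral_mul_pow (F := fun x => 1 - Real.tanh (h + β * √t * x) ^ 2),
      integral_one_sub_tanh_sq, integral_gaussianReal_sq, integral_gaussianReal_pow_four, mul_pow,
      mul_pow, show √s ^ 4 = (√s ^ 2) ^ 2 by ring, Real.sq_sqrt hs, NNReal.coe_one]
    ring
  rw [e]
  refine integral_mono ((hi2.sub (hi4.div_const 4)).div_const 2) (integrable_logCosh_sub β h t s)
    fun p => ?_
  have l := le_log_cosh_second_difference (h + β * √t * p.1) (β * √s * p.2)
  simp only
  linarith

theorem logCosh_sub_le {t s : ℝ} (ht : 0 ≤ t) (hs : 0 ≤ s) :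
    logCosh β h (t + s) - logCosh β h t ≤
      (1 - tanhSq β h t) * (β ^ 2 * s / 2) + 3 * β ^ 4 * s ^ 2 / 2 := by
  rw [logCosh_sub β h ht hs]
  have hi2 := integrable_mul_pow (integrable_one_sub_tanh_sq β h t) (β * √s) 2
  have hi4 := integrable_mul_pow (F := fun _ => 1) (integrable_const _) (β * √s) 4
  have e : (1 - tanhSq β h t) * (β ^ 2 * s / 2) + 3 * β ^ 4 * s ^ 2 / 2 =
      ∫ p : ℝ × ℝ, ((1 - Real.tanh (h + β * √t * p.1) ^ 2) * (β * √s * p.2) ^ 2 +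
        1 * (β * √s * p.2) ^ 4) / 2
        ∂((gaussianReal 0 1).prod (gaussianReal 0 1)) := by
    rw [integral_div, integral_add hi2 hi4,
      integral_mul_pow (F := fun x => 1 - Real.tanh (h + β * √t * x) ^ 2),
      integral_mul_pow (F := fun _ => 1),
      integral_one_sub_tanh_sq, integral_gaussianReal_sq, integral_gaussianReal_pow_four, mul_pow,
      mul_pow, show √s ^ 4 = (√s ^ 2) ^ 2 by ring, Real.sq_sqrt hs, NNReal.coe_one, integral_const]
    simp
    ring
  rw [e]
  refine integral_mono (integrable_logCosh_sub β h t s) ((hi2.add hi4).div_const 2)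
    fun p => ?_
  have l := log_cosh_second_difference_le (h + β * √t * p.1) (β * √s * p.2)
  simp only
  linarith

theorem tanhSq_sub_le {t s : ℝ} (ht : 0 ≤ t) (hs : 0 ≤ s) :
    tanhSq β h (t + s) - tanhSq β h t ≤ β ^ 2 * s := by
  have hc : Continuous fun x => Real.tanh (h + β * x) ^ 2 := (continuous_tanh_affine h _).pow 2
  have := integral_add_symm ht hs (F := fun x => Real.tanh (h + β * x) ^ 2) hc
    (a := 1) (b := 0) (fun x => by simpa using (Real.tanh_sq_lt_one _).le)
  simp only [← mul_assoc, mul_add, mul_sub, ← add_assoc, ← add_sub_assoc] at this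
  rw [tanhSq, tanhSq, this]
  have hi2 := integrable_mul_pow (F := fun _ => 1) (integrable_const _) (β * √s) 2
  have e : β ^ 2 * s = ∫ p : ℝ × ℝ, 1 * (β * √s * p.2) ^ 2
        ∂((gaussianReal 0 1).prod (gaussianReal 0 1)) := by
    rw [integral_mul_pow (F := fun _ => 1), integral_gaussianReal_sq, mul_pow, Real.sq_sqrt hs]
    simp
  rw [e]
  refine integral_mono (integrable_of_bounded (C := 2) ?_ fun p => ?_) hi2 fun p => ?_
  · exact ((((continuous_tanh.comp (by fun_prop)).pow 2).add
      ((continuous_tanh.comp (by fun_prop)).pow 2)).sub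
      (((continuous_tanh.comp (by fun_prop)).pow 2).const_mul 2)).div_const 2
  · rw [abs_le]
    constructor <;>
      linarith [one_sub_tanh_sq_mem (h + β * √t * p.1 + β * √s * p.2),
        one_sub_tanh_sq_mem (h + β * √t * p.1 - β * √s * p.2),
        one_sub_tanh_sq_mem (h + β * √t * p.1)]
  · have := tanh_sq_second_difference_le (h + β * √t * p.1) (β * √s * p.2)
    simp only
    linarith

theorem logCosh_nonneg (t : ℝ) : 0 ≤ logCosh β h t := integral_nonneg fun _ => log_cosh_nonneg _

/-- At high temperature the infimum in the replica symmetric formula is attained at the overlap. -/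
theorem RS_eq (hβ : β ^ 2 ≤ 1 / 8) : RS β h =
    logCosh β h (overlap β h) + β ^ 2 * (1 - overlap β h) ^ 2 / 4 := by
  set q := overlap β h with hq
  have hq0 : 0 ≤ q := overlap_nonneg β h
  have hq1 : q ≤ 1 := overlap_le_one β h
  have hfq : tanhSq β h q = q := tanhSq_overlap β h
  have hRS : RS β h = ⨅ t : ℝ≥0, (logCosh β h t + β ^ 2 * (1 - (t : ℝ)) ^ 2 / 4) := rfl
  have hb4 : β ^ 4 = β ^ 2 * β ^ 2 := by ring
  have hb0 := sq_nonneg β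
  rw [hRS]
  refine le_antisymm ?_ (le_ciInf fun t => ?_)
  · refine ciInf_le ⟨0, ?_⟩ (⟨q, hq0⟩ : ℝ≥0)
    rintro _ ⟨t, rfl⟩
    exact add_nonneg (logCosh_nonneg β h _) (by positivity)
  -- The linear part of the increment cancels that of β²(1-t)²/4, because `tanhSq` equals q at q.
  -- What remains is β²s²/4 against errors of order β⁴s². For t < q the expansion is based at t, and
  -- moving the slope to q costs β⁴s²/2 on top of 3β⁴s²/2; the total 2β⁴s² is what requires β² ≤
  -- 1/8.
  · rcases le_total q t with hqt | hqt
    · obtain ⟨s, hs⟩ : ∃ s, (t : ℝ) = q + s := ⟨t - q, by ring⟩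
      have hs0 : 0 ≤ s := by linarith
      have := le_logCosh_sub β h hq0 hs0
      rw [hfq] at this
      rw [hs]
      have h1 : 0 ≤ β ^ 2 * s ^ 2 := by positivity
      have h2 : (1 - q) * (3 * β ^ 4 * s ^ 2 / 8) ≤ β ^ 2 * s ^ 2 / 4 := by
        rw [hb4]
        have : (1 - q) * β ^ 2 ≤ 1 / 8 := by nlinarith
        nlinarith
      nlinarith
    · obtain ⟨s, hs⟩ : ∃ s, q = t + s := ⟨q - t, by ring⟩
      have hs0 : 0 ≤ s := by linarith
      have h1 := logCosh_sub_le β h t.2 hs0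
      have h2 := tanhSq_sub_le β h t.2 hs0
      have ht : (t : ℝ) = q - s := by linarith
      rw [NNReal.val_eq_coe, ← hs] at h1 h2
      rw [hfq] at h2
      have h3 : (1 - tanhSq β h t) * (β ^ 2 * s / 2) ≤
          (1 - q + β ^ 2 * s) * (β ^ 2 * s / 2) :=
        mul_le_mul_of_nonneg_right (by linarith) (by positivity)
      have h4 : 2 * β ^ 4 * s ^ 2 ≤ β ^ 2 * s ^ 2 / 4 := by
        rw [hb4]
        nlinarith [mul_nonneg hb0 (sq_nonneg s)]
      rw [hb4] at h1 h4
      have h5 : β ^ 2 * (1 - (t : ℝ)) ^ 2 / 4 = β ^ 2 * (1 - q) ^ 2 / 4 +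
        β ^ 2 * s * (1 - q) / 2 + β ^ 2 * s ^ 2 / 4 := by rw [ht]; ring
      rw [h5]
      nlinarith

end Overlap

/-! ### The numerical sequences -/

section Sequences

variable (β h : ℝ)

theorem integral_tanh_sq_linearForm {k : ℕ} {a : Fin k → ℝ} (ha : ∑ i, a i ^ 2 = overlap β h) :
    ∫ x, Real.tanh (h + β * ∑ i, a i * x i) ^ 2 ∂(gauss (Fin k) 1) = overlap β h := by
  rw [integral_linearForm_gauss ha (F := fun y => Real.tanh (h + β * y) ^ 2)
    ((continuous_tanh_affine h _).pow 2)]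
  simp_rw [← mul_assoc]
  exact tanhSq_overlap β h

theorem integral_tanh_linearForm {k : ℕ} {a : Fin k → ℝ} (ha : ∑ i, a i ^ 2 = overlap β h) :
    ∫ x, Real.tanh (h + β * ∑ i, a i * x i) ∂(gauss (Fin k) 1) = gammaOne β h := by
  rw [integral_linearForm_gauss ha (F := fun y => Real.tanh (h + β * y))
    (continuous_tanh_affine h _)]
  simp_rw [← mul_assoc]
  rfl

theorem integral_log_cosh_linearForm {k : ℕ} {a : Fin k → ℝ} (ha : ∑ i, a i ^ 2 = overlap β h) :
    ∫ x, Real.log (Real.cosh (h + β * ∑ i, a i * x i)) ∂(gauss (Fin k) 1) =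
      logCosh β h (overlap β h) := by
  rw [integral_linearForm_gauss ha (F := fun y => Real.log (Real.cosh (h + β * y)))
    (continuous_log_cosh.comp (by fun_prop))]
  simp_rw [← mul_assoc]
  rfl

theorem abs_tanh_mul_tanh_le (x y : ℝ) : |Real.tanh x * Real.tanh y| ≤ 1 := by
  rw [abs_mul]
  exact mul_le_one₀ (abs_tanh_le_one x) (abs_nonneg _) (abs_tanh_le_one y)

/-- The correlation of two effective fields of variance `q` and covariance `t`. -/
theorem integral_tanh_mul_tanh {k : ℕ} {a b : Fin k → ℝ} {t : ℝ}
    (ha : ∑ i, a i ^ 2 = overlap β h) (hb : ∑ i, b i ^ 2 = overlap β h)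
    (hab : ∑ i, a i * b i = t) (ht0 : 0 ≤ t) (htq : t ≤ overlap β h) :
    ∫ x, Real.tanh (h + β * ∑ i, a i * x i) * Real.tanh (h + β * ∑ i, b i * x i)
      ∂(gauss (Fin k) 1) = psi β h t := by
  have e1 := Real.sq_sqrt ht0
  have e2 := Real.sq_sqrt (sub_nonneg.2 htq)
  rw [integral_pair_linearForm_gauss (l := 3) (a' := ![√t, √(overlap β h - t), 0])
    (b' := ![√t, 0, √(overlap β h - t)])
    (F := fun x y => Real.tanh (h + β * x) * Real.tanh (h + β * y))
    (by rw [ha]; simp [Fin.sum_univ_three, e1, e2]) (by rw [hb]; simp [Fin.sum_univ_three, e1, e2])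
    (by rw [hab]; simp [Fin.sum_univ_three, ← sq, e1])
    ((continuous_tanh.comp (by fun_prop)).mul (continuous_tanh.comp (by fun_prop))),
    integral_gauss_three (F := fun x =>
        Real.tanh (h + β * ∑ i, (![√t, √(overlap β h - t), 0] : Fin 3 → ℝ) i * x i) *
        Real.tanh (h + β * ∑ i, (![√t, 0, √(overlap β h - t)] : Fin 3 → ℝ) i * x i))
      ((continuous_tanh.comp (by fun_prop)).mul
    (continuous_tanh.comp (by fun_prop))) (C := 1) fun x => abs_tanh_mul_tanh_le _ _, psi]
  simp [Fin.sum_univ_three]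

variable {β h}

/-- For two fields A, B of variance q and covariance t, q - ψ(t) is half the mean square of Th(A) -
Th(B). The difference A - B is centered Gaussian of variance 2(q - t): the Lipschitz property gives
the upper bound, and injectivity of tanh together with the absence of atoms gives strict positivity.
-/
theorem psi_bounds (hβ : 0 < β) {t : ℝ} (ht0 : 0 ≤ t) (htq : t < overlap β h) :
    0 < overlap β h - psi β h t ∧ overlap β h - psi β h t ≤ β ^ 2 * (overlap β h - t) := by
  have e1 := Real.sq_sqrt ht0
  have e2 := Real.sq_sqrt (sub_nonneg.2 htq.le)
  set r := √(overlap β h - t) with hr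
  set a : Fin 3 → ℝ := ![√t, r, 0] with ha'
  set b : Fin 3 → ℝ := ![√t, 0, r] with hb'
  have ha : ∑ i, a i ^ 2 = overlap β h := by simp [a, Fin.sum_univ_three, e1, e2]
  have hb : ∑ i, b i ^ 2 = overlap β h := by simp [b, Fin.sum_univ_three, e1, e2]
  have hab : ∑ i, a i * b i = t := by simp [a, b, Fin.sum_univ_three, ← sq, e1]
  have hd : ∑ i, (a i - b i) ^ 2 = 2 * (overlap β h - t) := by
    simp [a, b, Fin.sum_univ_three, e2]; ring
  set A : (Fin 3 → ℝ) → ℝ := fun x => ∑ i, a i * x i with hA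
  set B : (Fin 3 → ℝ) → ℝ := fun x => ∑ i, b i * x i with hB
  have hAc : Continuous A := by rw [hA]; fun_prop
  have hBc : Continuous B := by rw [hB]; fun_prop
  have tA : Continuous fun x => Real.tanh (h + β * A x) := continuous_tanh.comp (by fun_prop)
  have tB : Continuous fun x => Real.tanh (h + β * B x) := continuous_tanh.comp (by fun_prop)
  have iA : Integrable (fun x => Real.tanh (h + β * A x) ^ 2) (gauss (Fin 3) 1) :=
    integrable_of_bounded (tA.pow 2) fun x => abs_tanh_sq_le_one _
  have iB : Integrable (fun x => Real.tanh (h + β * B x) ^ 2) (gauss (Fin 3) 1) :=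
    integrable_of_bounded (tB.pow 2) fun x => abs_tanh_sq_le_one _
  have iAB : Integrable (fun x => Real.tanh (h + β * A x) * Real.tanh (h + β * B x))
      (gauss (Fin 3) 1) :=
    integrable_of_bounded (tA.mul tB) fun x => abs_tanh_mul_tanh_le _ _
  have hsq : overlap β h - psi β h t = ∫ x, ((Real.tanh (h + β * A x) ^ 2 / 2 +
      Real.tanh (h + β * B x) ^ 2 / 2) - Real.tanh (h + β * A x) * Real.tanh (h + β * B x))
      ∂(gauss (Fin 3) 1) := by
    have i2 : Integrable (fun x => Real.tanh (h + β * A x) ^ 2 / 2 +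
      Real.tanh (h + β * B x) ^ 2 / 2) (gauss (Fin 3) 1) := (iA.div_const 2).add (iB.div_const 2)
    rw [integral_sub i2 iAB, integral_add (iA.div_const 2) (iB.div_const 2), integral_div,
      integral_div, integral_tanh_sq_linearForm β h ha, integral_tanh_sq_linearForm β h hb,
      integral_tanh_mul_tanh β h ha hb hab ht0 htq.le]
    ring
  have hsq' : ∀ x, (Real.tanh (h + β * A x) ^ 2 / 2 +
      Real.tanh (h + β * B x) ^ 2 / 2) - Real.tanh (h + β * A x) * Real.tanh (h + β * B x) =
      (Real.tanh (h + β * A x) - Real.tanh (h + β * B x)) ^ 2 / 2 := fun x => by ring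
  simp_rw [hsq'] at hsq
  have hdiff : ∀ x, A x - B x = ∑ i, (a i - b i) * x i := fun x => by
    simp only [hA, hB, sub_mul, Finset.sum_sub_distrib]
  have hint : Integrable (fun x => (Real.tanh (h + β * A x) - Real.tanh (h + β * B x)) ^ 2 / 2)
      (gauss (Fin 3) 1) := by
    refine integrable_of_bounded (((tA.sub tB).pow 2).div_const 2) (C := 2) fun x => ?_
    have h1 := abs_le.1 (abs_tanh_le_one (h + β * A x))
    have h2 := abs_le.1 (abs_tanh_le_one (h + β * B x))
    rw [abs_of_nonneg (by positivity)]
    nlinarith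
  constructor
  · rw [hsq]
    refine lt_of_le_of_ne (integral_nonneg fun x => by positivity) fun h0 => ?_
    have hae := (integral_eq_zero_iff_of_nonneg (fun x => by positivity) hint).1 h0.symm
    have hvar : 0 ≤ 2 * (overlap β h - t) := by linarith
    have hlaw := map_linearForm_gauss 1 (fun i => a i - b i) (NNReal.mk _ hvar) (by
      rw [NNReal.coe_mk, NNReal.coe_one, one_mul, hd])
    have hne : NNReal.mk _ hvar ≠ 0 := by
      intro h1
      have := congrArg NNReal.toReal h1
      rw [NNReal.coe_mk, NNReal.coe_zero] at this
      linarith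
    have hnull := nullSingletonClass_gaussianReal (μ := 0) hne
    have hz : gauss (Fin 3) 1 {x | ∑ i, (a i - b i) * x i = 0} = 0 := by
      have : (gauss (Fin 3) 1).map (fun x => ∑ i, (a i - b i) * x i) {0} = 0 := by
        rw [hlaw]; exact measure_singleton 0
      rwa [Measure.map_apply (by fun_prop) (measurableSet_singleton 0)] at this
    have hfalse : ∀ᵐ x ∂(gauss (Fin 3) 1), False := by
      have h2 : ∀ᵐ x ∂(gauss (Fin 3) 1), ¬ ∑ i, (a i - b i) * x i = 0 := by
        rw [ae_iff]; simpa using hz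
      filter_upwards [hae, h2] with x hx1 hx2
      apply hx2
      rw [← hdiff]
      simp only [Pi.zero_apply, div_eq_zero_iff, OfNat.ofNat_ne_zero, or_false,
        pow_eq_zero_iff (two_ne_zero), sub_eq_zero] at hx1
      have h3 := Real.tanh_injective hx1
      have h4 : β * (A x - B x) = 0 := by linarith
      exact (mul_eq_zero.1 h4).resolve_left hβ.ne'
    exact (IsProbabilityMeasure.ne_zero (gauss (Fin 3) 1)) (by simpa using hfalse)
  · rw [hsq]
    have hle : ∀ x, (Real.tanh (h + β * A x) - Real.tanh (h + β * B x)) ^ 2 / 2 ≤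
        β ^ 2 / 2 * (∑ i, (a i - b i) * x i) ^ 2 := fun x => by
      have := sq_le_sq.2 (lipschitz_tanh (h + β * A x) (h + β * B x))
      rw [← hdiff]
      nlinarith
    refine (integral_mono hint ((integrable_sq_linearForm_gauss 1 _).const_mul _) hle).trans ?_
    rw [integral_const_mul, integral_sq_linearForm_gauss, hd, NNReal.coe_one]
    linarith

theorem psi_zero : psi β h 0 = gammaOne β h ^ 2 := by
  have : ∀ z z' z'' : ℝ, Real.tanh (h + β * (√0 * z + √(overlap β h - 0) * z')) *
        Real.tanh (h + β * (√0 * z + √(overlap β h - 0) * z'')) =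
      Real.tanh (h + β * √(overlap β h) * z') * Real.tanh (h + β * √(overlap β h) * z'') := by
    intro z z' z''; simp [mul_assoc]
  rw [psi]
  simp_rw [this, integral_const_mul, integral_mul_const]
  rw [integral_const, gammaOne, sq]
  simp

/-- Symmetrizing x ↦ -x replaces the integrand by tanh(h+y) + tanh(h-y), which is positive for h >
0. -/
theorem gammaOne_pos (hh : 0 < h) : 0 < gammaOne β h := by
  set c := β * √(overlap β h)
  have hc := continuous_tanh_affine h c
  have hi : Integrable (fun x => Real.tanh (h + c * x)) (gaussianReal 0 1) :=
    integrable_of_bounded hc fun x => abs_tanh_le_one _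
  have hneg : ∫ x, Real.tanh (h + c * x) ∂(gaussianReal 0 1) =
      ∫ x, Real.tanh (h - c * x) ∂(gaussianReal 0 1) := by
    have h1 := gaussianReal_map_neg (μ := 0) (v := 1)
    rw [neg_zero] at h1
    conv_lhs => rw [← h1]
    rw [integral_map (by fun_prop) hc.aestronglyMeasurable]
    simp_rw [mul_neg, ← sub_eq_add_neg]
  have hi' : Integrable (fun x => Real.tanh (h - c * x)) (gaussianReal 0 1) :=
    integrable_of_bounded (continuous_tanh.comp (by fun_prop)) fun x => abs_tanh_le_one _
  have h2 : 2 * gammaOne β h =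
      ∫ x, (Real.tanh (h + c * x) + Real.tanh (h - c * x)) ∂(gaussianReal 0 1) := by
    rw [integral_add hi hi', ← hneg, two_mul]; rfl
  have hpos : ∀ x, 0 < Real.tanh (h + c * x) + Real.tanh (h - c * x) := fun x => by
    rw [tanh_add_tanh_sub]
    have := Real.cosh_pos h
    have := Real.sinh_pos_iff.2 hh
    positivity
  have h3 : 0 < ∫ x, (Real.tanh (h + c * x) + Real.tanh (h - c * x)) ∂(gaussianReal 0 1) := by
    rw [integral_pos_iff_support_of_nonneg (fun x => (hpos x).le) (hi.add hi')]
    have : Function.support (fun x => Real.tanh (h + c * x) + Real.tanh (h - c * x)) =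
        Set.univ := Set.eq_univ_of_forall fun x => (hpos x).ne'
    rw [this]; simp
  linarith

/-- At t = 0 the two fields are independent, so strictness of Cauchy–Schwarz here is a special case
of `psi_bounds`. -/
theorem gammaOne_sq_lt (hβ : 0 < β) (hh : 0 < h) : gammaOne β h ^ 2 < overlap β h := by
  have := (psi_bounds hβ le_rfl (overlap_pos β hh)).1
  rw [psi_zero] at this
  linarith

/-- `∑_{j<k} γ_j²`. -/
def gammaSum (β h : ℝ) (k : ℕ) : ℝ := ∑ j ∈ Finset.range k, gammaSeq β h j ^ 2

theorem gammaSum_eq (k : ℕ) : ∑ j : Fin k, gammaSeq β h j ^ 2 = gammaSum β h k :=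
  Fin.sum_univ_eq_sum_range (fun j => gammaSeq β h j ^ 2) k

theorem gammaSeq_zero : gammaSeq β h 0 = gammaOne β h := by rw [gammaSeq]

theorem gammaSeq_succ (k : ℕ) : gammaSeq β h (k + 1) =
    (rhoSeq β h (k + 1) - gammaSum β h (k + 1)) / √(overlap β h - gammaSum β h (k + 1)) := by
  rw [gammaSeq, gammaSum_eq]

theorem rhoSeq_mem (hβ : 0 < β) (hβ1 : β ^ 2 < 1) (hh : 0 < h) (k : ℕ) :
    0 < rhoSeq β h k ∧ rhoSeq β h k < overlap β h := by
  induction k with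
  | zero =>
    have h1 := gammaOne_pos (β := β) hh
    have h2 := overlap_pos β hh
    have h3 := gammaOne_sq_lt hβ hh
    have h4 := Real.sqrt_pos.2 h2
    have h5 := Real.sq_sqrt h2.le
    rw [rhoSeq]
    refine ⟨by positivity, ?_⟩
    have h6 : gammaOne β h < √(overlap β h) := Real.lt_sqrt_of_sq_lt h3
    nlinarith
  | succ k ih =>
    obtain ⟨h1, h2⟩ := psi_bounds hβ ih.1.le ih.2
    rw [rhoSeq]
    constructor
    · nlinarith
    · linarith

theorem rhoSeq_succ_bounds (hβ : 0 < β) (hβ1 : β ^ 2 < 1) (hh : 0 < h) (k : ℕ) :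
    overlap β h - rhoSeq β h (k + 1) ≤ β ^ 2 * (overlap β h - rhoSeq β h k) :=
  have h1 := rhoSeq_mem hβ hβ1 hh k
  (psi_bounds hβ h1.1.le h1.2).2

theorem rhoSeq_lt_succ (hβ : 0 < β) (hβ1 : β ^ 2 < 1) (hh : 0 < h) (k : ℕ) :
    rhoSeq β h k < rhoSeq β h (k + 1) := by
  have h1 := rhoSeq_succ_bounds hβ hβ1 hh k
  have h2 := rhoSeq_mem hβ hβ1 hh k
  nlinarith

/-- Each application of ψ shrinks the distance to q at least by the factor β² < 1. -/
theorem tendsto_rhoSeq (hβ : 0 < β) (hβ1 : β ^ 2 < 1) (hh : 0 < h) :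
    Tendsto (rhoSeq β h) atTop (𝓝 (overlap β h)) := by
  have hb : ∀ k, overlap β h - rhoSeq β h k ≤ (β ^ 2) ^ k * overlap β h := by
    intro k
    induction k with
    | zero => simpa using (rhoSeq_mem hβ hβ1 hh 0).1.le
    | succ k ih =>
      refine (rhoSeq_succ_bounds hβ hβ1 hh k).trans ?_
      rw [pow_succ' (β ^ 2), mul_assoc]
      exact mul_le_mul_of_nonneg_left ih (sq_nonneg β)
  have h0 : Tendsto (fun k => (β ^ 2) ^ k * overlap β h) atTop (𝓝 0) := by
    have := (tendsto_pow_atTop_nhds_zero_of_lt_one (sq_nonneg β) hβ1).mul_const (overlap β h)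
    simpa using this
  have h1 : Tendsto (fun k => overlap β h - rhoSeq β h k) atTop (𝓝 0) :=
    squeeze_zero (fun k => by linarith [(rhoSeq_mem hβ hβ1 hh k).2]) hb h0
  have h2 := (tendsto_const_nhds (x := overlap β h)).sub h1
  simpa using h2

theorem gammaSum_succ (k : ℕ) : gammaSum β h (k + 1) = gammaSum β h k + gammaSeq β h k ^ 2 :=
  Finset.sum_range_succ _ _

/-- With x = ρ - Γ² and y = q - Γ² the new term is γ² = x²/y, and 0 < x < y gives γ² < x. In
particular the square roots in the definition of γ have positive arguments. -/
theorem gammaSum_succ_lt_rhoSeq (hβ : 0 < β) (hβ1 : β ^ 2 < 1) (hh : 0 < h) (k : ℕ) :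
    gammaSum β h (k + 1) < rhoSeq β h k := by
  induction k with
  | zero =>
    have h1 := gammaOne_pos (β := β) hh
    have h3 := gammaOne_sq_lt hβ hh
    have h6 : gammaOne β h < √(overlap β h) := Real.lt_sqrt_of_sq_lt h3
    rw [gammaSum_succ, gammaSeq_zero, rhoSeq, gammaSum]
    simp only [Finset.range_zero, Finset.sum_empty, zero_add]
    nlinarith
  | succ k ih =>
    have h1 := rhoSeq_lt_succ hβ hβ1 hh k
    have h2 := (rhoSeq_mem hβ hβ1 hh (k + 1)).2
    rw [gammaSum_succ, gammaSeq_succ, div_pow, Real.sq_sqrt (by linarith)]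
    have h3 : (rhoSeq β h (k + 1) - gammaSum β h (k + 1)) ^ 2 /
        (overlap β h - gammaSum β h (k + 1)) < rhoSeq β h (k + 1) - gammaSum β h (k + 1) := by
      rw [div_lt_iff₀ (by linarith)]
      nlinarith
    linarith

theorem gammaSum_lt (hβ : 0 < β) (hβ1 : β ^ 2 < 1) (hh : 0 < h) (k : ℕ) :
    gammaSum β h k < overlap β h := by
  cases k with
  | zero => simpa [gammaSum] using overlap_pos β hh
  | succ k =>
    exact (gammaSum_succ_lt_rhoSeq hβ hβ1 hh k).trans (rhoSeq_mem hβ hβ1 hh k).2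

/-- The identity `Γ_{k}² + γ_{k} √(q - Γ_{k}²) = ρ_{k}`. -/
theorem gammaSum_add (hβ : 0 < β) (hβ1 : β ^ 2 < 1) (hh : 0 < h) (k : ℕ) :
    gammaSum β h k + gammaSeq β h k * √(overlap β h - gammaSum β h k) = rhoSeq β h k := by
  cases k with
  | zero => simp [gammaSum, gammaSeq_zero, rhoSeq, mul_comm]
  | succ k =>
    have := Real.sqrt_pos.2 (sub_pos.2 (gammaSum_lt hβ hβ1 hh (k + 1)))
    rw [gammaSeq_succ, div_mul_cancel₀ _ this.ne']
    ring

/-- The partial sums increase and stay below q, so they converge and the terms γ tend to 0. Passing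
to the limit in Γ² + γ √(q - Γ²) = ρ identifies the limit with that of ρ, namely q. -/
theorem tendsto_gammaSum (hβ : 0 < β) (hβ1 : β ^ 2 < 1) (hh : 0 < h) :
    Tendsto (gammaSum β h) atTop (𝓝 (overlap β h)) ∧ Tendsto (gammaSeq β h) atTop (𝓝 0) := by
  have hmono : Monotone (gammaSum β h) := monotone_nat_of_le_succ fun k => by
    rw [gammaSum_succ]; linarith [sq_nonneg (gammaSeq β h k)]
  have hlim := tendsto_atTop_ciSup hmono
    ⟨overlap β h, by rintro _ ⟨k, rfl⟩; exact (gammaSum_lt hβ hβ1 hh k).le⟩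
  set G := ⨆ k, gammaSum β h k
  have hsq : Tendsto (fun k => gammaSeq β h k ^ 2) atTop (𝓝 0) := by
    have := ((tendsto_add_atTop_iff_nat 1).2 hlim).sub hlim
    simpa [gammaSum_succ] using this
  have hg : Tendsto (gammaSeq β h) atTop (𝓝 0) := by
    have := hsq.sqrt
    simp only [Real.sqrt_sq_eq_abs, Real.sqrt_zero] at this
    exact (tendsto_zero_iff_abs_tendsto_zero _).2 this
  have hprod : Tendsto (fun k => gammaSeq β h k * √(overlap β h - gammaSum β h k)) atTop
      (𝓝 (0 * √(overlap β h - G))) := hg.mul (tendsto_const_nhds.sub hlim).sqrt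
  have hsum := hlim.add hprod
  simp_rw [gammaSum_add hβ hβ1 hh, zero_mul, add_zero] at hsum
  have := tendsto_nhds_unique hsum (tendsto_rhoSeq hβ hβ1 hh)
  exact ⟨this ▸ hlim, hg⟩

/-! ### Gaussian integration by parts -/

theorem integral_mul_tanh (h c : ℝ) :
    ∫ x, x * Real.tanh (h + c * x) ∂(gaussianReal 0 1) =
      c * ∫ x, (1 - Real.tanh (h + c * x) ^ 2) ∂(gaussianReal 0 1) := by
  have hpdf : ∀ x, HasDerivAt (gaussianPDFReal 0 1) (-(x * gaussianPDFReal 0 1 x)) x := fun x => by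
    have h1 : HasDerivAt (fun x : ℝ => (√(2 * Real.pi * (1 : ℝ≥0)))⁻¹ *
        Real.exp (-(x - 0) ^ 2 / (2 * (1 : ℝ≥0)))) _ x :=
      ((((((hasDerivAt_id x).sub_const 0).pow 2).neg).div_const (2 * ((1 : ℝ≥0) : ℝ))).exp).const_mul
        ((√(2 * Real.pi * (1 : ℝ≥0)))⁻¹)
    unfold gaussianPDFReal
    convert! h1 using 1
    simp
    ring
  have hu : ∀ x, HasDerivAt (fun x => Real.tanh (h + c * x))
      (c * (1 - Real.tanh (h + c * x) ^ 2)) x := fun x => by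
    have h1 := (hasDerivAt_tanh (h + c * x)).comp x (((hasDerivAt_id x).const_mul c).const_add h)
    convert! h1 using 1
    simp; ring
  have hc := continuous_tanh_affine h c
  have hmul : ∀ {F : ℝ → ℝ} (_ : Continuous F) {G : ℝ → ℝ} (_ : Integrable G)
      {C : ℝ} (_ : ∀ x, |F x| ≤ C), Integrable (F * G) := fun hF G hG C hC =>
    hG.bdd_mul hF.aestronglyMeasurable (ae_of_all _ hC)
  have hpi := integrable_gaussianPDFReal 0 1
  have hxpi : Integrable fun x => -(x * gaussianPDFReal 0 1 x) := by
    have h1 : Integrable (fun x : ℝ => x) (gaussianReal 0 1) := by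
      simpa using integrable_pow_gaussianReal 1
    rw [gaussianReal_of_var_ne_zero 0 one_ne_zero,
      integrable_withDensity_iff (by fun_prop) (by simp [gaussianPDF])] at h1
    simp only [toReal_gaussianPDF] at h1
    exact h1.neg
  have hbd : ∀ x, |c * (1 - Real.tanh (h + c * x) ^ 2)| ≤ |c| := fun x => by
    rw [abs_mul]
    have := one_sub_tanh_sq_mem (h + c * x)
    rw [abs_of_nonneg this.1]
    exact mul_le_of_le_one_right (abs_nonneg c) this.2
  have key := integral_mul_deriv_eq_deriv_mul_of_integrable (u := fun x => Real.tanh (h + c * x))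
    (u' := fun x => c * (1 - Real.tanh (h + c * x) ^ 2))
    (v := gaussianPDFReal 0 1) (fun x _ => hu x) (fun x _ => hpdf x)
    (hmul hc hxpi fun x => abs_tanh_le_one _)
    (hmul (continuous_const.mul (continuous_const.sub (hc.pow 2))) hpi hbd)
    (hmul hc hpi fun x => abs_tanh_le_one _)
  rw [integral_gaussianReal_eq_integral_smul one_ne_zero,
    integral_gaussianReal_eq_integral_smul one_ne_zero, ← integral_const_mul]
  simp only [smul_eq_mul]
  have e1 : ∀ x, gaussianPDFReal 0 1 x * (x * Real.tanh (h + c * x)) =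
      -(Real.tanh (h + c * x) * -(x * gaussianPDFReal 0 1 x)) := fun x => by ring
  simp_rw [e1]
  rw [integral_neg, key, neg_neg]
  congr 1
  funext x
  ring

/-- Split x_s into its regression on A = Σ a_i x_i and a residual uncorrelated with A. The residual
contributes nothing, and the rest is Gaussian integration by parts in one variable. The value is the
limit of ⟨ζ_s, m⟩. -/
theorem integral_coord_mul_tanh (hq : 0 < overlap β h) {k : ℕ} {a : Fin k → ℝ}
    (ha : ∑ i, a i ^ 2 = overlap β h) (s : Fin k) :
    ∫ x, x s * Real.tanh (h + β * ∑ i, a i * x i) ∂(gauss (Fin k) 1) =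
      β * a s * (1 - overlap β h) := by
  set q := overlap β h with hqdef
  have hL : Continuous fun x : Fin k → ℝ => ∑ i, a i * x i := by fun_prop
  have htc : Continuous fun x : Fin k → ℝ => Real.tanh (h + β * ∑ i, a i * x i) :=
    continuous_tanh.comp (by fun_prop)
  set e : Fin k → ℝ := fun i => (if i = s then 1 else 0) - a s / q * a i with he
  have hes : ∀ x : Fin k → ℝ, ∑ i, e i * x i = x s - a s / q * ∑ i, a i * x i := fun x => by
    simp [he, sub_mul, Finset.sum_sub_distrib, Finset.mul_sum, mul_assoc]
  have horth : ∑ i, e i * a i = 0 := by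
    rw [hes]
    simp_rw [← sq]
    rw [ha]
    field_simp
    ring
  -- As e is orthogonal to a, changing its sign leaves the joint law with A unchanged, so the
  -- integral equals its own negative.
  have hflip := integral_pair_linearForm_gauss (a := e) (b := a) (a' := fun i => -e i) (b' := a)
    (by simp) rfl (by simp [horth]) (F := fun x y => x * Real.tanh (h + β * y))
    (continuous_fst.mul (continuous_tanh.comp (by fun_prop)))
  simp only [neg_mul, Finset.sum_neg_distrib, integral_neg] at hflip
  have hz : ∫ x, (∑ i, e i * x i) * Real.tanh (h + β * ∑ i, a i * x i) ∂(gauss (Fin k) 1) = 0 := by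
    linarith
  have hint : ∀ c : Fin k → ℝ, Integrable (fun x : Fin k → ℝ => (∑ i, c i * x i) *
      Real.tanh (h + β * ∑ i, a i * x i)) (gauss (Fin k) 1) := fun c => by
    have h1 : Integrable (fun x : Fin k → ℝ => ∑ i, c i * x i) (gauss (Fin k) 1) := by
      refine ((integrable_const 1).add (integrable_sq_linearForm_gauss 1 c)).mono'
        (Continuous.aestronglyMeasurable (by fun_prop)) (ae_of_all _ fun x => ?_)
      simp only [Pi.add_apply, Real.norm_eq_abs]
      rw [abs_le]
      constructor <;> nlinarith [sq_nonneg (∑ i, c i * x i + 1 / 2), sq_nonneg (∑ i, c i * x i - 1 / 2)]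
    exact h1.mul_bdd htc.aestronglyMeasurable (ae_of_all _ fun x => abs_tanh_le_one _)
  have hdecomp : ∀ x : Fin k → ℝ, x s * Real.tanh (h + β * ∑ i, a i * x i) =
      (∑ i, e i * x i) * Real.tanh (h + β * ∑ i, a i * x i) +
        a s / q * ((∑ i, a i * x i) * Real.tanh (h + β * ∑ i, a i * x i)) := fun x => by
    rw [hes]; ring
  simp_rw [hdecomp]
  rw [integral_add (hint e) ((hint a).const_mul _), hz, integral_const_mul,
    integral_linearForm_gauss ha (F := fun y => y * Real.tanh (h + β * y))
      (continuous_id.mul (continuous_tanh.comp (by fun_prop)))]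
  simp_rw [mul_assoc (√q), ← mul_assoc β]
  rw [integral_const_mul, integral_mul_tanh, integral_one_sub_tanh_sq, tanhSq_overlap, ← hqdef]
  have := Real.mul_self_sqrt hq.le
  field_simp
  linear_combination (β * a s * (1 - q)) * this

end Sequences

/-! ### Product measures on spins -/

section Spins

variable {N : ℕ}

/-- A spin configuration as a real vector. -/
def spin (σ : Fin N → ℤˣ) : Fin N → ℝ := fun i => ((σ i : ℤ) : ℝ)

theorem spin_mul_self (σ : Fin N → ℤˣ) (i : Fin N) : spin σ i * spin σ i = 1 := by
  rcases Int.units_eq_one_or (σ i) with h | h <;> simp [spin, h]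

theorem inner_spin_self (hN : N ≠ 0) (σ : Fin N → ℤˣ) : inner (spin σ) (spin σ) = 1 := by
  have : (N : ℝ) ≠ 0 := by positivity
  simp [inner, spin_mul_self, this]

theorem sum_exp_spin (b : Fin N → ℝ) :
    ∑ σ : Fin N → ℤˣ, Real.exp (∑ i, b i * spin σ i) = 2 ^ N * ∏ i, Real.cosh (b i) := by
  have h1 : ∀ σ : Fin N → ℤˣ, Real.exp (∑ i, b i * spin σ i) =
      ∏ i, Real.exp (b i * ((σ i : ℤ) : ℝ)) := fun σ => Real.exp_sum _ _
  simp_rw [h1]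
  rw [← Fintype.prod_sum (fun i (u : ℤˣ) => Real.exp (b i * ((u : ℤ) : ℝ)))]
  have h2 : ∀ i, ∑ u : ℤˣ, Real.exp (b i * ((u : ℤ) : ℝ)) = 2 * Real.cosh (b i) := fun i => by
    rw [UnitsInt.univ, Finset.sum_pair (by decide), Real.cosh_eq]
    simp
    ring
  simp_rw [h2]
  rw [Finset.prod_mul_distrib]
  simp

/-- The expectation under the product measure on spins with external fields `b`. -/
def gibbs (b : Fin N → ℝ) (f : (Fin N → ℤˣ) → ℝ) : ℝ :=
  (2 ^ N * ∏ i, Real.cosh (b i))⁻¹ * ∑ σ, Real.exp (∑ i, b i * spin σ i) * f σ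

theorem gibbs_norm_pos (b : Fin N → ℝ) : 0 < 2 ^ N * ∏ i, Real.cosh (b i) :=
  mul_pos (by positivity) (Finset.prod_pos fun i _ => Real.cosh_pos _)

theorem gibbs_mono {b : Fin N → ℝ} {f f' : (Fin N → ℤˣ) → ℝ} (hf : ∀ σ, f σ ≤ f' σ) :
    gibbs b f ≤ gibbs b f' :=
  mul_le_mul_of_nonneg_left (Finset.sum_le_sum fun σ _ =>
    mul_le_mul_of_nonneg_left (hf σ) (Real.exp_pos _).le) (inv_nonneg.2 (gibbs_norm_pos b).le)

theorem gibbs_add (b : Fin N → ℝ) (f f' : (Fin N → ℤˣ) → ℝ) :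
    gibbs b (fun σ => f σ + f' σ) = gibbs b f + gibbs b f' := by
  simp only [gibbs, mul_add, Finset.sum_add_distrib]

theorem gibbs_const_mul (b : Fin N → ℝ) (c : ℝ) (f : (Fin N → ℤˣ) → ℝ) :
    gibbs b (fun σ => c * f σ) = c * gibbs b f := by
  simp only [gibbs, mul_left_comm _ c, ← Finset.mul_sum]

theorem gibbs_const (b : Fin N → ℝ) (c : ℝ) : gibbs b (fun _ => c) = c := by
  rw [gibbs, ← Finset.sum_mul, sum_exp_spin, ← mul_assoc,
    inv_mul_cancel₀ (gibbs_norm_pos b).ne', one_mul]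

theorem gibbs_nonneg {b : Fin N → ℝ} {f : (Fin N → ℤˣ) → ℝ} (hf : ∀ σ, 0 ≤ f σ) :
    0 ≤ gibbs b f := by
  rw [← gibbs_const b 0]; exact gibbs_mono hf

/-- Jensen's inequality, from the tangent line of exp at the mean. -/
theorem exp_gibbs_le (b : Fin N → ℝ) (f : (Fin N → ℤˣ) → ℝ) :
    Real.exp (gibbs b f) ≤ gibbs b fun σ => Real.exp (f σ) := by
  set c := gibbs b f with hc
  have h1 : gibbs b (fun σ => Real.exp c * (f σ + (1 - c))) = Real.exp c := by
    rw [gibbs_const_mul, gibbs_add, gibbs_const, ← hc]; ring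
  rw [← h1]
  refine gibbs_mono fun σ => ?_
  have h2 := Real.add_one_le_exp (f σ - c)
  have h3 : Real.exp (f σ) = Real.exp c * Real.exp (f σ - c) := by rw [← Real.exp_add]; ring_nf
  rw [h3]
  exact mul_le_mul_of_nonneg_left (by linarith) (Real.exp_pos c).le

/-- Tilting by w only shifts the fields, so the ratio of normalizations is a product over sites and
`cosh_add_le` applies to each factor. -/
theorem gibbs_exp_le (b w : Fin N → ℝ) :
    gibbs b (fun σ => Real.exp (∑ i, w i * (spin σ i - Real.tanh (b i)))) ≤
      Real.exp ((∑ i, w i ^ 2) / 2) := by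
  have h1 : ∀ σ : Fin N → ℤˣ, Real.exp (∑ i, b i * spin σ i) *
      Real.exp (∑ i, w i * (spin σ i - Real.tanh (b i))) =
      Real.exp (∑ i, (b i + w i) * spin σ i) * Real.exp (-∑ i, w i * Real.tanh (b i)) := fun σ => by
    rw [← Real.exp_add, ← Real.exp_add, ← Finset.sum_add_distrib, ← sub_eq_add_neg,
      ← Finset.sum_sub_distrib]
    congr 1
    exact Finset.sum_congr rfl fun i _ => by ring
  rw [gibbs]
  simp_rw [h1]
  rw [← Finset.sum_mul, sum_exp_spin, inv_mul_le_iff₀ (gibbs_norm_pos b)]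
  have h2 : ∏ i, Real.cosh (b i + w i) ≤
      (∏ i, Real.cosh (b i)) * Real.exp (∑ i, (w i * Real.tanh (b i) + w i ^ 2 / 2)) := by
    rw [Real.exp_sum, ← Finset.prod_mul_distrib]
    exact Finset.prod_le_prod (fun i _ => (Real.cosh_pos _).le) fun i _ => cosh_add_le _ _
  calc _ ≤ 2 ^ N * ((∏ i, Real.cosh (b i)) *
        Real.exp (∑ i, (w i * Real.tanh (b i) + w i ^ 2 / 2))) *
        Real.exp (-∑ i, w i * Real.tanh (b i)) := by gcongr
    _ = 2 ^ N * (∏ i, Real.cosh (b i)) * (Real.exp (∑ i, (w i * Real.tanh (b i) + w i ^ 2 / 2)) *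
        Real.exp (-∑ i, w i * Real.tanh (b i))) := by ring
    _ = _ := by
      rw [← Real.exp_add, Finset.sum_add_distrib, Finset.sum_div]
      congr 2
      ring

/-- `E exp (Z²/4)`. -/
def expSqMoment : ℝ := ∫ x, Real.exp (1 / 4 * x ^ 2) ∂(gaussianReal 0 1)

theorem one_le_expSqMoment : 1 ≤ expSqMoment := by
  have h1 : ∫ _, (1 : ℝ) ∂(gaussianReal 0 1) ≤ expSqMoment :=
    integral_mono (integrable_const _) (integrable_exp_mul_sq_gaussianReal (by norm_num)) fun x =>
      Real.one_le_exp (by positivity)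
  simpa using h1

theorem integrable_exp_sum_sq {ι : Type*} [Fintype ι] :
    Integrable (fun z : ι → ℝ => Real.exp (1 / 4 * ∑ s, z s ^ 2)) (gauss ι 1) := by
  simp_rw [Finset.mul_sum, Real.exp_sum]
  exact Integrable.fintype_prod (f := fun _ (x : ℝ) => Real.exp (1 / 4 * x ^ 2))
    fun _ => integrable_exp_mul_sq_gaussianReal (by norm_num)

theorem integral_exp_sum_sq {ι : Type*} [Fintype ι] :
    ∫ z : ι → ℝ, Real.exp (1 / 4 * ∑ s, z s ^ 2) ∂(gauss ι 1) =
      expSqMoment ^ Fintype.card ι := by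
  simp_rw [Finset.mul_sum, Real.exp_sum]
  rw [integral_fintype_prod_eq_prod (f := fun _ (x : ℝ) => Real.exp (1 / 4 * x ^ 2))]
  simp [expSqMoment]

/-- Exponential moments of quadratic forms of centered spins. -/
theorem gibbs_exp_sq_le (hN : N ≠ 0) {ι : Type*} [Fintype ι] (b : Fin N → ℝ)
    (v : ι → Fin N → ℝ) {l B : ℝ} (hl : 0 ≤ l) (hlB : l * B ≤ 1 / 4)
    (hB : ∀ z : ι → ℝ, inner (∑ s, z s • v s) (∑ s, z s • v s) ≤ B * ∑ s, z s ^ 2) :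
    gibbs b (fun σ => Real.exp (N * (l *
      ∑ s, inner (v s) (spin σ - fun i => Real.tanh (b i)) ^ 2))) ≤
      expSqMoment ^ Fintype.card ι := by
  have hN' : (0 : ℝ) < N := by positivity
  set y : (Fin N → ℤˣ) → ι → ℝ := fun σ s => inner (v s) (spin σ - fun i => Real.tanh (b i))
    with hy
  -- Gaussian linearization: e^{c²y²/2} = E e^{cyz}, with one auxiliary variable per direction. The
  -- exponent becomes linear in the spins, where the sub-Gaussian bound applies; the condition l B ≤
  -- 1/4 then matches the moment E e^{Z²/4}.
  set c := √(2 * N * l) with hc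
  have hc2 : c ^ 2 = 2 * N * l := Real.sq_sqrt (by positivity)
  have h1 : ∀ σ, Real.exp (N * (l * ∑ s, y σ s ^ 2)) =
      ∫ z, Real.exp (∑ s, (c * y σ s) * z s) ∂(gauss ι 1) := fun σ => by
    rw [integral_exp_gauss]
    simp_rw [mul_pow, ← Finset.mul_sum, hc2]
    congr 1
    rw [NNReal.coe_one]
    ring
  have h2 : gibbs b (fun σ => Real.exp (N * (l * ∑ s, y σ s ^ 2))) =
      ∫ z, gibbs b (fun σ => Real.exp (∑ s, (c * y σ s) * z s)) ∂(gauss ι 1) := by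
    simp only [gibbs]
    rw [integral_const_mul, integral_finsetSum _ fun σ _ => (integrable_exp_gauss _ _).const_mul _]
    simp_rw [integral_const_mul, h1]
  rw [h2, ← integral_exp_sum_sq]
  refine integral_mono_of_nonneg (ae_of_all _ fun z => gibbs_nonneg fun σ => (Real.exp_pos _).le)
    integrable_exp_sum_sq (ae_of_all _ fun z => ?_)
  set w : Fin N → ℝ := fun i => c / N * (∑ s, z s • v s) i with hw
  have h3 : ∀ σ, ∑ s, (c * y σ s) * z s = ∑ i, w i * (spin σ i - Real.tanh (b i)) := fun σ => by
    have e1 : ∑ s, (c * y σ s) * z s =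
        c * inner (∑ s, z s • v s) (spin σ - fun i => Real.tanh (b i)) := by
      rw [inner_sum_left, Finset.mul_sum]
      refine Finset.sum_congr rfl fun s _ => ?_
      rw [inner_smul_left]
      ring
    rw [e1, inner, Finset.sum_div, Finset.mul_sum]
    refine Finset.sum_congr rfl fun i _ => ?_
    simp only [hw, Pi.sub_apply]
    ring
  simp only [h3]
  refine (gibbs_exp_le b w).trans (Real.exp_le_exp.2 ?_)
  have h4 : (∑ i, w i ^ 2) / 2 = l * inner (∑ s, z s • v s) (∑ s, z s • v s) := by
    have e2 : ∑ i, w i ^ 2 = c ^ 2 / N * inner (∑ s, z s • v s) (∑ s, z s • v s) := by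
      rw [inner, Finset.sum_div, Finset.mul_sum]
      refine Finset.sum_congr rfl fun i _ => ?_
      simp only [hw]
      field_simp
    rw [e2, hc2]
    field_simp
  rw [h4]
  calc _ ≤ l * (B * ∑ s, z s ^ 2) := mul_le_mul_of_nonneg_left (hB z) hl
    _ = l * B * ∑ s, z s ^ 2 := by ring
    _ ≤ _ := mul_le_mul_of_nonneg_right hlB (Finset.sum_nonneg fun s _ => sq_nonneg _)

theorem gibbs_exp_sq_le_one (hN : N ≠ 0) (b v : Fin N → ℝ) {l B : ℝ} (hl : 0 ≤ l)
    (hlB : l * B ≤ 1 / 4) (hB : inner v v ≤ B) :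
    gibbs b (fun σ => Real.exp (N * (l * inner v (spin σ - fun i => Real.tanh (b i)) ^ 2))) ≤
      expSqMoment := by
  have := gibbs_exp_sq_le hN b (fun _ : Unit => v) hl hlB (fun z => by
    simp only [Finset.univ_unique, Finset.sum_singleton, inner_smul_left, inner_smul_right]
    nlinarith [mul_le_mul_of_nonneg_left hB (sq_nonneg (z default))])
  simpa using this

theorem inner_sum_smul_self {ι : Type*} [Fintype ι] {φ : ι → Fin N → ℝ}
    (horth : ∀ s t, s ≠ t → inner (φ s) (φ t) = 0) (z : ι → ℝ) :
    inner (∑ s, z s • φ s) (∑ s, z s • φ s) = ∑ s, z s ^ 2 * inner (φ s) (φ s) := by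
  rw [inner_sum_left]
  refine Finset.sum_congr rfl fun s _ => ?_
  rw [inner_sum_right, Finset.sum_eq_single s]
  · rw [inner_smul_left, inner_smul_right]; ring
  · intro t _ hts
    rw [inner_smul_left, inner_smul_right, horth s t hts.symm]; ring
  · simp

theorem inner_sum_smul_self_le {ι : Type*} [Fintype ι] {φ : ι → Fin N → ℝ}
    (horth : ∀ s t, s ≠ t → inner (φ s) (φ t) = 0) (hone : ∀ s, inner (φ s) (φ s) ≤ 1)
    (z : ι → ℝ) : inner (∑ s, z s • φ s) (∑ s, z s • φ s) ≤ ∑ s, z s ^ 2 := by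
  rw [inner_sum_smul_self horth]
  exact Finset.sum_le_sum fun s _ => mul_le_of_le_one_right (sq_nonneg _) (hone s)

/-- Bessel's inequality. -/
theorem sum_inner_sq_le {ι : Type*} [Fintype ι] {φ : ι → Fin N → ℝ}
    (horth : ∀ s t, s ≠ t → inner (φ s) (φ t) = 0) (hone : ∀ s, inner (φ s) (φ s) ≤ 1)
    (x : Fin N → ℝ) : ∑ s, inner (φ s) x ^ 2 ≤ inner x x := by
  have h1 := inner_self_nonneg (x - ∑ s, inner (φ s) x • φ s)
  have h2 := inner_sum_smul_self_le horth hone fun s => inner (φ s) x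
  have h3 : inner (∑ s, inner (φ s) x • φ s) x = ∑ s, inner (φ s) x ^ 2 := by
    rw [inner_sum_left]
    exact Finset.sum_congr rfl fun s _ => by rw [inner_smul_left, sq]
  rw [inner_sub_left, inner_sub_right, inner_sub_right, inner_comm x (∑ s, _), h3] at h1
  linarith

theorem abs_inner_le (x y : Fin N → ℝ) : |inner x y| ≤ nrm x * nrm y := by
  have h1 : (∑ i, x i * y i) ^ 2 ≤ (∑ i, x i ^ 2) * ∑ i, y i ^ 2 :=
    Finset.sum_mul_sq_le_sq_mul_sq _ _ _
  rw [nrm, nrm, ← Real.sqrt_mul (inner_self_nonneg x)]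
  refine Real.abs_le_sqrt ?_
  simp only [inner, ← sq]
  rw [div_pow, div_mul_div_comm, ← sq]
  exact div_le_div_of_nonneg_right h1 (sq_nonneg _)

end Spins

/-! ### The conditional second moment as a sum over two replicas -/

section Replicas

variable {N : ℕ} {ι : Type*} [Fintype ι]

/-- The single-replica exponent. -/
def replicaExp (β h : ℝ) (φ ζ : ι → Fin N → ℝ) (e : ι → ℝ) (x : Fin N → ℝ) : ℝ :=
  β * ∑ s, inner (φ s) x * inner (ζ s) x - β / √2 * ∑ s, e s * inner (φ s) x ^ 2 +
    h * inner (fun _ => 1) x + β ^ 2 / 4 * (1 - ∑ s, inner (φ s) x ^ 2) ^ 2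

/-- The overlap of two replicas after projection. -/
def crossTerm (φ : ι → Fin N → ℝ) (x y : Fin N → ℝ) : ℝ :=
  inner x y - ∑ s, inner (φ s) x * inner (φ s) y

/-- The sum over two replicas. -/
def replicaSum (β h : ℝ) (φ ζ : ι → Fin N → ℝ) (e : ι → ℝ) : ℝ :=
  ((2 : ℝ) ^ N)⁻¹ ^ 2 * ∑ σ : Fin N → ℤˣ, ∑ τ : Fin N → ℤˣ,
    Real.exp (N * (replicaExp β h φ ζ e (spin σ) + replicaExp β h φ ζ e (spin τ) +
      β ^ 2 / 2 * crossTerm φ (spin σ) (spin τ) ^ 2))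

theorem replicaSum_pos (β h : ℝ) (φ ζ : ι → Fin N → ℝ) (e : ι → ℝ) :
    0 < replicaSum β h φ ζ e :=
  mul_pos (by positivity) (Finset.sum_pos (fun _ _ => Finset.sum_pos (fun _ _ => Real.exp_pos _)
    Finset.univ_nonempty) Finset.univ_nonempty)

/-! ### Bounds on the exponent that are uniform over configurations. -/

section Crude

variable {β h : ℝ} {φ ζ : ι → Fin N → ℝ} {e : ι → ℝ}

theorem nrm_spin (hN : N ≠ 0) (σ : Fin N → ℤˣ) : nrm (spin σ) = 1 := by
  rw [nrm, inner_spin_self hN, Real.sqrt_one]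

theorem sum_inner_spin_sq_le (hN : N ≠ 0) (horth : ∀ s t, s ≠ t → inner (φ s) (φ t) = 0)
    (hone : ∀ s, inner (φ s) (φ s) ≤ 1) (σ : Fin N → ℤˣ) :
    ∑ s, inner (φ s) (spin σ) ^ 2 ≤ 1 :=
  (sum_inner_sq_le horth hone _).trans (inner_spin_self hN σ).le

theorem sum_mul_inner_spin_sq_le (hN : N ≠ 0) (horth : ∀ s t, s ≠ t → inner (φ s) (φ t) = 0)
    (hone : ∀ s, inner (φ s) (φ s) ≤ 1) (hβ0 : 0 ≤ β) (hβ1 : β ≤ 1) (σ : Fin N → ℤˣ) :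
    |β / √2 * ∑ s, e s * inner (φ s) (spin σ) ^ 2| ≤ ∑ s, |e s| := by
  have h2 : 1 ≤ √2 := Real.one_le_sqrt.2 one_le_two
  have hx := sum_inner_spin_sq_le hN horth hone σ
  rw [abs_mul, abs_of_nonneg (by positivity)]
  have h3 : β / √2 ≤ 1 := (div_le_one (by positivity)).2 (hβ1.trans h2)
  refine (mul_le_of_le_one_left (abs_nonneg _) h3).trans
    ((Finset.abs_sum_le_sum_abs _ _).trans (Finset.sum_le_sum fun s _ => ?_))
  rw [abs_mul, abs_of_nonneg (sq_nonneg (inner (φ s) (spin σ)))]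
  exact mul_le_of_le_one_right (abs_nonneg _) ((Finset.single_le_sum (f := fun s =>
    inner (φ s) (spin σ) ^ 2) (fun t _ => sq_nonneg _) (Finset.mem_univ s)).trans hx)

theorem abs_replicaExp_le (hN : N ≠ 0) (horth : ∀ s t, s ≠ t → inner (φ s) (φ t) = 0)
    (hone : ∀ s, inner (φ s) (φ s) ≤ 1) (hβ0 : 0 ≤ β) (hβ1 : β ≤ 1) (hh : 0 ≤ h)
    (σ : Fin N → ℤˣ) :
    |replicaExp β h φ ζ e (spin σ)| ≤ ∑ s, nrm (ζ s) + ∑ s, |e s| + h + 1 := by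
  have hx := sum_inner_spin_sq_le hN horth hone σ
  have hx0 : 0 ≤ ∑ s, inner (φ s) (spin σ) ^ 2 := Finset.sum_nonneg fun s _ => sq_nonneg _
  have h1 : |β * ∑ s, inner (φ s) (spin σ) * inner (ζ s) (spin σ)| ≤ ∑ s, nrm (ζ s) := by
    rw [abs_mul, abs_of_nonneg hβ0]
    refine (mul_le_of_le_one_left (abs_nonneg _) hβ1).trans
      ((Finset.abs_sum_le_sum_abs _ _).trans (Finset.sum_le_sum fun s _ => ?_))
    rw [abs_mul]
    have e1 := abs_inner_le (ζ s) (spin σ)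
    rw [nrm_spin hN, mul_one] at e1
    have e2 : |inner (φ s) (spin σ)| ≤ 1 := by
      rw [← sq_le_one_iff_abs_le_one]
      exact (Finset.single_le_sum (f := fun s => inner (φ s) (spin σ) ^ 2)
        (fun t _ => sq_nonneg _) (Finset.mem_univ s)).trans hx
    exact (mul_le_of_le_one_left (abs_nonneg _) e2).trans e1
  have h2 := sum_mul_inner_spin_sq_le (e := e) hN horth hone hβ0 hβ1 σ
  have h3 : |h * inner (fun _ => 1) (spin σ)| ≤ h := by
    rw [abs_mul, abs_of_nonneg hh]
    refine mul_le_of_le_one_right hh ((abs_inner_le _ _).trans ?_)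
    have hN' : (N : ℝ) ≠ 0 := by positivity
    rw [nrm_spin hN, mul_one, nrm]
    simp [inner, hN']
  have h4 : |β ^ 2 / 4 * (1 - ∑ s, inner (φ s) (spin σ) ^ 2) ^ 2| ≤ 1 := by
    rw [abs_of_nonneg (by positivity)]
    have : (1 - ∑ s, inner (φ s) (spin σ) ^ 2) ^ 2 ≤ 1 := by nlinarith
    nlinarith
  rw [replicaExp]
  have a1 := abs_le.1 h1
  have a2 := abs_le.1 h2
  have a3 := abs_le.1 h3
  have a4 := abs_le.1 h4
  rw [abs_le]
  constructor <;> linarith [a1.1, a1.2, a2.1, a2.2, a3.1, a3.2, a4.1, a4.2]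

theorem abs_crossTerm_le (hN : N ≠ 0) (horth : ∀ s t, s ≠ t → inner (φ s) (φ t) = 0)
    (hone : ∀ s, inner (φ s) (φ s) ≤ 1) (σ τ : Fin N → ℤˣ) :
    |crossTerm φ (spin σ) (spin τ)| ≤ 2 := by
  have h1 := abs_inner_le (spin σ) (spin τ)
  rw [nrm_spin hN, nrm_spin hN, one_mul] at h1
  have h2 : (∑ s, inner (φ s) (spin σ) * inner (φ s) (spin τ)) ^ 2 ≤ 1 :=
    (Finset.sum_mul_sq_le_sq_mul_sq _ _ _).trans (mul_le_one₀
      (sum_inner_spin_sq_le hN horth hone σ) (Finset.sum_nonneg fun s _ => sq_nonneg _)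
      (sum_inner_spin_sq_le hN horth hone τ))
  have a1 := abs_le.1 h1
  have a2 := abs_le.1 ((sq_le_one_iff_abs_le_one _).1 h2)
  rw [crossTerm, abs_le]
  constructor <;> linarith [a1.1, a1.2, a2.1, a2.2]

/-- A crude bound on the free energy of two replicas. -/
theorem abs_log_replicaSum_le (hN : N ≠ 0) (horth : ∀ s t, s ≠ t → inner (φ s) (φ t) = 0)
    (hone : ∀ s, inner (φ s) (φ s) ≤ 1) (hβ0 : 0 ≤ β) (hβ1 : β ≤ 1) (hh : 0 ≤ h) :
    |1 / (N : ℝ) * Real.log (replicaSum β h φ ζ e)| ≤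
      2 * (∑ s, nrm (ζ s) + ∑ s, |e s| + h + 1) + 2 := by
  have hN' : (0 : ℝ) < N := by positivity
  set C := ∑ s, nrm (ζ s) + ∑ s, |e s| + h + 1
  have hE : ∀ σ τ : Fin N → ℤˣ, |replicaExp β h φ ζ e (spin σ) + replicaExp β h φ ζ e (spin τ) +
      β ^ 2 / 2 * crossTerm φ (spin σ) (spin τ) ^ 2| ≤ 2 * C + 2 := fun σ τ => by
    have h1 := abs_le.1 (abs_replicaExp_le (ζ := ζ) (e := e) hN horth hone hβ0 hβ1 hh σ)
    have h2 := abs_le.1 (abs_replicaExp_le (ζ := ζ) (e := e) hN horth hone hβ0 hβ1 hh τ)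
    have h3 := abs_le.1 (abs_crossTerm_le hN horth hone σ τ)
    have h4 : crossTerm φ (spin σ) (spin τ) ^ 2 ≤ 4 := by nlinarith [h3.1, h3.2]
    have h5 : 0 ≤ β ^ 2 / 2 * crossTerm φ (spin σ) (spin τ) ^ 2 := by positivity
    have h6 : β ^ 2 / 2 * crossTerm φ (spin σ) (spin τ) ^ 2 ≤ 2 := by
      nlinarith [sq_nonneg (crossTerm φ (spin σ) (spin τ))]
    rw [abs_le]
    constructor <;> linarith [h1.1, h1.2, h2.1, h2.2]
  have hsum : ∀ c : ℝ, ((2 : ℝ) ^ N)⁻¹ ^ 2 * ∑ _σ : Fin N → ℤˣ, ∑ _τ : Fin N → ℤˣ, c = c := by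
    intro c
    simp only [Finset.sum_const, Finset.card_univ, Fintype.card_pi, Fintype.card_units_int,
      Finset.prod_const, Fintype.card_fin, nsmul_eq_mul]
    push_cast
    field_simp
  have hup : replicaSum β h φ ζ e ≤ Real.exp (N * (2 * C + 2)) := by
    rw [← hsum (Real.exp (N * (2 * C + 2)))]
    refine mul_le_mul_of_nonneg_left (Finset.sum_le_sum fun σ _ => Finset.sum_le_sum fun τ _ =>
      Real.exp_le_exp.2 (mul_le_mul_of_nonneg_left (abs_le.1 (hE σ τ)).2 hN'.le)) (by positivity)
  have hlo : Real.exp (N * -(2 * C + 2)) ≤ replicaSum β h φ ζ e := by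
    rw [← hsum (Real.exp (N * -(2 * C + 2)))]
    refine mul_le_mul_of_nonneg_left (Finset.sum_le_sum fun σ _ => Finset.sum_le_sum fun τ _ =>
      Real.exp_le_exp.2 (mul_le_mul_of_nonneg_left (abs_le.1 (hE σ τ)).1 hN'.le)) (by positivity)
  have hpos := replicaSum_pos β h φ ζ e
  have l1 := (Real.log_le_iff_le_exp hpos).2 hup
  have l2 := (Real.le_log_iff_exp_le hpos).2 hlo
  rw [abs_le, one_div, inv_mul_eq_div, le_div_iff₀ hN', div_le_iff₀ hN']
  constructor <;> linarith

end Crude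

/-! ### Second-order expansion around the effective field. -/

section Expansion

variable {β h : ℝ} {φ ζ : ι → Fin N → ℝ} {e a : ι → ℝ}

/-- The effective field `h + β ∑_s a_s ζ_s`. -/
def effField (β h : ℝ) (ζ : ι → Fin N → ℝ) (a : ι → ℝ) : Fin N → ℝ :=
  fun i => h + β * ∑ s, a s * ζ s i

/-- The mean spins in the effective field. -/
def effMean (β h : ℝ) (ζ : ι → Fin N → ℝ) (a : ι → ℝ) : Fin N → ℝ :=
  fun i => Real.tanh (effField β h ζ a i)

/-- The part of the exponent that is of second order around the effective field. -/
def replicaRem (β q : ℝ) (φ ζ : ι → Fin N → ℝ) (e a : ι → ℝ) (x : Fin N → ℝ) : ℝ :=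
  β * ∑ s, (inner (φ s) x - a s) * (inner (ζ s) x - β * a s * (1 - q)) -
    β ^ 2 / 2 * (1 - q) * ∑ s, (inner (φ s) x - a s) ^ 2 +
    β ^ 2 / 4 * (∑ s, inner (φ s) x ^ 2 - q) ^ 2 - β / √2 * ∑ s, e s * inner (φ s) x ^ 2

/-- Centering ⟨φ_s, x⟩ at a_s and ⟨ζ_s, x⟩ at βa_s(1-q), the terms linear in ⟨φ_s, x⟩ from the
product cancel those from the expansion of (1 - Σ⟨φ_s, x⟩²)². The linear terms left over form
exactly the effective field. -/
theorem replicaExp_eq (hN : N ≠ 0) {q : ℝ} (ha : ∑ s, a s ^ 2 = q) (x : Fin N → ℝ) :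
    N * replicaExp β h φ ζ e x = ∑ i, effField β h ζ a i * x i +
      N * (β ^ 2 / 4 * (1 - q) ^ 2) + N * replicaRem β q φ ζ e a x := by
  have hN' : (N : ℝ) ≠ 0 := by positivity
  have h1 : ∑ i, effField β h ζ a i * x i =
      N * (h * inner (fun _ => 1) x + β * ∑ s, a s * inner (ζ s) x) := by
    simp only [effField, add_mul, Finset.sum_add_distrib, inner, one_mul]
    rw [mul_add, ← Finset.mul_sum]
    congr 1
    · field_simp
    · simp only [Finset.mul_sum, Finset.sum_mul, Finset.sum_div]
      rw [Finset.sum_comm]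
      refine Finset.sum_congr rfl fun s _ => Finset.sum_congr rfl fun i _ => ?_
      field_simp
  have e1 : ∑ s, (inner (φ s) x - a s) * (inner (ζ s) x - β * a s * (1 - q)) =
      ∑ s, inner (φ s) x * inner (ζ s) x - ∑ s, a s * inner (ζ s) x -
        β * (1 - q) * ∑ s, a s * inner (φ s) x + β * (1 - q) * q := by
    rw [← ha]
    simp only [Finset.mul_sum, ← Finset.sum_sub_distrib, ← Finset.sum_add_distrib]
    exact Finset.sum_congr rfl fun s _ => by ring
  have e2 : ∑ s, (inner (φ s) x - a s) ^ 2 =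
      ∑ s, inner (φ s) x ^ 2 - 2 * ∑ s, a s * inner (φ s) x + q := by
    rw [← ha]
    simp only [Finset.mul_sum, ← Finset.sum_sub_distrib, ← Finset.sum_add_distrib]
    exact Finset.sum_congr rfl fun s _ => by ring
  rw [h1, replicaRem, e1, e2, replicaExp]
  ring

theorem replicaSum_eq (hN : N ≠ 0) {q : ℝ} (ha : ∑ s, a s ^ 2 = q) :
    replicaSum β h φ ζ e = (∏ i, Real.cosh (effField β h ζ a i)) ^ 2 *
      Real.exp (N * (β ^ 2 * (1 - q) ^ 2 / 2)) *
      gibbs (effField β h ζ a) fun σ => gibbs (effField β h ζ a) fun τ =>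
        Real.exp (N * (replicaRem β q φ ζ e a (spin σ) + replicaRem β q φ ζ e a (spin τ) +
          β ^ 2 / 2 * crossTerm φ (spin σ) (spin τ) ^ 2)) := by
  set b := effField β h ζ a with hb
  have h1 : ∀ σ τ : Fin N → ℤˣ, Real.exp (N * (replicaExp β h φ ζ e (spin σ) +
      replicaExp β h φ ζ e (spin τ) + β ^ 2 / 2 * crossTerm φ (spin σ) (spin τ) ^ 2)) =
      Real.exp (N * (β ^ 2 * (1 - q) ^ 2 / 2)) * (Real.exp (∑ i, b i * spin σ i) *
      (Real.exp (∑ i, b i * spin τ i) * Real.exp (N * (replicaRem β q φ ζ e a (spin σ) +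
        replicaRem β q φ ζ e a (spin τ) +
          β ^ 2 / 2 * crossTerm φ (spin σ) (spin τ) ^ 2)))) := fun σ τ => by
    rw [← Real.exp_add, ← Real.exp_add, ← Real.exp_add, mul_add, mul_add,
      replicaExp_eq hN ha, replicaExp_eq hN ha]
    congr 1
    ring
  simp only [replicaSum, h1, ← Finset.mul_sum, gibbs]
  have hP : ∏ i, Real.cosh (b i) ≠ 0 := (Finset.prod_pos fun i _ => Real.cosh_pos _).ne'
  simp only [mul_left_comm _ (2 ^ N * ∏ i, Real.cosh (b i))⁻¹, ← Finset.mul_sum]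
  field_simp

/-- A difference of squares and Cauchy–Schwarz; the factor Σ(⟨φ_s, σ⟩ + a_s)² is at most 4 by
Bessel's inequality. A quartic term is thereby bounded by a quadratic one. -/
theorem sq_sum_sub_le (hN : N ≠ 0) (horth : ∀ s t, s ≠ t → inner (φ s) (φ t) = 0)
    (hone : ∀ s, inner (φ s) (φ s) ≤ 1) {q : ℝ} (hq1 : q ≤ 1) (ha : ∑ s, a s ^ 2 = q)
    (σ : Fin N → ℤˣ) :
    (∑ s, inner (φ s) (spin σ) ^ 2 - q) ^ 2 ≤ 4 * ∑ s, (inner (φ s) (spin σ) - a s) ^ 2 := by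
  have hx := sum_inner_spin_sq_le hN horth hone σ
  have h1 : ∑ s, inner (φ s) (spin σ) ^ 2 - q =
      ∑ s, (inner (φ s) (spin σ) - a s) * (inner (φ s) (spin σ) + a s) := by
    rw [← ha, ← Finset.sum_sub_distrib]
    exact Finset.sum_congr rfl fun s _ => by ring
  have h2 : ∑ s, (inner (φ s) (spin σ) + a s) ^ 2 ≤ 4 := by
    calc _ ≤ ∑ s, (2 * inner (φ s) (spin σ) ^ 2 + 2 * a s ^ 2) :=
          Finset.sum_le_sum fun s _ => by nlinarith [sq_nonneg (inner (φ s) (spin σ) - a s)]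
      _ = 2 * ∑ s, inner (φ s) (spin σ) ^ 2 + 2 * q := by
          rw [Finset.sum_add_distrib, ← Finset.mul_sum, ← Finset.mul_sum, ha]
      _ ≤ 4 := by linarith
  rw [h1]
  refine (Finset.sum_mul_sq_le_sq_mul_sq _ _ _).trans ?_
  rw [mul_comm]
  exact mul_le_mul_of_nonneg_right h2 (Finset.sum_nonneg fun s _ => sq_nonneg _)

theorem abs_replicaRem_le (hN : N ≠ 0) (horth : ∀ s t, s ≠ t → inner (φ s) (φ t) = 0)
    (hone : ∀ s, inner (φ s) (φ s) ≤ 1) (hβ0 : 0 ≤ β) (hβ1 : β ≤ 1) {q : ℝ} (hq0 : 0 ≤ q)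
    (hq1 : q ≤ 1) (ha : ∑ s, a s ^ 2 = q) (σ : Fin N → ℤˣ) :
    |replicaRem β q φ ζ e a (spin σ)| ≤
      2 * β * (∑ s, (inner (φ s) (spin σ) - a s) ^ 2 +
        ∑ s, (inner (ζ s) (spin σ) - β * a s * (1 - q)) ^ 2) + ∑ s, |e s| := by
  set X := ∑ s, (inner (φ s) (spin σ) - a s) ^ 2 with hX
  set Y := ∑ s, (inner (ζ s) (spin σ) - β * a s * (1 - q)) ^ 2 with hY
  have hX0 : 0 ≤ X := Finset.sum_nonneg fun s _ => sq_nonneg _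
  have hY0 : 0 ≤ Y := Finset.sum_nonneg fun s _ => sq_nonneg _
  have h1 : |∑ s, (inner (φ s) (spin σ) - a s) *
      (inner (ζ s) (spin σ) - β * a s * (1 - q))| ≤ (X + Y) / 2 := by
    refine (Finset.abs_sum_le_sum_abs _ _).trans ?_
    rw [hX, hY, ← Finset.sum_add_distrib, Finset.sum_div]
    refine Finset.sum_le_sum fun s _ => ?_
    rw [abs_le]
    constructor <;> nlinarith [
      sq_nonneg (inner (φ s) (spin σ) - a s + (inner (ζ s) (spin σ) - β * a s * (1 - q))),
      sq_nonneg (inner (φ s) (spin σ) - a s - (inner (ζ s) (spin σ) - β * a s * (1 - q)))]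
  have h2 := sum_mul_inner_spin_sq_le (e := e) hN horth hone hβ0 hβ1 σ
  have h3 := sq_sum_sub_le hN horth hone hq1 ha σ
  have hβ2 : β ^ 2 ≤ β := by nlinarith
  have h4 : 0 ≤ β ^ 2 / 2 * (1 - q) * X :=
    mul_nonneg (mul_nonneg (by positivity) (by linarith)) hX0
  have h5 : β ^ 2 / 2 * (1 - q) * X ≤ β / 2 * X := by
    refine mul_le_mul_of_nonneg_right ?_ hX0
    nlinarith [sq_nonneg β]
  have h6 : 0 ≤ β ^ 2 / 4 * (∑ s, inner (φ s) (spin σ) ^ 2 - q) ^ 2 := by positivity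
  have h7 : β ^ 2 / 4 * (∑ s, inner (φ s) (spin σ) ^ 2 - q) ^ 2 ≤ β * X := by
    calc _ ≤ β ^ 2 / 4 * (4 * X) := mul_le_mul_of_nonneg_left h3 (by positivity)
      _ = β ^ 2 * X := by ring
      _ ≤ _ := mul_le_mul_of_nonneg_right hβ2 hX0
  have a1 := abs_le.1 h1
  have a2 := abs_le.1 h2
  have b1 := mul_le_mul_of_nonneg_left a1.1 hβ0
  have b2 := mul_le_mul_of_nonneg_left a1.2 hβ0
  have c1 : 0 ≤ β * X := mul_nonneg hβ0 hX0
  have c2 : 0 ≤ β * Y := mul_nonneg hβ0 hY0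
  rw [replicaRem, abs_le]
  constructor <;> nlinarith [a2.1, a2.2]

/-- Expanding ⟨σ, τ⟩ around m and Σ⟨φ_s, σ⟩⟨φ_s, τ⟩ around q, the main terms ⟨m, m⟩ and q nearly
cancel. Seven small terms remain. The constant 35 is 7(1 + 4), as the bilinear term C is bounded
through Y ≤ 4. -/
theorem crossTerm_sq_le (hN : N ≠ 0) (horth : ∀ s t, s ≠ t → inner (φ s) (φ t) = 0)
    (hone : ∀ s, inner (φ s) (φ s) ≤ 1) {q : ℝ}
    (hq1 : q ≤ 1) (ha : ∑ s, a s ^ 2 = q) (m : Fin N → ℝ) (σ τ : Fin N → ℤˣ) :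
    crossTerm φ (spin σ) (spin τ) ^ 2 ≤ 7 * inner (spin τ - m) (spin σ - m) ^ 2 +
      7 * inner m (spin σ - m) ^ 2 + 7 * inner m (spin τ - m) ^ 2 + 7 * (inner m m - q) ^ 2 +
      35 * ∑ s, (inner (φ s) (spin σ) - a s) ^ 2 +
      35 * ∑ s, (inner (φ s) (spin τ) - a s) ^ 2 := by
  have hxτ := sum_inner_spin_sq_le hN horth hone τ
  set X := ∑ s, (inner (φ s) (spin σ) - a s) ^ 2 with hX
  set Y := ∑ s, (inner (φ s) (spin τ) - a s) ^ 2 with hY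
  have hX0 : 0 ≤ X := Finset.sum_nonneg fun s _ => sq_nonneg _
  have hY0 : 0 ≤ Y := Finset.sum_nonneg fun s _ => sq_nonneg _
  have hY4 : Y ≤ 4 := by
    calc Y ≤ ∑ s, (2 * inner (φ s) (spin τ) ^ 2 + 2 * a s ^ 2) :=
          Finset.sum_le_sum fun s _ => by nlinarith [sq_nonneg (inner (φ s) (spin τ) + a s)]
      _ = 2 * ∑ s, inner (φ s) (spin τ) ^ 2 + 2 * q := by
          rw [Finset.sum_add_distrib, ← Finset.mul_sum, ← Finset.mul_sum, ha]
      _ ≤ 4 := by linarith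
  set A := ∑ s, a s * (inner (φ s) (spin σ) - a s) with hA
  set B := ∑ s, a s * (inner (φ s) (spin τ) - a s) with hB
  set C := ∑ s, (inner (φ s) (spin σ) - a s) * (inner (φ s) (spin τ) - a s) with hC
  have hA2 : A ^ 2 ≤ X := (Finset.sum_mul_sq_le_sq_mul_sq _ _ _).trans
    (by rw [ha]; exact mul_le_of_le_one_left hX0 hq1)
  have hB2 : B ^ 2 ≤ Y := (Finset.sum_mul_sq_le_sq_mul_sq _ _ _).trans
    (by rw [ha]; exact mul_le_of_le_one_left hY0 hq1)
  have hC2 : C ^ 2 ≤ 4 * X := (Finset.sum_mul_sq_le_sq_mul_sq _ _ _).trans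
    (by rw [mul_comm]; exact mul_le_mul_of_nonneg_right hY4 hX0)
  have e1 : ∑ s, inner (φ s) (spin σ) * inner (φ s) (spin τ) = q + A + B + C := by
    rw [← ha, hA, hB, hC, ← Finset.sum_add_distrib, ← Finset.sum_add_distrib,
      ← Finset.sum_add_distrib]
    exact Finset.sum_congr rfl fun s _ => by ring
  have e2 : inner (spin σ) (spin τ) = inner (spin τ - m) (spin σ - m) +
      inner m (spin σ - m) + inner m (spin τ - m) + inner m m := by
    simp only [inner_sub_left, inner_sub_right, inner_comm (spin τ) (spin σ),
      inner_comm (spin τ) m]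
    ring
  have e3 : crossTerm φ (spin σ) (spin τ) = inner (spin τ - m) (spin σ - m) +
      inner m (spin σ - m) + inner m (spin τ - m) + (inner m m - q) - A - B - C := by
    rw [crossTerm, e1, e2]; ring
  have h7 : ∀ x1 x2 x3 x4 x5 x6 x7 : ℝ, (x1 + x2 + x3 + x4 - x5 - x6 - x7) ^ 2 ≤
      7 * (x1 ^ 2 + x2 ^ 2 + x3 ^ 2 + x4 ^ 2 + x5 ^ 2 + x6 ^ 2 + x7 ^ 2) := by
    intro x1 x2 x3 x4 x5 x6 x7
    -- Cauchy–Schwarz against the all-ones vector.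
    have := Finset.sum_mul_sq_le_sq_mul_sq Finset.univ
      (![1, 1, 1, 1, 1, 1, 1] : Fin 7 → ℝ) ![x1, x2, x3, x4, -x5, -x6, -x7]
    simp [Fin.sum_univ_succ] at this
    ring_nf at this ⊢
    linarith
  rw [e3]
  refine (h7 _ _ _ _ _ _ _).trans ?_
  linarith

end Expansion

end Replicas

/-! ### The free energy of two replicas -/

section FreeEnergy

variable {N : ℕ} {ι : Type*} [Fintype ι] {β h : ℝ} {φ ζ : ι → Fin N → ℝ} {e a : ι → ℝ}

/-- The inequality ABC ≤ (A³ + B³ + C³)/3, used in place of Hölder's inequality to treat each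
quadratic form separately. -/
theorem exp_add_three_le (x y z : ℝ) : Real.exp (x + y + z) ≤
    1 / 3 * (Real.exp (3 * x) + Real.exp (3 * y) + Real.exp (3 * z)) := by
  have h3 : ∀ t : ℝ, Real.exp (3 * t) = Real.exp t ^ 3 := fun t => by
    rw [← Real.exp_nat_mul]; norm_num
  rw [h3, h3, h3, Real.exp_add, Real.exp_add]
  have hx := (Real.exp_pos x).le
  have hy := (Real.exp_pos y).le
  have hz := (Real.exp_pos z).le
  set A := Real.exp x
  set B := Real.exp y
  set C := Real.exp z
  nlinarith [mul_nonneg (add_nonneg (add_nonneg hx hy) hz) (add_nonneg (add_nonneg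
    (sq_nonneg (A - B)) (sq_nonneg (B - C))) (sq_nonneg (C - A)))]

theorem exp_add_le (x y : ℝ) : Real.exp (x + y) ≤
    1 / 2 * (Real.exp (2 * x) + Real.exp (2 * y)) := by
  have h3 : ∀ t : ℝ, Real.exp (2 * t) = Real.exp t ^ 2 := fun t => by
    rw [← Real.exp_nat_mul]; norm_num
  rw [h3, h3, Real.exp_add]
  nlinarith [sq_nonneg (Real.exp x - Real.exp y)]

/-- The squared fluctuations of a replica around the effective field. -/
def fluct (φ ζ : ι → Fin N → ℝ) (m : Fin N → ℝ) (x : Fin N → ℝ) : ℝ :=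
  ∑ s, inner (φ s) (x - m) ^ 2 + ∑ s, inner (ζ s) (x - m) ^ 2

/-- The deviation of the empirical quantities from their limits. -/
def biasTerm (β q : ℝ) (φ ζ : ι → Fin N → ℝ) (a : ι → ℝ) (m : Fin N → ℝ) : ℝ :=
  ∑ s, (inner (φ s) m - a s) ^ 2 + ∑ s, (inner (ζ s) m - β * a s * (1 - q)) ^ 2

theorem biasTerm_nonneg (β q : ℝ) (φ ζ : ι → Fin N → ℝ) (a : ι → ℝ) (m : Fin N → ℝ) :
    0 ≤ biasTerm β q φ ζ a m :=
  add_nonneg (Finset.sum_nonneg fun _ _ => sq_nonneg _) (Finset.sum_nonneg fun _ _ => sq_nonneg _)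

theorem fluct_nonneg (φ ζ : ι → Fin N → ℝ) (m x : Fin N → ℝ) : 0 ≤ fluct φ ζ m x :=
  add_nonneg (Finset.sum_nonneg fun _ _ => sq_nonneg _) (Finset.sum_nonneg fun _ _ => sq_nonneg _)

theorem sum_sq_sub_le (v : ι → Fin N → ℝ) (c : ι → ℝ) (m x : Fin N → ℝ) :
    ∑ s, (inner (v s) x - c s) ^ 2 ≤
      2 * ∑ s, inner (v s) (x - m) ^ 2 + 2 * ∑ s, (inner (v s) m - c s) ^ 2 := by
  rw [Finset.mul_sum, Finset.mul_sum, ← Finset.sum_add_distrib]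
  refine Finset.sum_le_sum fun s _ => ?_
  rw [inner_sub_right]
  nlinarith [sq_nonneg (inner (v s) x - inner (v s) m - (inner (v s) m - c s))]

theorem abs_replicaRem_le_fluct (hN : N ≠ 0) (horth : ∀ s t, s ≠ t → inner (φ s) (φ t) = 0)
    (hone : ∀ s, inner (φ s) (φ s) ≤ 1) (hβ0 : 0 ≤ β) (hβ1 : β ≤ 1) {q : ℝ} (hq0 : 0 ≤ q)
    (hq1 : q ≤ 1) (ha : ∑ s, a s ^ 2 = q) (m : Fin N → ℝ) (σ : Fin N → ℤˣ) :
    |replicaRem β q φ ζ e a (spin σ)| ≤ 4 * β * fluct φ ζ m (spin σ) +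
      (4 * biasTerm β q φ ζ a m + ∑ s, |e s|) := by
  have h1 := abs_replicaRem_le (ζ := ζ) (e := e) hN horth hone hβ0 hβ1 hq0 hq1 ha σ
  have h2 := sum_sq_sub_le φ a m (spin σ)
  have h3 := sum_sq_sub_le ζ (fun s => β * a s * (1 - q)) m (spin σ)
  have h4 := biasTerm_nonneg β q φ ζ a m
  have h5 : β * biasTerm β q φ ζ a m ≤ biasTerm β q φ ζ a m := mul_le_of_le_one_left h4 hβ1
  refine h1.trans ?_
  have h6 := mul_le_mul_of_nonneg_left (add_le_add h2 h3) hβ0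
  rw [biasTerm] at h5 ⊢
  rw [fluct]
  linarith

/-- Sorts the whole exponent into a part in σ, a part in τ, one coupling term, and a
configuration-independent bias. The fluctuations all carry a factor β; this is where high
temperature enters. -/
theorem replica_exponent_le (hN : N ≠ 0) (horth : ∀ s t, s ≠ t → inner (φ s) (φ t) = 0)
    (hone : ∀ s, inner (φ s) (φ s) ≤ 1) (hβ0 : 0 ≤ β) (hβ1 : β ≤ 1) {q : ℝ} (hq0 : 0 ≤ q)
    (hq1 : q ≤ 1) (ha : ∑ s, a s ^ 2 = q) (m : Fin N → ℝ) (σ τ : Fin N → ℤˣ) :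
    replicaRem β q φ ζ e a (spin σ) + replicaRem β q φ ζ e a (spin τ) +
      β ^ 2 / 2 * crossTerm φ (spin σ) (spin τ) ^ 2 ≤
      40 * β * (fluct φ ζ m (spin σ) + inner m (spin σ - m) ^ 2) +
      40 * β * (fluct φ ζ m (spin τ) + inner m (spin τ - m) ^ 2) +
      40 * β * inner (spin τ - m) (spin σ - m) ^ 2 +
      (80 * biasTerm β q φ ζ a m + 2 * ∑ s, |e s| + 4 * (inner m m - q) ^ 2) := by
  have r1 := (le_abs_self _).trans
    (abs_replicaRem_le_fluct (ζ := ζ) (e := e) hN horth hone hβ0 hβ1 hq0 hq1 ha m σ)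
  have r2 := (le_abs_self _).trans
    (abs_replicaRem_le_fluct (ζ := ζ) (e := e) hN horth hone hβ0 hβ1 hq0 hq1 ha m τ)
  have c := crossTerm_sq_le hN horth hone hq1 ha m σ τ
  have s1 := sum_sq_sub_le φ a m (spin σ)
  have s2 := sum_sq_sub_le φ a m (spin τ)
  have z1 : 0 ≤ ∑ s, inner (ζ s) (spin σ - m) ^ 2 := Finset.sum_nonneg fun _ _ => sq_nonneg _
  have z2 : 0 ≤ ∑ s, inner (ζ s) (spin τ - m) ^ 2 := Finset.sum_nonneg fun _ _ => sq_nonneg _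
  have z3 : 0 ≤ ∑ s, (inner (ζ s) m - β * a s * (1 - q)) ^ 2 :=
    Finset.sum_nonneg fun _ _ => sq_nonneg _
  have hb := biasTerm_nonneg β q φ ζ a m
  have hβ2 : β ^ 2 / 2 ≤ β / 2 := by nlinarith
  set T := inner (spin τ - m) (spin σ - m) ^ 2
  set S1 := inner m (spin σ - m) ^ 2
  set S2 := inner m (spin τ - m) ^ 2
  set D := (inner m m - q) ^ 2
  set F1 := fluct φ ζ m (spin σ) with hF1
  set F2 := fluct φ ζ m (spin τ) with hF2
  set B := biasTerm β q φ ζ a m with hB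
  have c2 : crossTerm φ (spin σ) (spin τ) ^ 2 ≤ 7 * T + 7 * S1 + 7 * S2 + 7 * D + 70 * F1 +
      70 * F2 + 140 * B := by
    rw [hF1, hF2, hB, fluct, fluct, biasTerm]
    linarith
  have n : 0 ≤ 7 * T + 7 * S1 + 7 * S2 + 7 * D + 70 * F1 + 70 * F2 + 140 * B :=
    (sq_nonneg _).trans c2
  have c3 : β ^ 2 / 2 * crossTerm φ (spin σ) (spin τ) ^ 2 ≤ β / 2 *
      (7 * T + 7 * S1 + 7 * S2 + 7 * D + 70 * F1 + 70 * F2 + 140 * B) :=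
    (mul_le_mul_of_nonneg_left c2 (by positivity)).trans (mul_le_mul_of_nonneg_right hβ2 n)
  have p1 : 0 ≤ β * T := mul_nonneg hβ0 (sq_nonneg _)
  have p2 : 0 ≤ β * S1 := mul_nonneg hβ0 (sq_nonneg _)
  have p3 : 0 ≤ β * S2 := mul_nonneg hβ0 (sq_nonneg _)
  have p4 : β * D ≤ D := mul_le_of_le_one_left (sq_nonneg _) hβ1
  have p5 : β * B ≤ B := mul_le_of_le_one_left hb hβ1
  have p6 : 0 ≤ β * F1 := mul_nonneg hβ0 (fluct_nonneg _ _ _ _)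
  have p7 : 0 ≤ β * F2 := mul_nonneg hβ0 (fluct_nonneg _ _ _ _)
  have p8 : 0 ≤ D := sq_nonneg _
  nlinarith

theorem inner_effMean_self_le (hN : N ≠ 0) : inner (effMean β h ζ a) (effMean β h ζ a) ≤ 1 := by
  have hN' : (0 : ℝ) < N := by positivity
  rw [inner, div_le_one hN']
  calc _ ≤ ∑ _i : Fin N, (1 : ℝ) := Finset.sum_le_sum fun i _ => by
        rw [← sq]; exact (Real.tanh_sq_lt_one _).le
    _ = N := by simp

theorem inner_spin_sub_effMean_le (hN : N ≠ 0) (τ : Fin N → ℤˣ) :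
    inner (spin τ - effMean β h ζ a) (spin τ - effMean β h ζ a) ≤ 4 := by
  have h1 := inner_effMean_self_le (β := β) (h := h) (ζ := ζ) (a := a) hN
  have h2 := inner_spin_self hN τ
  have h3 := inner_self_nonneg (spin τ + effMean β h ζ a)
  rw [inner_add_left, inner_add_right, inner_add_right] at h3
  rw [inner_sub_left, inner_sub_right, inner_sub_right]
  linarith

/-- The free energy of two replicas, up to the deviation of the empirical quantities. -/
theorem abs_log_replicaSum_sub_le (hN : N ≠ 0) (horth : ∀ s t, s ≠ t → inner (φ s) (φ t) = 0)
    (hone : ∀ s, inner (φ s) (φ s) ≤ 1)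
    (hζ : ∀ z : ι → ℝ, inner (∑ s, z s • ζ s) (∑ s, z s • ζ s) ≤ 2 * ∑ s, z s ^ 2)
    (hβ0 : 0 ≤ β) (hβ1 : β ≤ 1 / 2000) {q : ℝ} (hq0 : 0 ≤ q)
    (hq1 : q ≤ 1) (ha : ∑ s, a s ^ 2 = q) :
    |1 / (N : ℝ) * Real.log (replicaSum β h φ ζ e) -
      (2 * ((∑ i, Real.log (Real.cosh (effField β h ζ a i))) / N) + β ^ 2 * (1 - q) ^ 2 / 2)| ≤
      80 * biasTerm β q φ ζ a (effMean β h ζ a) + 2 * ∑ s, |e s| +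
        4 * (inner (effMean β h ζ a) (effMean β h ζ a) - q) ^ 2 +
        4 * expSqMoment ^ (2 * (Fintype.card ι + 1)) / N := by
  have hN' : (0 : ℝ) < N := by positivity
  have hβ1' : β ≤ 1 := hβ1.trans (by norm_num)
  set b := effField β h ζ a with hb
  set m := effMean β h ζ a with hm
  have hmb : m = fun i => Real.tanh (b i) := rfl
  set M := expSqMoment with hM
  have hM1 : 1 ≤ M := one_le_expSqMoment
  set k := Fintype.card ι
  set c := 80 * biasTerm β q φ ζ a m + 2 * ∑ s, |e s| + 4 * (inner m m - q) ^ 2 with hc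
  set W := gibbs b fun σ => gibbs b fun τ =>
    Real.exp (N * (replicaRem β q φ ζ e a (spin σ) + replicaRem β q φ ζ e a (spin τ) +
      β ^ 2 / 2 * crossTerm φ (spin σ) (spin τ) ^ 2)) with hW
  have hMk : M ^ k ≤ M ^ (k + 1) := pow_le_pow_right₀ hM1 (Nat.le_succ k)
  have hMk1 : M ≤ M ^ (k + 1) := by simpa using pow_le_pow_right₀ hM1 (Nat.succ_le_succ k.zero_le)
  have hMk0 : 0 ≤ M ^ k := by positivity
  -- the three quadratic forms
  have hφ : ∀ l : ℝ, 0 ≤ l → l ≤ 1 / 8 → gibbs b (fun σ => Real.exp (N * (l *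
      ∑ s, inner (φ s) (spin σ - m) ^ 2))) ≤ M ^ k := fun l hl0 hl1 =>
    gibbs_exp_sq_le hN b φ hl0 (B := 1) (by linarith) fun z => by
      rw [one_mul]; exact inner_sum_smul_self_le horth hone z
  have hζ' : ∀ l : ℝ, 0 ≤ l → l ≤ 1 / 8 → gibbs b (fun σ => Real.exp (N * (l *
      ∑ s, inner (ζ s) (spin σ - m) ^ 2))) ≤ M ^ k := fun l hl0 hl1 =>
    gibbs_exp_sq_le hN b ζ hl0 (B := 2) (by linarith) hζ
  have hmm : ∀ l : ℝ, 0 ≤ l → l ≤ 1 / 8 → gibbs b (fun σ => Real.exp (N * (l *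
      inner m (spin σ - m) ^ 2))) ≤ M := fun l hl0 hl1 =>
    gibbs_exp_sq_le_one hN b m hl0 (B := 1) (by linarith) (inner_effMean_self_le hN)
  have hup1 : gibbs b (fun σ => Real.exp (N * (80 * β * (fluct φ ζ m (spin σ) +
      inner m (spin σ - m) ^ 2)))) ≤ M ^ (k + 1) := by
    have h1 : ∀ σ : Fin N → ℤˣ, Real.exp (N * (80 * β * (fluct φ ζ m (spin σ) +
        inner m (spin σ - m) ^ 2))) ≤
        1 / 3 * (Real.exp (N * (240 * β * ∑ s, inner (φ s) (spin σ - m) ^ 2)) +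
          Real.exp (N * (240 * β * ∑ s, inner (ζ s) (spin σ - m) ^ 2)) +
          Real.exp (N * (240 * β * inner m (spin σ - m) ^ 2))) := fun σ => by
      have := exp_add_three_le (N * (80 * β * ∑ s, inner (φ s) (spin σ - m) ^ 2))
        (N * (80 * β * ∑ s, inner (ζ s) (spin σ - m) ^ 2)) (N * (80 * β * inner m (spin σ - m) ^ 2))
      rw [fluct]
      convert! this using 2
      · ring_nf
      · congr 1 <;> [congr 1; skip] <;> ring_nf
    refine (gibbs_mono h1).trans ?_
    rw [gibbs_const_mul, gibbs_add, gibbs_add]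
    have l0 : 0 ≤ 240 * β := by positivity
    -- This determines 1/2000: the splitting into three triples 80β, and the bound 2 on the Gram
    -- form of the ζ's requires the coefficient to be at most 1/8.
    have l1 : 240 * β ≤ 1 / 8 := by linarith
    linarith [hφ _ l0 l1, hζ' _ l0 l1, hmm _ l0 l1]
  have hup2 : ∀ τ : Fin N → ℤˣ, gibbs b (fun σ => Real.exp (N * (80 * β *
      inner (spin τ - m) (spin σ - m) ^ 2))) ≤ M := fun τ =>
    gibbs_exp_sq_le_one hN b (spin τ - m) (by positivity) (B := 4) (by linarith)
      (inner_spin_sub_effMean_le hN τ)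
  -- The inequality AB ≤ (A² + B²)/2 separates the decoupled part, whose average factorizes over the
  -- replicas, from the coupling. For fixed σ the latter is the square of a single linear form in τ.
  have hWup : W ≤ Real.exp (N * c) * M ^ (2 * (k + 1)) := by
    have h1 : ∀ σ τ : Fin N → ℤˣ, Real.exp (N * (replicaRem β q φ ζ e a (spin σ) +
        replicaRem β q φ ζ e a (spin τ) + β ^ 2 / 2 * crossTerm φ (spin σ) (spin τ) ^ 2)) ≤
        Real.exp (N * c) * (1 / 2 * (
          Real.exp (N * (80 * β * (fluct φ ζ m (spin σ) + inner m (spin σ - m) ^ 2))) *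
          Real.exp (N * (80 * β * (fluct φ ζ m (spin τ) + inner m (spin τ - m) ^ 2))) +
          Real.exp (N * (80 * β * inner (spin σ - m) (spin τ - m) ^ 2)))) := fun σ τ => by
      have h2 := replica_exponent_le (e := e) (ζ := ζ) hN horth hone hβ0 hβ1' hq0 hq1 ha m σ τ
      have h3 := exp_add_le
        (N * (40 * β * (fluct φ ζ m (spin σ) + inner m (spin σ - m) ^ 2)) +
          N * (40 * β * (fluct φ ζ m (spin τ) + inner m (spin τ - m) ^ 2)))
        (N * (40 * β * inner (spin τ - m) (spin σ - m) ^ 2))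
      have h4 := mul_le_mul_of_nonneg_left h3 (Real.exp_pos (N * c)).le
      refine (Real.exp_le_exp.2 (mul_le_mul_of_nonneg_left h2 hN'.le)).trans (le_trans (le_of_eq ?_)
        (h4.trans (le_of_eq ?_)))
      · rw [← Real.exp_add]
        congr 1
        ring
      · rw [← Real.exp_add, inner_comm (spin τ - m)]
        congr 3
        · congr 1
          ring_nf
        · congr 1
          ring_nf
    have h5 : W ≤ gibbs b fun σ => gibbs b fun τ => Real.exp (N * c) * (1 / 2 * (
          Real.exp (N * (80 * β * (fluct φ ζ m (spin σ) + inner m (spin σ - m) ^ 2))) *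
          Real.exp (N * (80 * β * (fluct φ ζ m (spin τ) + inner m (spin τ - m) ^ 2))) +
          Real.exp (N * (80 * β * inner (spin σ - m) (spin τ - m) ^ 2)))) :=
      gibbs_mono fun σ => gibbs_mono fun τ => h1 σ τ
    refine h5.trans ?_
    simp only [gibbs_const_mul, gibbs_add]
    refine mul_le_mul_of_nonneg_left ?_ (Real.exp_pos _).le
    have h6 : gibbs b (fun σ => Real.exp (N * (80 * β * (fluct φ ζ m (spin σ) +
        inner m (spin σ - m) ^ 2))) * gibbs b fun τ => Real.exp (N * (80 * β *
        (fluct φ ζ m (spin τ) + inner m (spin τ - m) ^ 2)))) ≤ M ^ (k + 1) * M ^ (k + 1) := by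
      simp only [mul_comm (Real.exp _) (gibbs b _)]
      rw [gibbs_const_mul]
      exact mul_le_mul hup1 hup1 (gibbs_nonneg fun _ => (Real.exp_pos _).le) (by positivity)
    have h7 : gibbs b (fun σ => gibbs b fun τ => Real.exp (N * (80 * β *
        inner (spin σ - m) (spin τ - m) ^ 2))) ≤ M := by
      rw [← gibbs_const b M]
      exact gibbs_mono fun σ => hup2 σ
    have h8 : M ≤ M ^ (2 * (k + 1)) := by
      simpa using pow_le_pow_right₀ hM1 (show 1 ≤ 2 * (k + 1) by omega)
    have h9 : M ^ (k + 1) * M ^ (k + 1) = M ^ (2 * (k + 1)) := by rw [← pow_add]; congr 1; ring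
    linarith
  -- The coupling is nonnegative and can be dropped, leaving a square of one-replica averages.
  -- Jensen's inequality reduces each to the mean of the remainder, and y ≤ e^y bounds the mean
  -- fluctuations by the exponential moments already at hand.
  have hWlo : Real.exp (-(N * c) - 4 * M ^ k) ≤ W := by
    have h1 : (gibbs b fun σ => Real.exp (N * replicaRem β q φ ζ e a (spin σ))) *
        (gibbs b fun σ => Real.exp (N * replicaRem β q φ ζ e a (spin σ))) ≤ W := by
      rw [← gibbs_const_mul]
      refine gibbs_mono fun σ => ?_
      rw [mul_comm, ← gibbs_const_mul]
      refine gibbs_mono fun τ => ?_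
      rw [← Real.exp_add]
      refine Real.exp_le_exp.2 ?_
      rw [← mul_add]
      refine mul_le_mul_of_nonneg_left ?_ hN'.le
      have : 0 ≤ β ^ 2 / 2 * crossTerm φ (spin σ) (spin τ) ^ 2 := by positivity
      linarith
    have h2 : ∀ σ : Fin N → ℤˣ, -Real.exp (N * (4 * β * ∑ s, inner (φ s) (spin σ - m) ^ 2)) +
        (-Real.exp (N * (4 * β * ∑ s, inner (ζ s) (spin σ - m) ^ 2)) + -(N * (c / 2))) ≤
        N * replicaRem β q φ ζ e a (spin σ) := fun σ => by
      have h3 := (abs_le.1 (abs_replicaRem_le_fluct (ζ := ζ) (e := e) hN horth hone hβ0 hβ1' hq0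
        hq1 ha m σ)).1
      have e1 := Real.add_one_le_exp (N * (4 * β * ∑ s, inner (φ s) (spin σ - m) ^ 2))
      have e2 := Real.add_one_le_exp (N * (4 * β * ∑ s, inner (ζ s) (spin σ - m) ^ 2))
      have h4 := mul_le_mul_of_nonneg_left h3 hN'.le
      have h5 : 4 * biasTerm β q φ ζ a m + ∑ s, |e s| ≤ c / 2 := by
        rw [hc]
        have := biasTerm_nonneg β q φ ζ a m
        have := sq_nonneg (inner m m - q)
        linarith
      have h6 := mul_le_mul_of_nonneg_left h5 hN'.le
      rw [fluct] at h4
      linarith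
    have h7 : -(N * c) / 2 - 2 * M ^ k ≤ gibbs b fun σ => N * replicaRem β q φ ζ e a (spin σ) := by
      refine le_trans ?_ (gibbs_mono h2)
      rw [gibbs_add, gibbs_add, gibbs_const]
      have e1 := gibbs_const_mul b (-1) fun σ =>
        Real.exp (N * (4 * β * ∑ s, inner (φ s) (spin σ - m) ^ 2))
      have e2 := gibbs_const_mul b (-1) fun σ =>
        Real.exp (N * (4 * β * ∑ s, inner (ζ s) (spin σ - m) ^ 2))
      simp only [neg_one_mul] at e1 e2
      rw [e1, e2]
      linarith [hφ (4 * β) (by positivity) (by linarith), hζ' (4 * β) (by positivity) (by linarith)]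
    have h8 := (Real.exp_le_exp.2 h7).trans (exp_gibbs_le b _)
    refine le_trans (le_of_eq ?_) ((mul_le_mul h8 h8 (Real.exp_pos _).le
      ((Real.exp_pos _).le.trans h8)).trans h1)
    rw [← Real.exp_add]
    congr 1
    ring
  have hWpos : 0 < W := (Real.exp_pos _).trans_le hWlo
  have hlogW : |Real.log W| ≤ N * c + 4 * M ^ (2 * (k + 1)) := by
    have u1 := Real.log_le_log hWpos hWup
    rw [Real.log_mul (Real.exp_pos _).ne' (by positivity), Real.log_exp] at u1
    have u2 := Real.log_le_sub_one_of_pos (x := M ^ (2 * (k + 1))) (by positivity)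
    have u3 := Real.log_le_log (Real.exp_pos _) hWlo
    rw [Real.log_exp] at u3
    have u4 : M ^ k ≤ M ^ (2 * (k + 1)) := pow_le_pow_right₀ hM1 (by omega)
    rw [abs_le]
    constructor <;> linarith
  have hlog : 1 / (N : ℝ) * Real.log (replicaSum β h φ ζ e) -
      (2 * ((∑ i, Real.log (Real.cosh (b i))) / N) + β ^ 2 * (1 - q) ^ 2 / 2) =
      Real.log W / N := by
    have hP : 0 < ∏ i, Real.cosh (b i) := Finset.prod_pos fun i _ => Real.cosh_pos _
    rw [replicaSum_eq hN ha, ← hW, Real.log_mul (by positivity) hWpos.ne',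
      Real.log_mul (by positivity) (Real.exp_pos _).ne', Real.log_exp, Real.log_pow,
      Real.log_prod fun i _ => (Real.cosh_pos _).ne']
    push_cast
    field_simp
    ring
  rw [hlog, abs_div, abs_of_pos hN', div_le_iff₀ hN']
  refine hlogW.trans (le_of_eq ?_)
  field_simp

end FreeEnergy

/-! ### The conditional second moment -/

section CondExp

variable {N : ℕ}

/-- The matrix `a bᵀ`, without normalization. -/
def outer (a b : Fin N → ℝ) : Matrix (Fin N) (Fin N) ℝ := Matrix.of fun i j => a i * b j

theorem mul_inner (hN : N ≠ 0) (a b : Fin N → ℝ) : N * inner a b = ∑ i, a i * b i := by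
  have : (N : ℝ) ≠ 0 := by positivity
  rw [inner, mul_div_cancel₀ _ this]

theorem pairing_outer (hN : N ≠ 0) (a b : Fin N → ℝ) (A : Matrix (Fin N) (Fin N) ℝ) :
    pairing (outer a b) A = N * inner a (A *ᵥ b) := by
  rw [mul_inner hN]
  simp only [pairing, outer, Matrix.of_apply, Matrix.mulVec, dotProduct, Finset.mul_sum]
  exact Finset.sum_congr rfl fun i _ => Finset.sum_congr rfl fun j _ => by ring

theorem outer_mulVec (hN : N ≠ 0) (a b c : Fin N → ℝ) :
    outer a b *ᵥ c = (N * inner b c) • a := by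
  rw [mul_inner hN]
  ext i
  simp only [Matrix.mulVec, dotProduct, outer, Matrix.of_apply, Pi.smul_apply, smul_eq_mul,
    Finset.sum_mul]
  exact Finset.sum_congr rfl fun j _ => by ring

theorem hamiltonian_eq (hN : N ≠ 0) (β h : ℝ) (g : Matrix (Fin N) (Fin N) ℝ) (σ : Fin N → ℤˣ) :
    hamiltonian β h g σ = N * (β / √2 * inner (spin σ) (g *ᵥ spin σ) +
      h * inner (fun _ => 1) (spin σ)) := by
  have e1 : ∑ i, ∑ j, g i j * ((σ i : ℤ) : ℝ) * ((σ j : ℤ) : ℝ) =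
      N * inner (spin σ) (g *ᵥ spin σ) := by
    rw [mul_inner hN]
    simp only [Matrix.mulVec, dotProduct, Finset.mul_sum, spin]
    exact Finset.sum_congr rfl fun i _ => Finset.sum_congr rfl fun j _ => by ring
  have e2 : ∑ i, ((σ i : ℤ) : ℝ) = N * inner (fun _ => 1) (spin σ) := by
    rw [mul_inner hN]
    simp [spin]
  rw [hamiltonian, e1, e2]
  ring

theorem partitionFn_sq (β h : ℝ) (g : Matrix (Fin N) (Fin N) ℝ) :
    partitionFn β h g ^ 2 = ((2 : ℝ) ^ N)⁻¹ ^ 2 * ∑ σ : Fin N → ℤˣ, ∑ τ : Fin N → ℤˣ,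
      Real.exp (hamiltonian β h g σ + hamiltonian β h g τ) := by
  simp only [partitionFn, mul_pow, sq (∑ σ : Fin N → ℤˣ, _), Finset.sum_mul_sum, Real.exp_add]

/-! ### Integrating out the resampled block. -/

section Resampled

variable (β h : ℝ) (k : ℕ) (g : Matrix (Fin N) (Fin N) ℝ)

/-- The diagonal terms `⟨φ_k, ξ_k⟩`. -/
def diagTerm : ℝ := inner (phi β h g k) (xi β h g k)

/-- The subtracted rank-one matrices telescope; in a quadratic form ξ and η enter only through their
sum, which is √2 ζ. -/
theorem inner_sub_gIter_mulVec (x : Fin N → ℝ) :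
    inner x ((g - gIter β h g k) *ᵥ x) = ∑ s : Fin k,
      (√2 * (inner (phi β h g s) x * inner (zeta β h g s) x) -
        diagTerm β h s g * inner (phi β h g s) x ^ 2) := by
  induction k with
  | zero => simp [gIter_zero]
  | succ k ih =>
    have h2 : √2 * (√2)⁻¹ = 1 := mul_inv_cancel₀ (by positivity)
    rw [Fin.sum_univ_castSucc, gIter_succ, sub_sub_eq_add_sub, add_sub_right_comm,
      Matrix.add_mulVec, inner_add_right, ih]
    congr 1
    simp only [Fin.val_last, diagTerm, zeta, Matrix.add_mulVec, Matrix.sub_mulVec,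
      Matrix.smul_mulVec, tensor_mulVec, inner_sub_right, inner_add_right, inner_smul_right,
      inner_smul_left, inner_add_left]
    rw [inner_comm x (phi β h g k), inner_comm x (xi β h g k)]
    linear_combination (-(inner (phi β h g k) x * (inner (xi β h g k) x +
      inner (eta β h g k) x))) * h2

theorem inner_proj_mulVec (x y : Fin N → ℝ) :
    inner (proj β h g k *ᵥ x) (proj β h g k *ᵥ y) =
      crossTerm (fun s : Fin k => phi β h g s) x y := by
  rw [inner_mulVec, transpose_proj, Matrix.mulVec_mulVec, proj_mul_self, proj_mulVec,
    inner_sub_left, inner_sum_left, crossTerm, Finset.sum_range]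
  simp only [inner_smul_left]

theorem hamiltonian_resample (hN : N ≠ 0) (x : Matrix (Fin N) (Fin N) ℝ) (σ : Fin N → ℤˣ) :
    hamiltonian β h (resample β h k g x) σ =
      N * (β * ∑ s : Fin k, inner (phi β h g s) (spin σ) * inner (zeta β h g s) (spin σ) -
        β / √2 * ∑ s : Fin k, diagTerm β h s g * inner (phi β h g s) (spin σ) ^ 2 +
        h * inner (fun _ => 1) (spin σ)) +
      β / √2 * pairing (outer (proj β h g k *ᵥ spin σ) (proj β h g k *ᵥ spin σ)) x := by
  have h2 : β / √2 * √2 = β := div_mul_cancel₀ _ (by positivity)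
  have e1 : inner (spin σ) (resample β h k g x *ᵥ spin σ) =
      (√2 * ∑ s : Fin k, inner (phi β h g s) (spin σ) * inner (zeta β h g s) (spin σ) -
        ∑ s : Fin k, diagTerm β h s g * inner (phi β h g s) (spin σ) ^ 2) +
      inner (proj β h g k *ᵥ spin σ) (x *ᵥ (proj β h g k *ᵥ spin σ)) := by
    rw [resample, ← gIter_eq_proj, Matrix.add_mulVec, inner_add_right, inner_sub_gIter_mulVec,
      Finset.sum_sub_distrib, ← Finset.mul_sum, ← Matrix.mulVec_mulVec, ← Matrix.mulVec_mulVec,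
      inner_mulVec (proj β h g k), transpose_proj]
  rw [hamiltonian_eq hN, e1, pairing_outer hN]
  linear_combination (N * ∑ s : Fin k, inner (phi β h g s) (spin σ) *
    inner (zeta β h g s) (spin σ)) * h2

theorem pairing_add_left (a b c : Matrix (Fin N) (Fin N) ℝ) :
    pairing (a + b) c = pairing a c + pairing b c := by
  rw [pairing_comm, pairing_add, pairing_comm c, pairing_comm c]

theorem pairing_smul_left (r : ℝ) (a c : Matrix (Fin N) (Fin N) ℝ) :
    pairing (r • a) c = r * pairing a c := by
  simp [pairing, Finset.mul_sum, mul_assoc]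

theorem pairing_smul_right (r : ℝ) (a c : Matrix (Fin N) (Fin N) ℝ) :
    pairing a (r • c) = r * pairing a c := by
  rw [pairing_comm, pairing_smul_left, pairing_comm]

/-- In the fresh matrix the exponent is linear, with coefficient matrix (β/√2)(a aᵀ + b bᵀ) for the
projected spins a, b. Its squared Frobenius norm produces ⟨a,a⟩² and ⟨b,b⟩², which are the quartic
terms of the one-replica exponents, and 2⟨a,b⟩², the coupling. -/
theorem exp_hamiltonian_resample (hN : N ≠ 0) (σ τ : Fin N → ℤˣ) :
    (Integrable (fun x => Real.exp (hamiltonian β h (resample β h k g x) σ +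
      hamiltonian β h (resample β h k g x) τ)) (matrixLaw N)) ∧
    ∫ x, Real.exp (hamiltonian β h (resample β h k g x) σ +
      hamiltonian β h (resample β h k g x) τ) ∂(matrixLaw N) =
    Real.exp (N * (replicaExp β h (fun s : Fin k => phi β h g s) (fun s => zeta β h g s)
        (fun s => diagTerm β h s g) (spin σ) +
      replicaExp β h (fun s : Fin k => phi β h g s) (fun s => zeta β h g s)
        (fun s => diagTerm β h s g) (spin τ) +
      β ^ 2 / 2 * crossTerm (fun s : Fin k => phi β h g s) (spin σ) (spin τ) ^ 2)) := by
  set a := proj β h g k *ᵥ spin σ with ha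
  set b := proj β h g k *ᵥ spin τ with hb
  set c := (β / √2) • (outer a a + outer b b) with hc
  have hN' : (N : ℝ) ≠ 0 := by positivity
  set D : (Fin N → ℤˣ) → ℝ := fun σ =>
    N * (β * ∑ s : Fin k, inner (phi β h g s) (spin σ) * inner (zeta β h g s) (spin σ) -
        β / √2 * ∑ s : Fin k, diagTerm β h s g * inner (phi β h g s) (spin σ) ^ 2 +
        h * inner (fun _ => 1) (spin σ)) with hD
  have e1 : ∀ x, Real.exp (hamiltonian β h (resample β h k g x) σ +
      hamiltonian β h (resample β h k g x) τ) = Real.exp (D σ + D τ) * Real.exp (pairing c x) := by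
    intro x
    rw [hamiltonian_resample β h k g hN, hamiltonian_resample β h k g hN, ← Real.exp_add, hc,
      pairing_smul_left, pairing_add_left]
    congr 1
    simp only [hD]
    ring
  have haa : inner a a = 1 - ∑ s : Fin k, inner (phi β h g s) (spin σ) ^ 2 := by
    rw [ha, inner_proj_mulVec, crossTerm, inner_spin_self hN]
    simp only [sq]
  have hbb : inner b b = 1 - ∑ s : Fin k, inner (phi β h g s) (spin τ) ^ 2 := by
    rw [hb, inner_proj_mulVec, crossTerm, inner_spin_self hN]
    simp only [sq]
  have hab : inner a b = crossTerm (fun s : Fin k => phi β h g s) (spin σ) (spin τ) :=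
    inner_proj_mulVec β h k g _ _
  have e2 : pairing c c = N ^ 2 * (β ^ 2 / 2 * (inner a a ^ 2 + inner b b ^ 2 +
      2 * inner a b ^ 2)) := by
    have h2 : (β / √2) * (β / √2) = β ^ 2 / 2 := by
      rw [div_mul_div_comm, Real.mul_self_sqrt (by norm_num)]; ring
    rw [hc, pairing_smul_left, pairing_smul_right, pairing_add_left, pairing_add, pairing_add]
    simp only [pairing_outer hN, outer_mulVec hN, inner_smul_right]
    rw [inner_comm b a, ← mul_assoc, h2]
    ring
  simp_rw [e1]
  refine ⟨(integrable_exp_pairing c).const_mul _, ?_⟩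
  rw [integral_const_mul, integral_exp_pairing, ← Real.exp_add, e2, haa, hbb, hab]
  congr 1
  simp only [hD, replicaExp]
  field_simp
  ring

/-- The expectation of the squared partition function over the part of the disorder that is
independent of the first `k` steps. -/
theorem integral_partitionFn_resample (hN : N ≠ 0) :
    (Integrable (fun x => partitionFn β h (resample β h k g x) ^ 2) (matrixLaw N)) ∧
    ∫ x, partitionFn β h (resample β h k g x) ^ 2 ∂(matrixLaw N) =
      replicaSum β h (fun s : Fin k => phi β h g s) (fun s => zeta β h g s)
        (fun s => diagTerm β h s g) := by
  simp_rw [partitionFn_sq]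
  have key := fun σ τ => exp_hamiltonian_resample β h k g hN σ τ
  refine ⟨(integrable_finsetSum _ fun σ _ => integrable_finsetSum _ fun τ _ =>
    (key σ τ).1).const_mul _, ?_⟩
  rw [integral_const_mul, replicaSum, integral_finsetSum _ fun σ _ =>
    integrable_finsetSum _ fun τ _ => (key σ τ).1]
  congr 1
  refine Finset.sum_congr rfl fun σ _ => ?_
  rw [integral_finsetSum _ fun τ _ => (key σ τ).1]
  exact Finset.sum_congr rfl fun τ _ => (key σ τ).2

end Resampled

/-! ### Identification of the conditional expectation. -/

theorem measurable_hamiltonian (β h : ℝ) (σ : Fin N → ℤˣ) :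
    Measurable fun g : Matrix (Fin N) (Fin N) ℝ => hamiltonian β h g σ := by
  unfold hamiltonian
  refine (Measurable.const_mul (Finset.measurable_sum _ fun i _ => Finset.measurable_sum _
    fun j _ => ?_) _).add_const _
  exact ((measurable_entry i j).mul_const _).mul_const _

theorem measurable_partitionFn (β h : ℝ) :
    Measurable fun g : Matrix (Fin N) (Fin N) ℝ => partitionFn β h g :=
  (Finset.measurable_sum _ fun σ _ => (measurable_hamiltonian β h σ).exp).const_mul _

theorem measurable_replicaSum_of (β h : ℝ) {k : ℕ} {α : Type*} [MeasurableSpace α]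
    {φ ζ : α → Fin k → Fin N → ℝ} {e : α → Fin k → ℝ} (hφ : ∀ s, Measurable fun a => φ a s)
    (hζ : ∀ s, Measurable fun a => ζ a s) (he : ∀ s, Measurable fun a => e a s) :
    Measurable fun a => replicaSum β h (φ a) (ζ a) (e a) := by
  have hE : ∀ x : Fin N → ℝ, Measurable fun a => replicaExp β h (φ a) (ζ a) (e a) x := fun x => by
    unfold replicaExp
    have h1 : ∀ s, Measurable fun a => inner (φ a s) x := fun s =>
      measurable_inner (hφ s) measurable_const
    have h2 : ∀ s, Measurable fun a => inner (ζ a s) x := fun s =>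
      measurable_inner (hζ s) measurable_const
    refine ((((Finset.measurable_sum _ fun s _ => (h1 s).mul (h2 s)).const_mul _).sub
      ((Finset.measurable_sum _ fun s _ => (he s).mul ((h1 s).pow_const 2)).const_mul _)).add
      measurable_const).add ?_
    exact (((Finset.measurable_sum _ fun s _ => (h1 s).pow_const 2).const_sub 1).pow_const
      2).const_mul _
  unfold replicaSum
  refine (Finset.measurable_sum _ fun σ _ => Finset.measurable_sum _ fun τ _ =>
    Measurable.exp (((hE _).add (hE _)).add ?_ |>.const_mul _)).const_mul _
  unfold crossTerm
  refine ((measurable_const.sub (Finset.measurable_sum _ fun s _ => ?_)).pow_const 2).const_mul _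
  exact (measurable_inner (hφ s) measurable_const).mul (measurable_inner (hφ s) measurable_const)

/-- The conditional second moment as a function of the disorder. -/
def condMoment (β h : ℝ) (k : ℕ) (g : Matrix (Fin N) (Fin N) ℝ) : ℝ :=
  replicaSum β h (fun s : Fin k => phi β h g s) (fun s => zeta β h g s)
    (fun s => diagTerm β h s g)

theorem measurable_condMoment_of (β h : ℝ) (k : ℕ) {α : Type*} [MeasurableSpace α]
    {G : α → Matrix (Fin N) (Fin N) ℝ} (hxi : ∀ s < k, Measurable fun a => xi β h (G a) s)
    (heta : ∀ s < k, Measurable fun a => eta β h (G a) s) :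
    Measurable fun a => condMoment β h k (G a) := by
  have hphi := measurable_phi_of β h hxi heta
  refine measurable_replicaSum_of β h (fun s => hphi s s.2.le)
    (fun s => ((hxi s s.2).add (heta s s.2)).const_smul (√2)⁻¹)
    fun s => measurable_inner (hphi s s.2.le) (hxi s s.2)

theorem condMoment_pos (β h : ℝ) (k : ℕ) (g : Matrix (Fin N) (Fin N) ℝ) :
    0 < condMoment β h k g := replicaSum_pos _ _ _ _ _

/-- The first `k` pairs `(ξ_s, η_s)`. -/
def stepData (β h : ℝ) (k : ℕ) (g : Matrix (Fin N) (Fin N) ℝ) :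
    Fin k → (Fin N → ℝ) × (Fin N → ℝ) := fun s => (xi β h g s, eta β h g s)

theorem measurable_stepData (β h : ℝ) (k : ℕ) :
    Measurable fun g : Matrix (Fin N) (Fin N) ℝ => stepData β h k g :=
  measurable_pi_lambda _ fun s => (measurable_xi β h s).prodMk (measurable_eta β h s)

theorem stepData_resample (β h : ℝ) (k : ℕ) (g x : Matrix (Fin N) (Fin N) ℝ) :
    stepData β h k (resample β h k g x) = stepData β h k g :=
  funext fun s => by rw [stepData, stepData, xi_resample β h g x s.2, eta_resample β h g x s.2]

/-- Resampling does not leave an event depending on the first k steps, so on it the squared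
partition function may be averaged over the fresh block. With nonnegative integrals no prior
integrability of `condMoment` is needed; it follows by taking the whole space. -/
theorem lintegral_partitionFn_sq_on (β h : ℝ) (hN : N ≠ 0) (k : ℕ)
    {B : Set (Fin k → (Fin N → ℝ) × (Fin N → ℝ))} (hB : MeasurableSet B) :
    ∫⁻ g in stepData β h k ⁻¹' B, ENNReal.ofReal (partitionFn β h g ^ 2) ∂(matrixLaw N) =
      ∫⁻ g in stepData β h k ⁻¹' B, ENNReal.ofReal (condMoment β h k g) ∂(matrixLaw N) := by
  have hA := measurable_stepData (N := N) β h k hB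
  have hZ : Measurable fun g : Matrix (Fin N) (Fin N) ℝ =>
      ENNReal.ofReal (partitionFn β h g ^ 2) :=
    ((measurable_partitionFn β h).pow_const 2).ennreal_ofReal
  rw [← lintegral_indicator hA, ← lintegral_indicator hA,
    lintegral_resample β h k (hZ.indicator hA)]
  refine lintegral_congr fun g => ?_
  obtain ⟨h1, h2⟩ := integral_partitionFn_resample β h k g hN
  by_cases hg : g ∈ stepData β h k ⁻¹' B
  · have hr : ∀ x, resample β h k g x ∈ stepData β h k ⁻¹' B := fun x => by
      rw [Set.mem_preimage, stepData_resample]; exact hg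
    simp only [Set.indicator_of_mem (hr _), Set.indicator_of_mem hg]
    rw [← ofReal_integral_eq_lintegral_ofReal h1 (ae_of_all _ fun x => sq_nonneg _), h2]
    rfl
  · have hr : ∀ x, resample β h k g x ∉ stepData β h k ⁻¹' B := fun x => by
      rw [Set.mem_preimage, stepData_resample]; exact hg
    simp only [Set.indicator_of_notMem (hr _), Set.indicator_of_notMem hg, lintegral_zero]

theorem integrable_partitionFn_sq (β h : ℝ) (hN : N ≠ 0) :
    Integrable (fun g => partitionFn β h g ^ 2) (matrixLaw N) := by
  -- At level 0 the projection is the identity, so resampling replaces the whole matrix.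
  have h1 := (integral_partitionFn_resample β h 0 (0 : Matrix (Fin N) (Fin N) ℝ) hN).1
  simpa [resample, proj] using h1

/-- The conditional second moment given the first `k` steps. -/
theorem condExp_partitionFn_sq {Ω : Type*} [m0 : MeasurableSpace Ω] {P : Measure Ω}
    [IsProbabilityMeasure P] {g : Ω → Matrix (Fin N) (Fin N) ℝ} (hg : IsDisorder P g)
    (β h : ℝ) (hN : N ≠ 0) (k : ℕ) :
    P[fun ω => partitionFn β h (g ω) ^ 2 | sigmaField β h g k] =ᵐ[P]
      fun ω => condMoment β h k (g ω) := by
  have hgm := hg.measurable_fun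
  have hxi : ∀ s < k, Measurable[sigmaField β h g k] fun ω => xi β h (g ω) s := fun s hs =>
    (comap_measurable _).mono ((le_sup_left.trans (le_iSup (fun s : Fin k =>
      (MeasurableSpace.comap (fun ω => xi β h (g ω) s) inferInstance ⊔
    MeasurableSpace.comap (fun ω => eta β h (g ω) s) inferInstance)) ⟨s, hs⟩))) le_rfl
  have heta : ∀ s < k, Measurable[sigmaField β h g k] fun ω => eta β h (g ω) s := fun s hs =>
    (comap_measurable _).mono ((le_sup_right.trans (le_iSup (fun s : Fin k =>
      (MeasurableSpace.comap (fun ω => xi β h (g ω) s) inferInstance ⊔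
    MeasurableSpace.comap (fun ω => eta β h (g ω) s) inferInstance)) ⟨s, hs⟩))) le_rfl
  -- Every event of the σ-field is thus a preimage under `stepData`, the form in which the integral
  -- identity was proved.
  have hle : sigmaField β h g k ≤ MeasurableSpace.comap (fun ω => stepData β h k (g ω))
      inferInstance := by
    refine iSup_le fun s => sup_le ?_ ?_
    · exact measurable_iff_comap_le.1 (measurable_fst.comp ((measurable_pi_apply s).comp
        (comap_measurable fun ω => stepData β h k (g ω))))
    · exact measurable_iff_comap_le.1 (measurable_snd.comp ((measurable_pi_apply s).comp
        (comap_measurable fun ω => stepData β h k (g ω))))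
  have hle0 : sigmaField β h g k ≤ m0 :=
    hle.trans (((measurable_stepData β h k).comp hgm).comap_le)
  have hset : ∀ s, MeasurableSet[sigmaField β h g k] s →
      ∃ B, MeasurableSet B ∧ g ⁻¹' (stepData β h k ⁻¹' B) = s := fun s hs => by
    obtain ⟨B, hB, rfl⟩ := hle s hs
    exact ⟨B, hB, rfl⟩
  have hV : Measurable fun g : Matrix (Fin N) (Fin N) ℝ => condMoment β h k g :=
    measurable_condMoment_of β h k (G := id) (fun s _ => measurable_xi β h s)
      fun s _ => measurable_eta β h s
  have hZ : Measurable fun g : Matrix (Fin N) (Fin N) ℝ => partitionFn β h g ^ 2 :=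
    (measurable_partitionFn β h).pow_const 2
  have hV0 : ∀ g : Matrix (Fin N) (Fin N) ℝ, 0 ≤ condMoment β h k g :=
    fun g => (condMoment_pos β h k g).le
  have hZi := integrable_partitionFn_sq (N := N) β h hN
  have hVi : Integrable (fun g => condMoment β h k g) (matrixLaw N) := by
    refine (lintegral_ofReal_ne_top_iff_integrable hV.aestronglyMeasurable
      (ae_of_all _ hV0)).1 ?_
    have := lintegral_partitionFn_sq_on (N := N) β h hN k MeasurableSet.univ
    simp only [Set.preimage_univ, Measure.restrict_univ] at this
    rw [← this]
    exact (lintegral_ofReal_ne_top_iff_integrable hZ.aestronglyMeasurable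
      (ae_of_all _ fun g => sq_nonneg _)).2 hZi
  rw [← hg.map_eq] at hZi hVi
  have hZi' := hZi.comp_measurable hgm
  have hVi' := hVi.comp_measurable hgm
  refine (ae_eq_condExp_of_forall_setIntegral_eq hle0 hZi' (fun s _ _ => hVi'.integrableOn)
    (fun s hs _ => ?_) ?_).symm
  · obtain ⟨B, hB, rfl⟩ := hset s hs
    have hA := measurable_stepData (N := N) β h k hB
    have e1 : ∀ f : Matrix (Fin N) (Fin N) ℝ → ℝ, Measurable f → (∀ g, 0 ≤ f g) →
        ∫ ω in g ⁻¹' (stepData β h k ⁻¹' B), f (g ω) ∂P =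
        (∫⁻ A in stepData β h k ⁻¹' B, ENNReal.ofReal (f A) ∂(matrixLaw N)).toReal := by
      intro f hf hf0
      rw [← hg.map_eq, integral_eq_lintegral_of_nonneg_ae (ae_of_all _ fun ω => hf0 _)
        (hf.comp hgm).aestronglyMeasurable, setLIntegral_map hA hf.ennreal_ofReal hgm]
    refine (e1 _ hV hV0).trans (Eq.trans ?_ (e1 _ hZ fun g => sq_nonneg _).symm)
    rw [lintegral_partitionFn_sq_on β h hN k hB]
  · exact (@measurable_condMoment_of N β h k Ω (sigmaField β h g k) g hxi
      heta).stronglyMeasurable.aestronglyMeasurable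

end CondExp

/-! ### Pseudo-Lipschitz functions -/

section PseudoLipschitz

/-- Locally Lipschitz functions with a Lipschitz constant of linear growth. -/
def PseudoLip {k : ℕ} (f : (Fin k → ℝ) → ℝ) (L : ℝ) : Prop :=
  0 ≤ L ∧ ∀ x y, |f x - f y| ≤ L * (1 + ‖x‖ + ‖y‖) * ‖x - y‖

variable {k : ℕ}

theorem PseudoLip.continuous {f : (Fin k → ℝ) → ℝ} {L : ℝ} (hf : PseudoLip f L) :
    Continuous f := by
  refine continuous_iff_continuousAt.2 fun x => ?_
  refine tendsto_iff_dist_tendsto_zero.2 ?_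
  have h1 : Tendsto (fun y => L * (1 + ‖y‖ + ‖x‖) * ‖y - x‖) (𝓝 x) (𝓝 0) := by
    have : Continuous fun y => L * (1 + ‖y‖ + ‖x‖) * ‖y - x‖ := by fun_prop
    simpa using this.tendsto x
  exact squeeze_zero (fun _ => dist_nonneg) (fun y => by
    rw [Real.dist_eq]; exact hf.2 y x) h1

/-- Inner products of Lipschitz functions of the fields are empirical averages of such products, the
test functions needed for the overlaps. -/
theorem PseudoLip.mul {f g : (Fin k → ℝ) → ℝ} {A B : ℝ} (hA : 0 ≤ A) (hB : 0 ≤ B)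
    (hf : ∀ x y, |f x - f y| ≤ A * ‖x - y‖) (hg : ∀ x y, |g x - g y| ≤ B * ‖x - y‖) :
    PseudoLip (fun x => f x * g x) (|f 0| * B + |g 0| * A + A * B) := by
  refine ⟨by positivity, fun x y => ?_⟩
  have h1 : |f x| ≤ |f 0| + A * ‖x‖ := by
    have := hf x 0
    rw [sub_zero] at this
    have h2 := abs_sub_abs_le_abs_sub (f x) (f 0)
    linarith
  have h2 : |g y| ≤ |g 0| + B * ‖y‖ := by
    have := hg y 0
    rw [sub_zero] at this
    have h2 := abs_sub_abs_le_abs_sub (g y) (g 0)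
    linarith
  have h3 : f x * g x - f y * g y = f x * (g x - g y) + g y * (f x - f y) := by ring
  have h4 : |f x * g x - f y * g y| ≤ |f x| * (B * ‖x - y‖) + |g y| * (A * ‖x - y‖) := by
    rw [h3]
    refine (abs_add_le _ _).trans ?_
    rw [abs_mul, abs_mul]
    gcongr
    · exact hg x y
    · exact hf x y
  refine h4.trans ?_
  have h5 : |f x| * (B * ‖x - y‖) + |g y| * (A * ‖x - y‖) ≤
      (|f 0| + A * ‖x‖) * (B * ‖x - y‖) + (|g 0| + B * ‖y‖) * (A * ‖x - y‖) := by gcongr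
  refine h5.trans ?_
  have e : (|f 0| * B + |g 0| * A + A * B) * (1 + ‖x‖ + ‖y‖) * ‖x - y‖ -
      ((|f 0| + A * ‖x‖) * (B * ‖x - y‖) + (|g 0| + B * ‖y‖) * (A * ‖x - y‖)) =
      ((|f 0| * B + |g 0| * A) * (‖x‖ + ‖y‖) + A * B) * ‖x - y‖ := by ring
  have : 0 ≤ ((|f 0| * B + |g 0| * A) * (‖x‖ + ‖y‖) + A * B) * ‖x - y‖ := by positivity
  linarith

theorem norm_le_sqrt_sum (x : Fin k → ℝ) : ‖x‖ ^ 2 ≤ ∑ s, x s ^ 2 := by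
  have h0 : 0 ≤ ∑ s, x s ^ 2 := Finset.sum_nonneg fun s _ => sq_nonneg _
  have h1 : ‖x‖ ≤ √(∑ s, x s ^ 2) := by
    refine (pi_norm_le_iff_of_nonneg (Real.sqrt_nonneg _)).2 fun s => ?_
    rw [Real.norm_eq_abs]
    refine Real.abs_le_sqrt (Finset.single_le_sum (f := fun s => x s ^ 2)
      (fun t _ => sq_nonneg _) (Finset.mem_univ s))
  calc ‖x‖ ^ 2 ≤ √(∑ s, x s ^ 2) ^ 2 := by gcongr
    _ = _ := Real.sq_sqrt h0

theorem norm_snoc_le (y : Fin k → ℝ) (w : ℝ) :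
    ‖(Fin.snoc y w : Fin (k + 1) → ℝ)‖ ≤ ‖y‖ + |w| := by
  refine (pi_norm_le_iff_of_nonneg (by positivity)).2 fun s => ?_
  refine Fin.lastCases ?_ (fun s => ?_) s
  · simp
  · have := norm_le_pi_norm y s
    simp only [Fin.snoc_castSucc]
    have := abs_nonneg w
    linarith

theorem snoc_sub_snoc (y y' : Fin k → ℝ) (w w' : ℝ) :
    (Fin.snoc y w : Fin (k + 1) → ℝ) - Fin.snoc y' w' = Fin.snoc (y - y') (w - w') := by
  ext s
  refine Fin.lastCases ?_ (fun s => ?_) s <;> simp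

theorem continuous_snoc (y : Fin k → ℝ) :
    Continuous fun w : ℝ => (Fin.snoc y w : Fin (k + 1) → ℝ) := by
  refine continuous_pi fun s => ?_
  refine Fin.lastCases ?_ (fun s => ?_) s
  · simp only [Fin.snoc_last]; exact continuous_id
  · simp only [Fin.snoc_castSucc]; exact continuous_const

variable {f : (Fin (k + 1) → ℝ) → ℝ} {L : ℝ}

/-- Average over the last coordinate. -/
def lastAvg (f : (Fin (k + 1) → ℝ) → ℝ) (y : Fin k → ℝ) : ℝ :=
  ∫ w, f (Fin.snoc y w) ∂(gaussianReal 0 1)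

theorem PseudoLip.snoc_left (hf : PseudoLip f L) (y y' : Fin k → ℝ) (w : ℝ) :
    |f (Fin.snoc y w) - f (Fin.snoc y' w)| ≤ L * (1 + ‖y‖ + ‖y'‖ + 2 * |w|) * ‖y - y'‖ := by
  refine (hf.2 _ _).trans ?_
  rw [snoc_sub_snoc, sub_self]
  have h1 := norm_snoc_le y w
  have h2 := norm_snoc_le y' w
  have h3 := norm_snoc_le (y - y') 0
  rw [abs_zero, add_zero] at h3
  refine mul_le_mul (mul_le_mul_of_nonneg_left ?_ hf.1) h3 (norm_nonneg _)
    (mul_nonneg hf.1 (by positivity))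
  linarith

theorem PseudoLip.snoc_right (hf : PseudoLip f L) (y : Fin k → ℝ) (w w' : ℝ) :
    |f (Fin.snoc y w) - f (Fin.snoc y w')| ≤ L * (1 + 2 * ‖y‖ + |w| + |w'|) * |w - w'| := by
  refine (hf.2 _ _).trans ?_
  rw [snoc_sub_snoc, sub_self]
  have h1 := norm_snoc_le y w
  have h2 := norm_snoc_le y w'
  have h3 := norm_snoc_le (0 : Fin k → ℝ) (w - w')
  rw [norm_zero, zero_add] at h3
  refine mul_le_mul (mul_le_mul_of_nonneg_left ?_ hf.1) h3 (norm_nonneg _)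
    (mul_nonneg hf.1 (by positivity))
  linarith

theorem integrable_abs_gaussianReal : Integrable (fun w : ℝ => |w|) (gaussianReal 0 1) := by
  simpa using (integrable_pow_gaussianReal 1).abs

theorem integral_abs_gaussianReal_le : ∫ w, |w| ∂(gaussianReal 0 1) ≤ 1 := by
  calc ∫ w, |w| ∂(gaussianReal 0 1) ≤ ∫ w, (1 / 2 + w ^ 2 / 2) ∂(gaussianReal 0 1) := by
        refine integral_mono integrable_abs_gaussianReal ((integrable_const _).add
          ((integrable_pow_gaussianReal 2).div_const 2)) fun w => ?_
        simp only
        nlinarith [sq_nonneg (|w| - 1), sq_abs w]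
    _ = 1 := by
        rw [integral_add (integrable_const _) ((integrable_pow_gaussianReal 2).div_const 2),
          integral_div _ (fun w : ℝ => w ^ 2), integral_gaussianReal_sq, integral_const]
        norm_num

theorem PseudoLip.sq_sub_le (hf : PseudoLip f L) (y : Fin k → ℝ) (w : ℝ) :
    (f (Fin.snoc y w) - f (Fin.snoc y 0)) ^ 2 ≤
      3 * L ^ 2 * ((1 + 4 * ‖y‖ ^ 2) * w ^ 2 + w ^ 4) := by
  have h1 := hf.snoc_right y w 0
  rw [sub_zero, abs_zero, add_zero] at h1
  have h2 : (f (Fin.snoc y w) - f (Fin.snoc y 0)) ^ 2 ≤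
      (L * (1 + 2 * ‖y‖ + |w|) * |w|) ^ 2 := sq_le_sq' (by
        have := neg_abs_le (f (Fin.snoc y w) - f (Fin.snoc y 0)); linarith)
      ((le_abs_self _).trans h1)
  refine h2.trans ?_
  have h3 : (1 + 2 * ‖y‖ + |w|) ^ 2 ≤ 3 * (1 + 4 * ‖y‖ ^ 2 + w ^ 2) := by
    rw [← sq_abs w]
    nlinarith [sq_nonneg (1 - 2 * ‖y‖), sq_nonneg (1 - |w|), sq_nonneg (2 * ‖y‖ - |w|)]
  calc (L * (1 + 2 * ‖y‖ + |w|) * |w|) ^ 2 = L ^ 2 * (1 + 2 * ‖y‖ + |w|) ^ 2 * w ^ 2 := by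
        rw [mul_pow, mul_pow, sq_abs]
    _ ≤ L ^ 2 * (3 * (1 + 4 * ‖y‖ ^ 2 + w ^ 2)) * w ^ 2 := by gcongr
    _ = _ := by ring

theorem PseudoLip.memLp_snoc (hf : PseudoLip f L) (y : Fin k → ℝ) :
    MemLp (fun w => f (Fin.snoc y w)) 2 (gaussianReal 0 1) := by
  have hc : Continuous fun w => f (Fin.snoc y w) := hf.continuous.comp (continuous_snoc y)
  have h1 : MemLp (fun w => f (Fin.snoc y w) - f (Fin.snoc y 0)) 2 (gaussianReal 0 1) := by
    refine (memLp_two_iff_integrable_sq (hc.sub continuous_const).aestronglyMeasurable).2 ?_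
    refine Integrable.mono' (((integrable_pow_gaussianReal 2).const_mul (1 + 4 * ‖y‖ ^ 2)).add
      (integrable_pow_gaussianReal 4) |>.const_mul (3 * L ^ 2))
      ((hc.sub continuous_const).pow 2).aestronglyMeasurable (ae_of_all _ fun w => ?_)
    rw [Real.norm_eq_abs, abs_of_nonneg (sq_nonneg _)]
    exact hf.sq_sub_le y w
  have h2 := h1.add (memLp_const (f (Fin.snoc y 0)))
  refine h2.congr_norm hc.aestronglyMeasurable (ae_of_all _ fun w => ?_)
  simp

theorem PseudoLip.integrable_snoc (hf : PseudoLip f L) (y : Fin k → ℝ) :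
    Integrable (fun w => f (Fin.snoc y w)) (gaussianReal 0 1) :=
  (hf.memLp_snoc y).integrable (by norm_num)

/-- Stability under Gaussian averaging of a coordinate is what makes the class suitable for
induction on the number of fields. The factor 3 comes from 1 + 2E|w| ≤ 3. -/
theorem PseudoLip.lastAvg (hf : PseudoLip f L) : PseudoLip (lastAvg f) (3 * L) := by
  have hL := hf.1
  refine ⟨by positivity, fun x y => ?_⟩
  rw [SKModel.lastAvg, SKModel.lastAvg, ← integral_sub (hf.integrable_snoc x) (hf.integrable_snoc y)]
  refine (abs_integral_le_integral_abs).trans ?_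
  have hi : Integrable (fun w => L * (1 + ‖x‖ + ‖y‖ + 2 * |w|) * ‖x - y‖) (gaussianReal 0 1) :=
    (((integrable_const _).add (integrable_abs_gaussianReal.const_mul 2)).const_mul L).mul_const _
  refine (integral_mono ((hf.integrable_snoc x).sub (hf.integrable_snoc y)).abs hi
    fun w => hf.snoc_left x y w).trans ?_
  rw [integral_mul_const, integral_const_mul, integral_add (integrable_const _)
    (integrable_abs_gaussianReal.const_mul 2), integral_const_mul, integral_const]
  have h1 := integral_abs_gaussianReal_le
  simp only [probReal_univ, one_smul]
  have h2 : 1 + ‖x‖ + ‖y‖ + 2 * ∫ w, |w| ∂(gaussianReal 0 1) ≤ 3 * (1 + ‖x‖ + ‖y‖) := by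
    have := norm_nonneg x
    have := norm_nonneg y
    linarith
  calc _ ≤ L * (3 * (1 + ‖x‖ + ‖y‖)) * ‖x - y‖ := by gcongr
    _ = _ := by ring

theorem PseudoLip.variance_le (hf : PseudoLip f L) (y : Fin k → ℝ) :
    Var[fun w => f (Fin.snoc y w); gaussianReal 0 1] ≤ 12 * L ^ 2 * (1 + ‖y‖ ^ 2) := by
  have hc : Continuous fun w => f (Fin.snoc y w) := hf.continuous.comp (continuous_snoc y)
  have e : Var[fun w => f (Fin.snoc y w); gaussianReal 0 1] =
      Var[fun w => f (Fin.snoc y w) - f (Fin.snoc y 0); gaussianReal 0 1] :=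
    (variance_sub_const hc.aestronglyMeasurable _).symm
  rw [e]
  refine (variance_le_expectation_sq (hc.sub continuous_const).aestronglyMeasurable).trans ?_
  have hi := (((integrable_pow_gaussianReal 2).const_mul (1 + 4 * ‖y‖ ^ 2)).add
      (integrable_pow_gaussianReal 4) |>.const_mul (3 * L ^ 2))
  refine (integral_mono_of_nonneg (ae_of_all _ fun w => sq_nonneg _) hi
    (ae_of_all _ fun w => hf.sq_sub_le y w)).trans ?_
  rw [integral_const_mul]
  simp only [Pi.add_apply]
  rw [integral_add ((integrable_pow_gaussianReal 2).const_mul (1 + 4 * ‖y‖ ^ 2))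
    (integrable_pow_gaussianReal 4), integral_const_mul, integral_gaussianReal_sq,
    integral_gaussianReal_pow_four]
  push_cast
  nlinarith [sq_nonneg (L * ‖y‖), sq_nonneg L]

theorem PseudoLip.abs_le {f : (Fin k → ℝ) → ℝ} (hf : PseudoLip f L) (x : Fin k → ℝ) :
    |f x| ≤ |f 0| + 2 * L * (1 + ∑ s, x s ^ 2) := by
  have h1 := hf.2 x 0
  rw [sub_zero, norm_zero, add_zero] at h1
  have h2 := abs_sub_abs_le_abs_sub (f x) (f 0)
  have h3 := norm_le_sqrt_sum x
  have h4 : L * (1 + ‖x‖) * ‖x‖ ≤ 2 * L * (1 + ‖x‖ ^ 2) := by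
    have hL := hf.1
    have : (1 + ‖x‖) * ‖x‖ ≤ 2 * (1 + ‖x‖ ^ 2) := by nlinarith [sq_nonneg (‖x‖ - 1)]
    nlinarith
  have h5 : 2 * L * (1 + ‖x‖ ^ 2) ≤ 2 * L * (1 + ∑ s, x s ^ 2) := by
    have hL := hf.1
    gcongr
  linarith

theorem integrable_coord_sq (s : Fin k) :
    Integrable (fun x : Fin k → ℝ => x s ^ 2) (gauss (Fin k) 1) := by
  have h1 := integrable_sq_linearForm_gauss 1 (Pi.single s 1 : Fin k → ℝ)
  simpa [Pi.single_apply] using h1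

theorem PseudoLip.integrable {f : (Fin k → ℝ) → ℝ} (hf : PseudoLip f L) :
    Integrable f (gauss (Fin k) 1) := by
  refine Integrable.mono' ((integrable_const (|f 0|)).add (((integrable_const (1 : ℝ)).add
    (integrable_finsetSum Finset.univ fun s _ => integrable_coord_sq s)).const_mul (2 * L)))
    hf.continuous.aestronglyMeasurable (ae_of_all _ fun x => ?_)
  exact hf.abs_le x

theorem PseudoLip.integral_lastAvg (hf : PseudoLip f L) :
    ∫ y, SKModel.lastAvg f y ∂(gauss (Fin k) 1) = ∫ x, f x ∂(gauss (Fin (k + 1)) 1) := by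
  have hmp := measurePreserving_piFinSuccAbove (fun _ : Fin (k + 1) => gaussianReal 0 1)
    (Fin.last k)
  have hsymm := hmp.symm
  have hi : Integrable (fun p : ℝ × (Fin k → ℝ) => f (Fin.snoc p.2 p.1))
      ((gaussianReal 0 1).prod (gauss (Fin k) 1)) := by
    have := (hsymm.integrable_comp_emb (MeasurableEquiv.measurableEmbedding _) (g := f)).2
      hf.integrable
    refine this.congr (ae_of_all _ fun p => ?_)
    simp [MeasurableEquiv.piFinSuccAbove, Fin.insertNthEquiv, Fin.insertNth_last']
  have e := hsymm.integral_comp (MeasurableEquiv.measurableEmbedding _) f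
  rw [gauss, ← e]
  have e2 : ∀ p : ℝ × (Fin k → ℝ), f ((MeasurableEquiv.piFinSuccAbove
      (fun _ : Fin (k + 1) => ℝ) (Fin.last k)).symm p) = f (Fin.snoc p.2 p.1) := fun p => by
    simp [MeasurableEquiv.piFinSuccAbove, Fin.insertNthEquiv, Fin.insertNth_last']
  simp_rw [e2]
  exact (integral_prod_symm _ hi).symm

end PseudoLipschitz

/-! ### Convergence in probability as a filter -/

section HighProbability

/-- Sets of matrices of varying dimension that have probability tending to one. -/
def hp : Filter (Σ N : ℕ, Matrix (Fin N) (Fin N) ℝ) where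
  sets := {A | Tendsto (fun N => matrixLaw N {g | (⟨N, g⟩ : Σ N : ℕ, Matrix (Fin N) (Fin N) ℝ) ∉ A})
    atTop (𝓝 0)}
  univ_sets := by simp
  sets_of_superset := fun {A B} hA hAB => by
    refine tendsto_of_tendsto_of_tendsto_of_le_of_le tendsto_const_nhds hA (fun _ => zero_le)
      fun N => measure_mono fun g hg hgA => hg (hAB hgA)
  inter_sets := fun {A B} hA hB => by
    have h := Tendsto.add hA hB
    rw [add_zero] at h
    refine tendsto_of_tendsto_of_tendsto_of_le_of_le tendsto_const_nhds h (fun _ => zero_le)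
      fun N => (measure_mono fun g hg => ?_).trans (measure_union_le _ _)
    simp only [Set.mem_ofPred_eq, Set.mem_inter_iff, not_and_or] at hg
    exact hg

theorem eventually_hp_iff {p : (Σ N : ℕ, Matrix (Fin N) (Fin N) ℝ) → Prop} :
    (∀ᶠ z in hp, p z) ↔ Tendsto (fun N => matrixLaw N {g | ¬ p ⟨N, g⟩}) atTop (𝓝 0) := Iff.rfl

theorem eventually_hp_of_eventually {p : (Σ N : ℕ, Matrix (Fin N) (Fin N) ℝ) → Prop}
    (h : ∀ᶠ N in atTop, ∀ g : Matrix (Fin N) (Fin N) ℝ, p ⟨N, g⟩) : ∀ᶠ z in hp, p z := by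
  rw [eventually_hp_iff]
  refine tendsto_const_nhds.congr' (h.mono fun N hN => ?_)
  simp [hN]

theorem eventually_hp_ne_zero : ∀ᶠ z : Σ N : ℕ, Matrix (Fin N) (Fin N) ℝ in hp, z.1 ≠ 0 :=
  eventually_hp_of_eventually ((eventually_ne_atTop 0).mono fun _ hN _ => hN)

/-- Markov's inequality. -/
theorem tendsto_hp_of_lintegral {F : (Σ N : ℕ, Matrix (Fin N) (Fin N) ℝ) → ℝ}
    (hm : ∀ N, Measurable fun g => F ⟨N, g⟩)
    (hF : Tendsto (fun N => ∫⁻ g, ENNReal.ofReal |F ⟨N, g⟩| ∂(matrixLaw N)) atTop (𝓝 0)) :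
    Tendsto F hp (𝓝 0) := by
  refine Metric.tendsto_nhds.2 fun ε hε => ?_
  rw [eventually_hp_iff]
  have h1 := ENNReal.Tendsto.div_const hF (b := ENNReal.ofReal ε)
    (Or.inr (by simpa using hε))
  rw [ENNReal.zero_div] at h1
  refine tendsto_of_tendsto_of_tendsto_of_le_of_le tendsto_const_nhds h1 (fun _ => zero_le)
    fun N => ?_
  refine le_trans (measure_mono fun g hg => ?_) (meas_ge_le_lintegral_div (ε := ENNReal.ofReal ε)
    (((hm N).abs).ennreal_ofReal).aemeasurable (by simpa using hε) ENNReal.ofReal_ne_top)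
  simp only [Set.mem_ofPred_eq, Real.dist_eq, sub_zero, not_lt] at hg
  exact ENNReal.ofReal_le_ofReal hg

end HighProbability

/-! ### The fields as perturbations of Gaussian vectors -/

section GaussianFields

variable {N : ℕ}

theorem inner_eq_linearForm (φ w : Fin N → ℝ) : inner φ w = ∑ i, φ i / N * w i := by
  rw [inner, Finset.sum_div]
  exact Finset.sum_congr rfl fun i _ => by ring

theorem integrable_inner_sq (φ : Fin N → ℝ) :
    Integrable (fun w => inner φ w ^ 2) (gauss (Fin N) 1) := by
  simp_rw [inner_eq_linearForm φ]
  exact integrable_sq_linearForm_gauss 1 _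

theorem integral_inner_sq (φ : Fin N → ℝ) :
    ∫ w, inner φ w ^ 2 ∂(gauss (Fin N) 1) = inner φ φ / N := by
  simp_rw [inner_eq_linearForm φ]
  rw [integral_sq_linearForm_gauss, Finset.sum_div, NNReal.coe_one, one_mul]
  exact Finset.sum_congr rfl fun i _ => by ring

theorem integrable_inner_self : Integrable (fun w : Fin N → ℝ => inner w w) (gauss (Fin N) 1) := by
  unfold inner
  refine (integrable_finsetSum _ fun i _ => ?_).div_const _
  simpa [sq] using integrable_coord_sq i

theorem integral_inner_self (hN : N ≠ 0) : ∫ w : Fin N → ℝ, inner w w ∂(gauss (Fin N) 1) = 1 := by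
  have hN' : (N : ℝ) ≠ 0 := by positivity
  unfold inner
  rw [integral_div, integral_finsetSum]
  · have : ∀ i : Fin N, ∫ x : Fin N → ℝ, x i * x i ∂(gauss (Fin N) 1) = 1 := fun i => by
      have h1 := integral_sq_linearForm_gauss 1 (Pi.single i 1 : Fin N → ℝ)
      simpa [Pi.single_apply, sq] using h1
    simp [this, hN']
  · intro i _
    simpa [sq] using integrable_coord_sq i

/-- The normalized sum of two vectors. -/
def halfSum (p : (Fin N → ℝ) × (Fin N → ℝ)) : Fin N → ℝ := (√2)⁻¹ • (p.1 + p.2)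

theorem measurable_halfSum : Measurable (halfSum (N := N)) :=
  (measurable_fst.add measurable_snd).const_smul (√2)⁻¹

theorem map_halfSum :
    ((gauss (Fin N) 1).prod (gauss (Fin N) 1)).map halfSum = gauss (Fin N) 1 := by
  refine map_gauss_prod_gauss measurable_halfSum (fun c i => (√2)⁻¹ * c i)
    (fun c i => (√2)⁻¹ * c i) (fun c p => ?_) fun c => ?_
  · rw [← Finset.sum_add_distrib]
    exact Finset.sum_congr rfl fun i _ => by
      simp only [halfSum, Pi.smul_apply, Pi.add_apply, smul_eq_mul]; ring
  · have h2 : ((√2)⁻¹) ^ 2 = (1 / 2 : ℝ) := by rw [inv_pow, Real.sq_sqrt (by norm_num)]; norm_num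
    simp only [mul_pow, h2, ← Finset.mul_sum, NNReal.coe_one]
    ring

theorem integrable_halfSum {G : (Fin N → ℝ) → ℝ} (hG : Integrable G (gauss (Fin N) 1)) :
    Integrable (fun p => G (halfSum p)) ((gauss (Fin N) 1).prod (gauss (Fin N) 1)) := by
  rw [← map_halfSum] at hG
  exact hG.comp_measurable measurable_halfSum

theorem integral_halfSum {G : (Fin N → ℝ) → ℝ} (hG : Integrable G (gauss (Fin N) 1)) :
    ∫ p, G (halfSum p) ∂((gauss (Fin N) 1).prod (gauss (Fin N) 1)) =
      ∫ w, G w ∂(gauss (Fin N) 1) := by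
  conv_rhs => rw [← map_halfSum]
  rw [integral_map measurable_halfSum.aemeasurable]
  rw [map_halfSum]
  exact hG.aestronglyMeasurable

variable (β h : ℝ) (k : ℕ) (g : Matrix (Fin N) (Fin N) ℝ)

/-- `ζ_k` in terms of the first `k` steps and two independent Gaussian vectors. -/
def zetaRep (p : (Fin N → ℝ) × (Fin N → ℝ)) : Fin N → ℝ :=
  (√2)⁻¹ • (xiRep β h k g p.1 + etaRep β h k g p.1 p.2)

theorem lintegral_zeta_step (hN : N ≠ 0) {F : Matrix (Fin N) (Fin N) ℝ → ENNReal}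
    (hF : Measurable F) {H : Matrix (Fin N) (Fin N) ℝ → (Fin N → ℝ) → ENNReal}
    (hH : ∀ g, Measurable (H g))
    (hFH : ∀ g x, F (resample β h k g x) = H g (zeta β h (resample β h k g x) k)) :
    ∫⁻ g, F g ∂(matrixLaw N) =
      ∫⁻ g, ∫⁻ p, H g (zetaRep β h k g p)
        ∂((gauss (Fin N) 1).prod (gauss (Fin N) 1)) ∂(matrixLaw N) :=
  lintegral_step β h hN k hF (H := fun g p => H g ((√2)⁻¹ • (p.1 + p.2)))
    (fun g => (hH g).comp measurable_halfSum) hFH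

/-- A bound on the squared distance between `ζ_k` and a Gaussian vector. -/
def defect (p : (Fin N → ℝ) × (Fin N → ℝ)) : ℝ :=
  ∑ s : Fin k, inner (phi β h g s) (halfSum p) ^ 2 + inner (phi β h g k) p.1 ^ 2 +
    inner (phi β h g k) p.2 ^ 2 + {g' | phi β h g' k = 0}.indicator 1 g * inner (halfSum p) (halfSum p)

/-- The vector ζ_k misses the components of the Gaussian along the k earlier directions and has a
modified component along φ_k; these errors are orthogonal. If φ_k = 0 then ζ_k = 0 and the whole
Gaussian is the error, whence the indicator. -/
theorem inner_halfSum_sub_zetaRep_le (p : (Fin N → ℝ) × (Fin N → ℝ)) :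
    inner (halfSum p - zetaRep β h k g p) (halfSum p - zetaRep β h k g p) ≤ defect β h k g p := by
  have hs : 0 ≤ ∑ s : Fin k, inner (phi β h g s) (halfSum p) ^ 2 :=
    Finset.sum_nonneg fun s _ => sq_nonneg _
  rcases phi_eq_zero_or β h g k with h0 | h0
  · have e : {g' : Matrix (Fin N) (Fin N) ℝ | phi β h g' k = 0}.indicator 1 g = (1 : ℝ) := by
      simp [h0]
    have e2 : zetaRep β h k g p = 0 := by simp [zetaRep, xiRep, etaRep, h0]
    rw [defect, e, e2, sub_zero, one_mul, h0]
    simp only [inner_zero_left]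
    linarith
  · have hne : phi β h g k ≠ 0 := fun h1 => by simp [h1] at h0
    have e : {g' : Matrix (Fin N) (Fin N) ℝ | phi β h g' k = 0}.indicator 1 g = (0 : ℝ) := by
      simp [hne]
    set c := (√2)⁻¹ * (inner (phi β h g k) p.1 - inner (phi β h g k) p.2) with hc
    set a : Fin N → ℝ := ∑ s : Fin k, inner (phi β h g s) (halfSum p) • phi β h g s with ha
    have e2 : halfSum p - zetaRep β h k g p = a - c • phi β h g k := by
      have e3 : zetaRep β h k g p = proj β h g k *ᵥ halfSum p + c • phi β h g k := by
        simp only [zetaRep, xiRep, etaRep, h0, one_smul, halfSum, Matrix.mulVec_add,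
          Matrix.mulVec_smul, proj_mulVec_phi_of_le β h g (le_refl k), hc, smul_add, smul_smul,
          one_mul]
        abel
      rw [e3, proj_mulVec, Finset.sum_range, ha]
      abel
    have h1 : inner a a ≤ ∑ s : Fin k, inner (phi β h g s) (halfSum p) ^ 2 := by
      rw [ha, inner_sum_left]
      refine Finset.sum_le_sum fun s _ => ?_
      rw [inner_sum_right, Finset.sum_eq_single s]
      · rw [inner_smul_left, inner_smul_right, ← mul_assoc, ← sq]
        exact mul_le_of_le_one_right (sq_nonneg _) (inner_phi_self_le β h g s)
      · intro t _ hts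
        rw [inner_smul_left, inner_smul_right,
          inner_phi_of_ne β h g (fun h' => hts (Fin.ext h'.symm)), mul_zero, mul_zero]
      · simp
    have h2 : inner a (phi β h g k) = 0 := by
      rw [ha, inner_sum_left]
      exact Finset.sum_eq_zero fun s _ => by
        rw [inner_smul_left, inner_phi_of_lt β h g s.2, mul_zero]
    have h3 : c ^ 2 ≤ inner (phi β h g k) p.1 ^ 2 + inner (phi β h g k) p.2 ^ 2 := by
      rw [hc, mul_pow, inv_pow, Real.sq_sqrt (by norm_num)]
      nlinarith [sq_nonneg (inner (phi β h g k) p.1 + inner (phi β h g k) p.2)]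
    rw [e2, defect, e]
    simp only [inner_sub_left, inner_sub_right, inner_smul_left, inner_smul_right, h0]
    rw [inner_comm (phi β h g k) a, h2]
    linarith

theorem integrable_defect :
    Integrable (defect β h k g) ((gauss (Fin N) 1).prod (gauss (Fin N) 1)) := by
  refine (((integrable_finsetSum _ fun s _ => ?_).add ?_).add ?_).add (Integrable.const_mul ?_ _)
  · exact integrable_halfSum (integrable_inner_sq _)
  · exact (integrable_inner_sq (phi β h g k)).comp_fst _
  · exact (integrable_inner_sq (phi β h g k)).comp_snd _
  · exact integrable_halfSum integrable_inner_self

/-- Each of the k + 2 one-dimensional components costs at most 1/N. -/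
theorem integral_defect_le (hN : N ≠ 0) :
    ∫ p, defect β h k g p ∂((gauss (Fin N) 1).prod (gauss (Fin N) 1)) ≤
      (k + 2) / N + {g' | phi β h g' k = 0}.indicator 1 g := by
  have hN' : (0 : ℝ) < N := by positivity
  have i1 : ∀ s : Fin k, Integrable (fun p => inner (phi β h g s) (halfSum p) ^ 2)
      ((gauss (Fin N) 1).prod (gauss (Fin N) 1)) := fun s =>
    integrable_halfSum (integrable_inner_sq _)
  have i2 : Integrable (fun p : (Fin N → ℝ) × (Fin N → ℝ) => inner (phi β h g k) p.1 ^ 2)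
      ((gauss (Fin N) 1).prod (gauss (Fin N) 1)) := (integrable_inner_sq (phi β h g k)).comp_fst _
  have i3 : Integrable (fun p : (Fin N → ℝ) × (Fin N → ℝ) => inner (phi β h g k) p.2 ^ 2)
      ((gauss (Fin N) 1).prod (gauss (Fin N) 1)) := (integrable_inner_sq (phi β h g k)).comp_snd _
  have i4 : Integrable (fun p : (Fin N → ℝ) × (Fin N → ℝ) => inner (halfSum p) (halfSum p))
      ((gauss (Fin N) 1).prod (gauss (Fin N) 1)) := integrable_halfSum integrable_inner_self
  have i5 : Integrable (fun p => ∑ s : Fin k, inner (phi β h g s) (halfSum p) ^ 2)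
      ((gauss (Fin N) 1).prod (gauss (Fin N) 1)) := integrable_finsetSum _ fun s _ => i1 s
  have i6 : Integrable (fun p : (Fin N → ℝ) × (Fin N → ℝ) =>
      ∑ s : Fin k, inner (phi β h g s) (halfSum p) ^ 2 + inner (phi β h g k) p.1 ^ 2)
      ((gauss (Fin N) 1).prod (gauss (Fin N) 1)) := i5.add i2
  have i7 : Integrable (fun p : (Fin N → ℝ) × (Fin N → ℝ) =>
      ∑ s : Fin k, inner (phi β h g s) (halfSum p) ^ 2 + inner (phi β h g k) p.1 ^ 2 +
        inner (phi β h g k) p.2 ^ 2)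
      ((gauss (Fin N) 1).prod (gauss (Fin N) 1)) := i6.add i3
  have j : ∀ s, inner (phi β h g s) (phi β h g s) / N ≤ 1 / N := fun s =>
    div_le_div_of_nonneg_right (inner_phi_self_le β h g s) hN'.le
  unfold defect
  rw [integral_add i7 (i4.const_mul _), integral_add i6 i3, integral_add i5 i2,
    integral_finsetSum _ fun s _ => i1 s, integral_const_mul,
    integral_halfSum integrable_inner_self, integral_inner_self hN, mul_one,
    integral_fun_fst (fun u => inner (phi β h g k) u ^ 2),
    integral_fun_snd (fun u => inner (phi β h g k) u ^ 2), integral_inner_sq]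
  simp only [probReal_univ, one_smul, integral_halfSum (integrable_inner_sq _), integral_inner_sq]
  have h1 : ∑ s : Fin k, inner (phi β h g s) (phi β h g s) / N ≤ ∑ _s : Fin k, 1 / (N : ℝ) :=
    Finset.sum_le_sum fun s _ => j s
  simp only [Finset.sum_const, Finset.card_univ, Fintype.card_fin, nsmul_eq_mul] at h1
  have h2 := j k
  have e : ((k : ℝ) + 2) / N = k * (1 / N) + 1 / N + 1 / N := by ring
  rw [e]
  linarith

theorem inner_self_le_of_sub (w z : Fin N → ℝ) :
    inner z z ≤ 2 * inner w w + 2 * inner (w - z) (w - z) := by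
  have h1 := inner_self_nonneg (w - (w - z) + (w + (w - z)) - (w + (w - z)))
  have h2 := inner_self_nonneg (w + (w - z))
  simp only [inner_sub_left, inner_sub_right, inner_add_left, inner_add_right] at *
  rw [inner_comm z w] at *
  linarith

/-- The constant is 2 + 2((k + 2) + 1), with 1/N and the indicator both bounded by 1. Uniformity in
N is the point. -/
theorem lintegral_zeta_sq_le (hN : N ≠ 0) :
    ∫⁻ g, ENNReal.ofReal (inner (zeta β h g k) (zeta β h g k)) ∂(matrixLaw N) ≤
      ENNReal.ofReal (2 * k + 8) := by
  rw [lintegral_zeta_step β h k hN (H := fun _ z => ENNReal.ofReal (inner z z))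
    (measurable_inner (measurable_zeta β h k) (measurable_zeta β h k)).ennreal_ofReal
    (fun _ => (measurable_inner measurable_id measurable_id).ennreal_ofReal) fun _ _ => rfl]
  refine le_trans (lintegral_mono (g := fun _ => ENNReal.ofReal (2 * k + 8)) fun g => ?_) (by simp)
  have hi : Integrable (fun p => 2 * inner (halfSum p) (halfSum p) + 2 * defect β h k g p)
      ((gauss (Fin N) 1).prod (gauss (Fin N) 1)) :=
    ((integrable_halfSum (N := N) integrable_inner_self).const_mul 2).add
      ((integrable_defect β h k g).const_mul 2)
  refine (lintegral_mono fun p => ENNReal.ofReal_le_ofReal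
    ((inner_self_le_of_sub (halfSum p) _).trans (add_le_add_right (mul_le_mul_of_nonneg_left
      (inner_halfSum_sub_zetaRep_le β h k g p) zero_le_two) _))).trans ?_
  rw [← ofReal_integral_eq_lintegral_ofReal hi]
  · refine ENNReal.ofReal_le_ofReal ?_
    rw [integral_add ((integrable_halfSum (N := N) integrable_inner_self).const_mul 2)
      ((integrable_defect β h k g).const_mul 2), integral_const_mul, integral_const_mul,
      integral_halfSum integrable_inner_self, integral_inner_self hN]
    have h1 := integral_defect_le β h k g hN
    have h2 : ((k : ℝ) + 2) / N ≤ k + 2 :=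
      div_le_self (by positivity) (by exact_mod_cast Nat.one_le_iff_ne_zero.2 hN)
    have h3 : {g' | phi β h g' k = 0}.indicator 1 g ≤ (1 : ℝ) :=
      Set.indicator_le_self' (fun _ _ => zero_le_one) g
    linarith
  · exact ae_of_all _ fun p => (inner_self_nonneg _).trans
      ((inner_self_le_of_sub (halfSum p) _).trans (add_le_add_right (mul_le_mul_of_nonneg_left
      (inner_halfSum_sub_zetaRep_le β h k g p) zero_le_two) _))

/-- Given the past, ⟨φ_k, ξ_k⟩ is a normalized inner product with a standard Gaussian vector, hence
of variance at most 1/N. -/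
theorem lintegral_diagTerm_sq_le (hN : N ≠ 0) :
    ∫⁻ g, ENNReal.ofReal (diagTerm β h k g ^ 2) ∂(matrixLaw N) ≤ ENNReal.ofReal (1 / N) := by
  have hN' : (0 : ℝ) < N := by positivity
  rw [lintegral_step β h hN k
    (F := fun g => ENNReal.ofReal (diagTerm β h k g ^ 2))
    (H := fun g p => ENNReal.ofReal (inner (phi β h g k) p.1 ^ 2))
    ((measurable_inner (measurable_phi β h k) (measurable_xi β h k)).pow_const 2).ennreal_ofReal
    (fun g => ((measurable_inner measurable_const measurable_fst).pow_const 2).ennreal_ofReal)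
    fun g x => by rw [diagTerm, phi_resample β h g x le_rfl]]
  refine le_trans (lintegral_mono (g := fun _ => ENNReal.ofReal (1 / N)) fun g => ?_) (by simp)
  have i2 : Integrable (fun p : (Fin N → ℝ) × (Fin N → ℝ) => inner (phi β h g k) p.1 ^ 2)
      ((gauss (Fin N) 1).prod (gauss (Fin N) 1)) := (integrable_inner_sq (phi β h g k)).comp_fst _
  refine (lintegral_mono (g := fun p => ENNReal.ofReal (inner (phi β h g k) p.1 ^ 2))
    fun p => ENNReal.ofReal_le_ofReal ?_).trans ?_
  · have e : inner (phi β h g k) (xiRep β h k g p.1) = inner (phi β h g k) (phi β h g k) *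
        inner (phi β h g k) p.1 := by
      rw [xiRep, inner_smul_right, inner_mulVec, transpose_proj,
        proj_mulVec_phi_of_le β h g le_rfl]
    simp only
    rw [e, mul_pow]
    exact mul_le_of_le_one_left (sq_nonneg _)
      (pow_le_one₀ (inner_self_nonneg _) (inner_phi_self_le β h g k))
  · rw [← ofReal_integral_eq_lintegral_ofReal i2 (ae_of_all _ fun p => sq_nonneg _),
      integral_fun_fst (fun u => inner (phi β h g k) u ^ 2), integral_inner_sq]
    refine ENNReal.ofReal_le_ofReal ?_
    simp only [probReal_univ, one_smul]
    exact div_le_div_of_nonneg_right (inner_phi_self_le β h g k) hN'.le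

end GaussianFields

/-! ### The law of large numbers for the fields -/

section LawOfLargeNumbers

variable {N k : ℕ}

/-- The first `k` fields at site `i`. -/
def site (β h : ℝ) (k : ℕ) (g : Matrix (Fin N) (Fin N) ℝ) (i : Fin N) : Fin k → ℝ :=
  fun s => zeta β h g s i

theorem site_succ (β h : ℝ) (k : ℕ) (g : Matrix (Fin N) (Fin N) ℝ) (i : Fin N) :
    site β h (k + 1) g i = Fin.snoc (site β h k g i) (zeta β h g k i) := by
  ext s
  refine Fin.lastCases ?_ (fun s => ?_) s <;> simp [site]

/-- The empirical average of a function of the first `k` fields. -/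
def emp (β h : ℝ) (k : ℕ) (f : (Fin k → ℝ) → ℝ) (z : Σ N : ℕ, Matrix (Fin N) (Fin N) ℝ) : ℝ :=
  (∑ i, f (site β h k z.2 i)) / z.1

theorem measurable_site (β h : ℝ) (k : ℕ) (i : Fin N) :
    Measurable fun g : Matrix (Fin N) (Fin N) ℝ => site β h k g i :=
  measurable_pi_lambda _ fun s => (measurable_pi_apply i).comp (measurable_zeta β h s)

theorem measurable_emp (β h : ℝ) {f : (Fin k → ℝ) → ℝ} (hf : Continuous f) (N : ℕ) :
    Measurable fun g : Matrix (Fin N) (Fin N) ℝ => emp β h k f ⟨N, g⟩ :=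
  Measurable.div_const (Finset.measurable_sum Finset.univ fun i _ =>
    hf.measurable.comp (measurable_site β h k i)) (N : ℝ)

/-- Averages of independent centered variables. -/
theorem integral_sq_average_le {F : Fin N → ℝ → ℝ} {V : Fin N → ℝ}
    (hF : ∀ i, MemLp (F i) 2 (gaussianReal 0 1)) (hV : ∀ i, Var[F i; gaussianReal 0 1] ≤ V i) :
    Integrable (fun w : Fin N → ℝ =>
      ((∑ i, (F i (w i) - ∫ x, F i x ∂(gaussianReal 0 1))) / N) ^ 2) (gauss (Fin N) 1) ∧
    ∫ w : Fin N → ℝ, ((∑ i, (F i (w i) - ∫ x, F i x ∂(gaussianReal 0 1))) / N) ^ 2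
      ∂(gauss (Fin N) 1) ≤ (∑ i, V i) / N ^ 2 := by
  have hmp : ∀ i, MeasurePreserving (fun w : Fin N → ℝ => w i) (gauss (Fin N) 1)
      (gaussianReal 0 1) := fun i => measurePreserving_eval (fun _ => gaussianReal 0 1) i
  have hL : ∀ i, MemLp (fun w : Fin N → ℝ => F i (w i)) 2 (gauss (Fin N) 1) := fun i =>
    (hF i).comp_measurePreserving (hmp i)
  have hsum : MemLp (∑ i, fun w : Fin N → ℝ => F i (w i)) 2 (gauss (Fin N) 1) :=
    memLp_finsetSum' _ fun i _ => hL i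
  have e1 : ∫ w, (∑ i, fun w : Fin N → ℝ => F i (w i)) w ∂(gauss (Fin N) 1) =
      ∑ i, ∫ x, F i x ∂(gaussianReal 0 1) := by
    simp only [Finset.sum_apply]
    rw [integral_finsetSum _ fun i _ => (hL i).integrable (by norm_num)]
    refine Finset.sum_congr rfl fun i _ => ?_
    have := (hmp i).map_eq
    rw [← this, integral_map (measurable_pi_apply i).aemeasurable]
    rw [this]
    exact (hF i).aestronglyMeasurable
  have hvar := variance_sum_pi (μ := fun _ : Fin N => gaussianReal 0 1) hF
  rw [variance_eq_integral hsum.aestronglyMeasurable.aemeasurable, e1] at hvar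
  have e2 : ∀ w : Fin N → ℝ, ((∑ i, (F i (w i) - ∫ x, F i x ∂(gaussianReal 0 1))) / N) ^ 2 =
      ((∑ i, fun w : Fin N → ℝ => F i (w i)) w - ∑ i, ∫ x, F i x ∂(gaussianReal 0 1)) ^ 2 /
        N ^ 2 := fun w => by
    rw [Finset.sum_apply, ← Finset.sum_sub_distrib, div_pow]
  simp_rw [e2]
  refine ⟨((hsum.sub (memLp_const _)).integrable_sq).div_const _, ?_⟩
  rw [integral_div, hvar]
  exact div_le_div_of_nonneg_right (Finset.sum_le_sum fun i _ => hV i) (by positivity)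

/-- Young's inequality 2ad ≤ δa² + d²/δ trades growth times displacement for a small multiple of the
size plus a large multiple of the squared displacement, which is O(1/N) on average over sites when
φ_k does not vanish. -/
theorem PseudoLip.snoc_perturb {f : (Fin (k + 1) → ℝ) → ℝ} {L δ : ℝ} (hf : PseudoLip f L)
    (hδ : 0 < δ) (y : Fin k → ℝ) (w z : ℝ) :
    |f (Fin.snoc y z) - f (Fin.snoc y w)| ≤
      L * (3 * δ * (1 + ‖y‖ ^ 2 + w ^ 2) + (1 / δ + 1) * ((w - z) * (w - z))) := by
  refine (hf.snoc_right y z w).trans ?_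
  have hL := hf.1
  rw [mul_assoc]
  refine mul_le_mul_of_nonneg_left ?_ hL
  set d := |w - z| with hd
  have h0 : |z - w| = d := abs_sub_comm z w
  have h1 : |z| ≤ |w| + d := by
    have := abs_sub_abs_le_abs_sub z w
    linarith
  have hd0 : 0 ≤ d := abs_nonneg _
  have hd2 : (w - z) * (w - z) = d ^ 2 := by rw [hd, sq_abs, sq]
  rw [h0, hd2]
  set a := 1 + ‖y‖ + |w| with ha
  have ha2 : a ^ 2 ≤ 3 * (1 + ‖y‖ ^ 2 + w ^ 2) := by
    rw [ha, ← sq_abs w]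
    nlinarith [sq_nonneg (1 - ‖y‖), sq_nonneg (1 - |w|), sq_nonneg (‖y‖ - |w|)]
  have h3 : 2 * a * d ≤ δ * a ^ 2 + 1 / δ * d ^ 2 := by
    have : 0 ≤ δ * (a - d / δ) ^ 2 := by positivity
    have e : δ * (a - d / δ) ^ 2 = δ * a ^ 2 - 2 * a * d + 1 / δ * d ^ 2 := by field_simp; ring
    linarith
  have h4 : (1 + 2 * ‖y‖ + |z| + |w|) * d ≤ (2 * a + d) * d := by
    refine mul_le_mul_of_nonneg_right ?_ hd0
    linarith
  have h5 : δ * a ^ 2 ≤ δ * (3 * (1 + ‖y‖ ^ 2 + w ^ 2)) := mul_le_mul_of_nonneg_left ha2 hδ.le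
  nlinarith

variable (β h : ℝ)

/-- The average squared size of the first `k` fields. -/
def fieldSize (k : ℕ) (g : Matrix (Fin N) (Fin N) ℝ) : ℝ := (∑ i, ‖site β h k g i‖ ^ 2) / N

theorem fieldSize_nonneg (k : ℕ) (g : Matrix (Fin N) (Fin N) ℝ) : 0 ≤ fieldSize β h k g :=
  div_nonneg (Finset.sum_nonneg fun _ _ => sq_nonneg _) (Nat.cast_nonneg N)

theorem fieldSize_le (k : ℕ) (g : Matrix (Fin N) (Fin N) ℝ) :
    fieldSize β h k g ≤ ∑ s : Fin k, inner (zeta β h g s) (zeta β h g s) := by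
  simp only [fieldSize, inner]
  rw [← Finset.sum_div, Finset.sum_comm]
  refine div_le_div_of_nonneg_right (Finset.sum_le_sum fun _ _ => ?_) (Nat.cast_nonneg N)
  simpa [site, sq] using norm_le_sqrt_sum (site β h k g _)

theorem lintegral_fieldSize_le (hN : N ≠ 0) (k : ℕ) :
    ∫⁻ g, ENNReal.ofReal (fieldSize β h k g) ∂(matrixLaw N) ≤
      ENNReal.ofReal (∑ s : Fin k, (2 * (s : ℝ) + 8)) := by
  refine (lintegral_mono fun g => ENNReal.ofReal_le_ofReal (fieldSize_le β h k g)).trans ?_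
  simp_rw [ENNReal.ofReal_sum_of_nonneg fun (s : Fin k) _ => inner_self_nonneg (zeta β h _ s)]
  rw [lintegral_finsetSum (f := fun (s : Fin k) (g : Matrix (Fin N) (Fin N) ℝ) =>
      ENNReal.ofReal (inner (zeta β h g s) (zeta β h g s))) _ fun s _ =>
    (measurable_inner (measurable_zeta β h s) (measurable_zeta β h s)).ennreal_ofReal,
    ENNReal.ofReal_sum_of_nonneg fun s _ => by positivity]
  exact Finset.sum_le_sum fun s _ => lintegral_zeta_sq_le β h s hN

theorem measurable_fieldSize (k : ℕ) :
    Measurable fun g : Matrix (Fin N) (Fin N) ℝ => fieldSize β h k g :=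
  (Finset.measurable_sum _ fun i _ => ((measurable_site β h k i).norm).pow_const 2).div_const _

variable {f : (Fin (k + 1) → ℝ) → ℝ} {L δ : ℝ}

/-- With the past fixed there are two errors: replacing ζ_k by the exact Gaussian vector, controlled
by `defect`, and the fluctuation B of an average of independent centered terms, controlled by |B| ≤
δ + B²/δ and its variance. -/
theorem lintegral_average_sub_le (hN : N ≠ 0) (hf : PseudoLip f L) (hδ : 0 < δ)
    (g : Matrix (Fin N) (Fin N) ℝ) :
    ∫⁻ p, ENNReal.ofReal |(∑ i, (f (Fin.snoc (site β h k g i) (zetaRep β h k g p i)) -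
        lastAvg f (site β h k g i))) / N| ∂((gauss (Fin N) 1).prod (gauss (Fin N) 1)) ≤
      ENNReal.ofReal (L * (3 * δ * (2 + fieldSize β h k g) +
        (1 / δ + 1) * ((k + 2) / N + {g' | phi β h g' k = 0}.indicator 1 g)) + δ +
        1 / δ * (12 * L ^ 2 * (1 + fieldSize β h k g) / N)) := by
  have hL := hf.1
  have hN' : (0 : ℝ) < N := by positivity
  set Y := fieldSize β h k g with hY
  set B : (Fin N → ℝ) → ℝ := fun w =>
    (∑ i, (f (Fin.snoc (site β h k g i) (w i)) - lastAvg f (site β h k g i))) / N with hB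
  obtain ⟨hB1, hB2⟩ := integral_sq_average_le (fun i => hf.memLp_snoc (site β h k g i))
    (fun i => hf.variance_le (site β h k g i))
  have hB3 : (∑ i, 12 * L ^ 2 * (1 + ‖site β h k g i‖ ^ 2)) / (N : ℝ) ^ 2 =
      12 * L ^ 2 * (1 + Y) / N := by
    rw [← Finset.mul_sum, Finset.sum_add_distrib, hY, fieldSize]
    simp only [Finset.sum_const, Finset.card_univ, Fintype.card_fin, nsmul_eq_mul, mul_one]
    field_simp
  rw [hB3] at hB2
  have hB1' : Integrable (fun w => B w ^ 2) (gauss (Fin N) 1) := hB1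
  have hB2' : ∫ w, B w ^ 2 ∂(gauss (Fin N) 1) ≤ 12 * L ^ 2 * (1 + Y) / N := hB2
  have hpt : ∀ p : (Fin N → ℝ) × (Fin N → ℝ),
      |(∑ i, (f (Fin.snoc (site β h k g i) (zetaRep β h k g p i)) -
        lastAvg f (site β h k g i))) / N| ≤
      L * (3 * δ * (1 + Y + inner (halfSum p) (halfSum p)) + (1 / δ + 1) * defect β h k g p) + δ +
        1 / δ * B (halfSum p) ^ 2 := by
    intro p
    set w := halfSum p with hw
    set z := zetaRep β h k g p with hz
    have e : (∑ i, (f (Fin.snoc (site β h k g i) (z i)) - lastAvg f (site β h k g i))) / N =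
        (∑ i, (f (Fin.snoc (site β h k g i) (z i)) - f (Fin.snoc (site β h k g i) (w i)))) / N +
          B w := by
      rw [hB, ← add_div, ← Finset.sum_add_distrib]
      congr 1
      exact Finset.sum_congr rfl fun i _ => by ring
    rw [e]
    have h1 : |(∑ i, (f (Fin.snoc (site β h k g i) (z i)) -
        f (Fin.snoc (site β h k g i) (w i)))) / (N : ℝ)| ≤
        L * (3 * δ * (1 + Y + inner w w) + (1 / δ + 1) * inner (w - z) (w - z)) := by
      rw [abs_div, abs_of_pos hN', div_le_iff₀ hN']
      refine (Finset.abs_sum_le_sum_abs _ _).trans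
        ((Finset.sum_le_sum fun i _ => hf.snoc_perturb hδ _ (w i) (z i)).trans (le_of_eq ?_))
      rw [← Finset.mul_sum, Finset.sum_add_distrib, ← Finset.mul_sum, ← Finset.mul_sum,
        Finset.sum_add_distrib, Finset.sum_add_distrib, hY, fieldSize]
      simp only [Finset.sum_const, Finset.card_univ, Fintype.card_fin, nsmul_eq_mul, mul_one,
        inner, sq, Pi.sub_apply]
      field_simp
    have h2 : |B w| ≤ δ + 1 / δ * B w ^ 2 := by
      have : 0 ≤ 1 / δ * (δ - |B w|) ^ 2 := by positivity
      have e : 1 / δ * (δ - |B w|) ^ 2 = δ - 2 * |B w| + 1 / δ * B w ^ 2 := by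
        rw [← sq_abs (B w)]; field_simp; ring
      have := abs_nonneg (B w)
      linarith
    have h3 := inner_halfSum_sub_zetaRep_le β h k g p
    have h4 : L * (3 * δ * (1 + Y + inner w w) + (1 / δ + 1) * inner (w - z) (w - z)) ≤
        L * (3 * δ * (1 + Y + inner w w) + (1 / δ + 1) * defect β h k g p) := by gcongr
    have := abs_add_le ((∑ i, (f (Fin.snoc (site β h k g i) (z i)) -
        f (Fin.snoc (site β h k g i) (w i)))) / (N : ℝ)) (B w)
    linarith
  have i1 : Integrable (fun p : (Fin N → ℝ) × (Fin N → ℝ) => inner (halfSum p) (halfSum p))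
      ((gauss (Fin N) 1).prod (gauss (Fin N) 1)) := integrable_halfSum integrable_inner_self
  have i2 := integrable_defect β h k g
  have i3 : Integrable (fun p => B (halfSum p) ^ 2)
      ((gauss (Fin N) 1).prod (gauss (Fin N) 1)) := integrable_halfSum hB1'
  have i4 : Integrable (fun p : (Fin N → ℝ) × (Fin N → ℝ) =>
      1 + Y + inner (halfSum p) (halfSum p)) ((gauss (Fin N) 1).prod (gauss (Fin N) 1)) :=
    (integrable_const _).add i1
  have i5 : Integrable (fun p : (Fin N → ℝ) × (Fin N → ℝ) =>
      3 * δ * (1 + Y + inner (halfSum p) (halfSum p)) + (1 / δ + 1) * defect β h k g p)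
      ((gauss (Fin N) 1).prod (gauss (Fin N) 1)) := (i4.const_mul _).add (i2.const_mul _)
  have i6 : Integrable (fun p : (Fin N → ℝ) × (Fin N → ℝ) =>
      L * (3 * δ * (1 + Y + inner (halfSum p) (halfSum p)) + (1 / δ + 1) * defect β h k g p) + δ)
      ((gauss (Fin N) 1).prod (gauss (Fin N) 1)) := (i5.const_mul _).add (integrable_const _)
  have i7 : Integrable (fun p : (Fin N → ℝ) × (Fin N → ℝ) =>
      L * (3 * δ * (1 + Y + inner (halfSum p) (halfSum p)) + (1 / δ + 1) * defect β h k g p) + δ +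
        1 / δ * B (halfSum p) ^ 2)
      ((gauss (Fin N) 1).prod (gauss (Fin N) 1)) := i6.add (i3.const_mul _)
  refine (lintegral_mono fun p => ENNReal.ofReal_le_ofReal (hpt p)).trans ?_
  rw [← ofReal_integral_eq_lintegral_ofReal i7
    (ae_of_all _ fun p => (abs_nonneg _).trans (hpt p))]
  refine ENNReal.ofReal_le_ofReal ?_
  rw [integral_add i6 (i3.const_mul _), integral_add (i5.const_mul _) (integrable_const _),
    integral_const_mul, integral_add (i4.const_mul _) (i2.const_mul _), integral_const_mul,
    integral_const_mul, integral_const_mul, integral_add (integrable_const _) i1,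
    integral_halfSum integrable_inner_self, integral_inner_self hN,
    integral_halfSum hB1']
  simp only [integral_const, probReal_univ, one_smul]
  have h1 := integral_defect_le β h k g hN
  have e1 : 1 + Y + 1 = 2 + Y := by ring
  rw [e1]
  gcongr

theorem lintegral_emp_sub_le (hN : N ≠ 0) (hf : PseudoLip f L) (hδ : 0 < δ) :
    ∫⁻ g, ENNReal.ofReal |emp β h (k + 1) f ⟨N, g⟩ - emp β h k (lastAvg f) ⟨N, g⟩| ∂(matrixLaw N) ≤
      ENNReal.ofReal ((L * (6 * δ + (1 / δ + 1) * ((k + 2) / N)) + δ + 12 * L ^ 2 / δ / N) +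
        (3 * L * δ + 12 * L ^ 2 / δ / N) * ∑ s : Fin k, (2 * (s : ℝ) + 8)) +
      ENNReal.ofReal (L * (1 / δ + 1)) * matrixLaw N {g | phi β h g k = 0} := by
  have hL := hf.1
  have hN' : (0 : ℝ) < N := by positivity
  have e1 : ∀ g : Matrix (Fin N) (Fin N) ℝ,
      emp β h (k + 1) f ⟨N, g⟩ - emp β h k (lastAvg f) ⟨N, g⟩ =
      (∑ i, (f (Fin.snoc (site β h k g i) (zeta β h g k i)) -
        lastAvg f (site β h k g i))) / N := fun g => by
    simp only [emp, site_succ]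
    rw [← sub_div, ← Finset.sum_sub_distrib]
  rw [lintegral_zeta_step β h k hN (F := fun g => ENNReal.ofReal
    |emp β h (k + 1) f ⟨N, g⟩ - emp β h k (lastAvg f) ⟨N, g⟩|) (H := fun g z => ENNReal.ofReal
    |(∑ i, (f (Fin.snoc (site β h k g i) (z i)) - lastAvg f (site β h k g i))) / N|)
    (((measurable_emp β h hf.continuous N).sub
      (measurable_emp β h hf.lastAvg.continuous N)).abs.ennreal_ofReal) (fun g => ?_)
    fun g x => ?_]
  rotate_left
  · refine Measurable.ennreal_ofReal (Measurable.abs (Measurable.div_const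
      (Finset.measurable_sum _ fun i _ => Measurable.sub_const ?_ _) _))
    exact (hf.continuous.comp (continuous_snoc _)).measurable.comp (measurable_pi_apply i)
  · have hs : ∀ i, site β h k (resample β h k g x) i = site β h k g i := fun i =>
      funext fun s => by rw [site, site, zeta_resample β h g x s.2]
    rw [e1]
    simp_rw [hs]
  refine (lintegral_mono fun g => lintegral_average_sub_le β h hN hf hδ g).trans ?_
  have hA : MeasurableSet {g : Matrix (Fin N) (Fin N) ℝ | phi β h g k = 0} :=
    measurable_phi β h k (measurableSet_singleton 0)
  set a := L * (6 * δ + (1 / δ + 1) * ((k + 2) / N)) + δ + 12 * L ^ 2 / δ / N with ha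
  set b := 3 * L * δ + 12 * L ^ 2 / δ / N with hb
  set c := L * (1 / δ + 1) with hc
  have ha0 : 0 ≤ a := by positivity
  have hb0 : 0 ≤ b := by positivity
  have hc0 : 0 ≤ c := by positivity
  have e2 : ∀ g : Matrix (Fin N) (Fin N) ℝ, ENNReal.ofReal (L * (3 * δ * (2 + fieldSize β h k g) +
        (1 / δ + 1) * ((k + 2) / N + {g' | phi β h g' k = 0}.indicator 1 g)) + δ +
        1 / δ * (12 * L ^ 2 * (1 + fieldSize β h k g) / N)) =
      ENNReal.ofReal a + ENNReal.ofReal b * ENNReal.ofReal (fieldSize β h k g) +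
        ENNReal.ofReal c * {g' | phi β h g' k = 0}.indicator 1 g := fun g => by
    have hY := fieldSize_nonneg β h k g
    have hind : ENNReal.ofReal ({g' | phi β h g' k = 0}.indicator 1 g) =
        {g' | phi β h g' k = 0}.indicator 1 g := by
      by_cases hg : phi β h g k = 0 <;> simp [hg]
    have hind0 : (0 : ℝ) ≤ {g' | phi β h g' k = 0}.indicator 1 g :=
      Set.indicator_nonneg (fun _ _ => zero_le_one) g
    rw [← hind, ← ENNReal.ofReal_mul hb0, ← ENNReal.ofReal_mul hc0,
      ← ENNReal.ofReal_add ha0 (mul_nonneg hb0 hY), ← ENNReal.ofReal_add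
        (add_nonneg ha0 (mul_nonneg hb0 hY)) (mul_nonneg hc0 hind0)]
    congr 1
    rw [ha, hb, hc]
    field_simp
    ring
  simp_rw [e2]
  have m1 : Measurable fun g : Matrix (Fin N) (Fin N) ℝ =>
      ENNReal.ofReal a + ENNReal.ofReal b * ENNReal.ofReal (fieldSize β h k g) :=
    measurable_const.add ((measurable_fieldSize β h k).ennreal_ofReal.const_mul _)
  rw [lintegral_add_left m1,
    lintegral_add_left measurable_const,
    lintegral_const_mul _ (measurable_fieldSize β h k).ennreal_ofReal,
    lintegral_const_mul _ (measurable_one.indicator hA), lintegral_const, measure_univ, mul_one,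
    lintegral_indicator_one hA]
  gcongr
  rw [ENNReal.ofReal_add ha0 (mul_nonneg hb0 (Finset.sum_nonneg fun s _ => by positivity)),
    ENNReal.ofReal_mul hb0]
  gcongr
  exact lintegral_fieldSize_le β h hN k

theorem tendsto_emp_sub (hf : PseudoLip f L)
    (hphi : Tendsto (fun N => matrixLaw N {g | phi β h g k = 0}) atTop (𝓝 0)) :
    Tendsto (fun z => emp β h (k + 1) f z - emp β h k (lastAvg f) z) hp (𝓝 0) := by
  have hL := hf.1
  refine tendsto_hp_of_lintegral (fun N => (measurable_emp β h hf.continuous N).sub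
    (measurable_emp β h hf.lastAvg.continuous N)) (ENNReal.tendsto_nhds_zero.2 fun ε hε => ?_)
  rcases eq_or_ne ε ⊤ with rfl | hε'
  · simp
  set e := ε.toReal
  have he : 0 < e := ENNReal.toReal_pos hε.ne' hε'
  set C := ∑ s : Fin k, (2 * (s : ℝ) + 8) with hC
  have hC0 : 0 ≤ C := Finset.sum_nonneg fun s _ => by positivity
  -- D collects the coefficients of δ that survive N → ∞; δ is fixed before N, so that their
  -- contribution is e/2.
  set D := 6 * L + 1 + 3 * L * C with hD
  have hD0 : 0 < D := by positivity
  set δ := e / (2 * D) with hδ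
  have hδ0 : 0 < δ := by positivity
  have hDδ : D * δ = e / 2 := by rw [hδ]; field_simp
  have hlim : Tendsto (fun N : ℕ =>
      ENNReal.ofReal ((L * (6 * δ + (1 / δ + 1) * ((k + 2) / N)) + δ + 12 * L ^ 2 / δ / N) +
        (3 * L * δ + 12 * L ^ 2 / δ / N) * C) +
      ENNReal.ofReal (L * (1 / δ + 1)) * matrixLaw N {g | phi β h g k = 0}) atTop
      (𝓝 (ENNReal.ofReal (e / 2) + ENNReal.ofReal (L * (1 / δ + 1)) * 0)) := by
    refine Tendsto.add (ENNReal.tendsto_ofReal ?_)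
      (ENNReal.Tendsto.const_mul hphi (Or.inr ENNReal.ofReal_ne_top))
    have h1 : ∀ a : ℝ, Tendsto (fun N : ℕ => a / (N : ℝ)) atTop (𝓝 0) := fun a =>
      tendsto_const_div_atTop_nhds_zero_nat a
    have h2 := (((((h1 (k + 2)).const_mul (1 / δ + 1)).const_add (6 * δ)).const_mul L).add_const
      δ |>.add (h1 (12 * L ^ 2 / δ))).add (((h1 (12 * L ^ 2 / δ)).const_add (3 * L * δ)).mul_const C)
    convert h2 using 2
    rw [← hDδ, hD]
    ring
  rw [mul_zero, add_zero] at hlim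
  have hlt : ENNReal.ofReal (e / 2) < ε := by
    rw [ENNReal.ofReal_lt_iff_lt_toReal (by positivity) hε']
    exact half_lt_self he
  filter_upwards [hlim.eventually_lt_const hlt, eventually_ne_atTop 0] with N h1 hN
  exact (lintegral_emp_sub_le β h hN hf hδ0).trans h1.le

end LawOfLargeNumbers

/-- The law of large numbers for pseudo-Lipschitz functions of the fields. -/
theorem tendsto_emp (β h : ℝ) {k : ℕ} {f : (Fin k → ℝ) → ℝ} {L : ℝ} (hf : PseudoLip f L)
    (hphi : ∀ s < k, Tendsto (fun N => matrixLaw N {g | phi β h g s = 0}) atTop (𝓝 0)) :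
    Tendsto (emp β h k f) hp (𝓝 (∫ x, f x ∂(gauss (Fin k) 1))) := by
  induction k generalizing L with
  | zero =>
    have e1 : ∀ x, f x = f 0 := fun x => congrArg f (Subsingleton.elim _ _)
    have e2 : ∫ x, f x ∂(gauss (Fin 0) 1) = f 0 := by simp_rw [e1]; simp
    rw [e2]
    refine tendsto_const_nhds.congr' ?_
    filter_upwards [eventually_hp_ne_zero] with z hz
    have : (z.1 : ℝ) ≠ 0 := by positivity
    simp only [emp]
    simp_rw [e1]
    simp [this]
  | succ k ih =>
    -- The most recent field is replaced by an independent Gaussian variable and integrated out,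
    -- which leaves a test function of one field fewer.
    have h1 := ih hf.lastAvg fun s hs => hphi s (by omega)
    have h2 := (tendsto_emp_sub β h hf (hphi k (by omega))).add h1
    rw [hf.integral_lastAvg, zero_add] at h2
    simpa using h2

/-! ### Limits of the overlaps along the iteration -/

section Limits

variable (β h : ℝ)

/-- The coefficient of `ζ_t` in the field that defines `mean l`. -/
def coef (l t : ℕ) : ℝ :=
  if t < l then gammaSeq β h t else if t = l then √(overlap β h - gammaSum β h l) else 0

theorem coef_of_lt {l t : ℕ} (ht : t < l) : coef β h l t = gammaSeq β h t := if_pos ht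

theorem coef_self (l : ℕ) : coef β h l l = √(overlap β h - gammaSum β h l) := by
  rw [coef, if_neg (lt_irrefl l), if_pos rfl]

theorem coef_of_gt {l t : ℕ} (ht : l < t) : coef β h l t = 0 := by
  rw [coef, if_neg (by omega), if_neg (by omega)]

theorem sum_coef_mul {l n : ℕ} (hln : l < n) (F : ℕ → ℝ) :
    ∑ t : Fin n, coef β h l t * F t =
      ∑ t ∈ Finset.range l, gammaSeq β h t * F t + √(overlap β h - gammaSum β h l) * F l := by
  rw [Fin.sum_univ_eq_sum_range (fun t => coef β h l t * F t) n,
    ← Finset.sum_subset (Finset.range_subset_range.2 (Nat.succ_le_of_lt hln)),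
    Finset.sum_range_succ, coef_self]
  · congr 1
    exact Finset.sum_congr rfl fun t ht => by rw [coef_of_lt β h (Finset.mem_range.1 ht)]
  · intro t _ ht
    rw [coef_of_gt β h (by simpa using ht), zero_mul]

theorem mean_apply {N : ℕ} (g : Matrix (Fin N) (Fin N) ℝ) {l n : ℕ} (hln : l < n) (i : Fin N) :
    mean β h g l i = Real.tanh (h + β * ∑ t : Fin n, coef β h l t * site β h n g i t) := by
  rw [mean, nextMean]
  simp only [site]
  rw [sum_coef_mul β h hln (fun t => zeta β h g t i), gammaSum_eq,
    ← Fin.sum_univ_eq_sum_range (fun t => gammaSeq β h t * zeta β h g t i) l]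
  congr 1
  simp only [Fin.val_last, Fin.val_castSucc]
  ring

variable {β h}

theorem lipschitz_linearForm {k : ℕ} (a : Fin k → ℝ) (x y : Fin k → ℝ) :
    |∑ s, a s * x s - ∑ s, a s * y s| ≤ (∑ s, |a s|) * ‖x - y‖ := by
  rw [← Finset.sum_sub_distrib, Finset.sum_mul]
  refine (Finset.abs_sum_le_sum_abs _ _).trans (Finset.sum_le_sum fun s _ => ?_)
  rw [← mul_sub, abs_mul]
  exact mul_le_mul_of_nonneg_left (norm_le_pi_norm (x - y) s) (abs_nonneg _)

theorem lipschitz_tanh_linearForm {k : ℕ} (a : Fin k → ℝ) (x y : Fin k → ℝ) :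
    |Real.tanh (h + β * ∑ s, a s * x s) - Real.tanh (h + β * ∑ s, a s * y s)| ≤
      (|β| * ∑ s, |a s|) * ‖x - y‖ := by
  refine (lipschitz_tanh _ _).trans ?_
  rw [add_sub_add_left_eq_sub, ← mul_sub, abs_mul, mul_assoc]
  exact mul_le_mul_of_nonneg_left (lipschitz_linearForm a x y) (abs_nonneg _)

theorem lipschitz_log_cosh_linearForm {k : ℕ} (a : Fin k → ℝ) (x y : Fin k → ℝ) :
    |Real.log (Real.cosh (h + β * ∑ s, a s * x s)) -
      Real.log (Real.cosh (h + β * ∑ s, a s * y s))| ≤ (|β| * ∑ s, |a s|) * ‖x - y‖ := by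
  refine (lipschitz_log_cosh _ _).trans ?_
  rw [add_sub_add_left_eq_sub, ← mul_sub, abs_mul, mul_assoc]
  exact mul_le_mul_of_nonneg_left (lipschitz_linearForm a x y) (abs_nonneg _)

theorem lipschitz_coord {k : ℕ} (s : Fin k) (x y : Fin k → ℝ) : |x s - y s| ≤ 1 * ‖x - y‖ := by
  rw [one_mul]; exact norm_le_pi_norm (x - y) s

theorem lipschitz_one {k : ℕ} (x y : Fin k → ℝ) :
    |(fun _ : Fin k → ℝ => (1 : ℝ)) x - (fun _ => 1) y| ≤ 0 * ‖x - y‖ := by simp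

/-- The last coefficient is chosen to fill the variance up to q: Γ² + (q - Γ²) = q. -/
theorem sum_coef_sq (hβ : 0 < β) (hβ1 : β ^ 2 < 1) (hh : 0 < h) {l n : ℕ} (hln : l < n) :
    ∑ t : Fin n, coef β h l t ^ 2 = overlap β h := by
  simp only [sq]
  rw [sum_coef_mul β h hln (fun t => coef β h l t), coef_self, Real.mul_self_sqrt
    (sub_nonneg.2 (gammaSum_lt hβ hβ1 hh l).le)]
  have : ∑ t ∈ Finset.range l, gammaSeq β h t * coef β h l t = gammaSum β h l :=
    Finset.sum_congr rfl fun t ht => by rw [coef_of_lt β h (Finset.mem_range.1 ht), sq]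
  rw [this]
  ring

/-- A later field carries γ_l where the field of index l carries √(q - Γ_l²), so the covariance is
Γ_l² + γ_l √(q - Γ_l²). The γ's are defined to make this equal to ρ, whatever the later index. -/
theorem sum_coef_mul_coef (hβ : 0 < β) (hβ1 : β ^ 2 < 1) (hh : 0 < h) {l j n : ℕ} (hlj : l < j) (hln : l < n) :
    ∑ t : Fin n, coef β h l t * coef β h j t = rhoSeq β h l := by
  rw [sum_coef_mul β h hln (fun t => coef β h j t), coef_of_lt β h hlj, ← gammaSum_add hβ hβ1 hh l,
    mul_comm (√_)]
  congr 1
  exact Finset.sum_congr rfl fun t ht => by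
    rw [coef_of_lt β h ((Finset.mem_range.1 ht).trans hlj), sq]

/-- The first `n` directions do not vanish, with probability tending to one. -/
def NonDegenerate (β h : ℝ) (n : ℕ) : Prop :=
  ∀ s < n, Tendsto (fun N => matrixLaw N {g | phi β h g s = 0}) atTop (𝓝 0)

theorem tendsto_inner_of_lipschitz {n : ℕ} (hn : NonDegenerate β h n) {F G : (Fin n → ℝ) → ℝ}
    {A B : ℝ} (hA : 0 ≤ A) (hB : 0 ≤ B) (hF : ∀ x y, |F x - F y| ≤ A * ‖x - y‖)
    (hG : ∀ x y, |G x - G y| ≤ B * ‖x - y‖) :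
    Tendsto (fun z : Σ N : ℕ, Matrix (Fin N) (Fin N) ℝ =>
      inner (fun i => F (site β h n z.2 i)) (fun i => G (site β h n z.2 i))) hp
      (𝓝 (∫ x, F x * G x ∂(gauss (Fin n) 1))) := by
  have h1 := tendsto_emp β h (PseudoLip.mul hA hB hF hG) hn
  refine h1.congr fun z => ?_
  simp only [emp, inner]

theorem lipConst_nonneg {k : ℕ} (a : Fin k → ℝ) : 0 ≤ |β| * ∑ s, |a s| :=
  mul_nonneg (abs_nonneg _) (Finset.sum_nonneg fun _ _ => abs_nonneg _)

theorem mean_eq_site {N : ℕ} (g : Matrix (Fin N) (Fin N) ℝ) {l n : ℕ} (hln : l < n) :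
    mean β h g l = fun i => (fun x : Fin n → ℝ => Real.tanh (h + β * ∑ t : Fin n, coef β h l t * x t))
      (site β h n g i) := funext fun i => mean_apply β h g hln i

/-- In the limit the two fields have variance q and covariance `rhoSeq β h l`; one application of ψ
gives the next term. -/
theorem tendsto_inner_mean_of_lt (hβ : 0 < β) (hβ1 : β ^ 2 < 1) (hh : 0 < h) {l j n : ℕ} (hn : NonDegenerate β h n) (hlj : l < j)
    (hjn : j < n) : Tendsto (fun z : Σ N : ℕ, Matrix (Fin N) (Fin N) ℝ =>
      inner (mean β h z.2 j) (mean β h z.2 l)) hp (𝓝 (rhoSeq β h (l + 1))) := by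
  have h1 := tendsto_inner_of_lipschitz hn (lipConst_nonneg _) (lipConst_nonneg _)
    (lipschitz_tanh_linearForm (β := β) (h := h) fun t : Fin n => coef β h l t)
    (lipschitz_tanh_linearForm (β := β) (h := h) fun t : Fin n => coef β h j t)
  have hr := rhoSeq_mem hβ hβ1 hh l
  rw [integral_tanh_mul_tanh β h (sum_coef_sq hβ hβ1 hh (hlj.trans hjn))
    (sum_coef_sq hβ hβ1 hh hjn) (sum_coef_mul_coef hβ hβ1 hh hlj (hlj.trans hjn)) hr.1.le
    hr.2.le] at h1
  simp_rw [inner_comm (mean β h _ j), mean_eq_site (β := β) (h := h) _ (hlj.trans hjn),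
    mean_eq_site (β := β) (h := h) _ hjn]
  exact h1

theorem tendsto_inner_mean_self (hβ : 0 < β) (hβ1 : β ^ 2 < 1) (hh : 0 < h) {l n : ℕ} (hn : NonDegenerate β h n) (hln : l < n) :
    Tendsto (fun z : Σ N : ℕ, Matrix (Fin N) (Fin N) ℝ =>
      inner (mean β h z.2 l) (mean β h z.2 l)) hp (𝓝 (overlap β h)) := by
  have h1 := tendsto_inner_of_lipschitz hn (lipConst_nonneg _) (lipConst_nonneg _)
    (lipschitz_tanh_linearForm (β := β) (h := h) fun t : Fin n => coef β h l t)
    (lipschitz_tanh_linearForm (β := β) (h := h) fun t : Fin n => coef β h l t)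
  simp_rw [← sq] at h1
  rw [integral_tanh_sq_linearForm β h (sum_coef_sq hβ hβ1 hh hln)] at h1
  simp_rw [mean_eq_site (β := β) (h := h) _ hln]
  exact h1

theorem tendsto_inner_mean_phi_zero (hβ : 0 < β) (hβ1 : β ^ 2 < 1) (hh : 0 < h) {l n : ℕ} (hn : NonDegenerate β h n) (hln : l < n) :
    Tendsto (fun z : Σ N : ℕ, Matrix (Fin N) (Fin N) ℝ =>
      inner (mean β h z.2 l) (phi β h z.2 0)) hp (𝓝 (gammaSeq β h 0)) := by
  have h1 := tendsto_inner_of_lipschitz hn (lipConst_nonneg _) le_rfl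
    (lipschitz_tanh_linearForm (β := β) (h := h) fun t : Fin n => coef β h l t) lipschitz_one
  simp_rw [mul_one] at h1
  rw [integral_tanh_linearForm β h (sum_coef_sq hβ hβ1 hh hln)] at h1
  simp_rw [phi_zero, gammaSeq_zero, mean_eq_site (β := β) (h := h) _ hln]
  exact h1

/-! ### Gram–Schmidt coefficients and nondegeneracy. -/

theorem inner_residual {N : ℕ} (g : Matrix (Fin N) (Fin N) ℝ) (s : ℕ) (m : Fin N → ℝ) :
    inner m (mean β h g s - ∑ t : Fin (s + 1), inner (mean β h g s) (phi β h g t) • phi β h g t) =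
      inner m (mean β h g s) -
        ∑ t : Fin (s + 1), inner (mean β h g s) (phi β h g t) * inner m (phi β h g t) := by
  rw [inner_sub_right, inner_sum_right]
  simp only [inner_smul_right]

theorem nrm_residual_sq {N : ℕ} (g : Matrix (Fin N) (Fin N) ℝ) (s : ℕ) :
    nrm (mean β h g s - ∑ t : Fin (s + 1),
      inner (mean β h g s) (phi β h g t) • phi β h g t) ^ 2 =
      inner (mean β h g s) (mean β h g s) -
        ∑ t : Fin (s + 1), inner (mean β h g s) (phi β h g t) ^ 2 := by
  set r := mean β h g s - ∑ t : Fin (s + 1), inner (mean β h g s) (phi β h g t) • phi β h g t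
  have h1 : ∀ t : Fin (s + 1), inner r (phi β h g t) = 0 := fun t => by
    have h2 := inner_phi_of_lt β h g t.2
    rw [phi_succ, inner_smul_right, inner_comm] at h2
    -- If the residual has norm zero, orthogonality cannot be read off from φ and follows from
    -- Cauchy–Schwarz instead.
    rcases mul_eq_zero.1 h2 with h3 | h3
    · have h4 : inner r r = 0 := by rw [← nrm_sq, inv_eq_zero.1 h3]; norm_num
      have h5 := abs_inner_le r (phi β h g t)
      rw [inv_eq_zero.1 h3, zero_mul] at h5
      exact abs_nonpos_iff.1 h5
    · exact h3
  have h6 := inner_residual (β := β) (h := h) g s r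
  rw [nrm_sq]
  change inner r r = _ at h6
  rw [h6]
  simp only [h1, mul_zero, Finset.sum_const_zero, sub_zero]
  rw [inner_comm, inner_residual]
  simp only [sq]

theorem tendsto_nrm_residual (hβ : 0 < β) (hβ1 : β ^ 2 < 1) (hh : 0 < h) {s n : ℕ} (hn : NonDegenerate β h n) (hsn : s < n)
    (hphi : ∀ t ≤ s, Tendsto (fun z : Σ N : ℕ, Matrix (Fin N) (Fin N) ℝ =>
      inner (mean β h z.2 s) (phi β h z.2 t)) hp (𝓝 (gammaSeq β h t))) :
    Tendsto (fun z : Σ N : ℕ, Matrix (Fin N) (Fin N) ℝ => nrm (mean β h z.2 s -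
      ∑ t : Fin (s + 1), inner (mean β h z.2 s) (phi β h z.2 t) • phi β h z.2 t)) hp
      (𝓝 (√(overlap β h - gammaSum β h (s + 1)))) := by
  have h1 := ((tendsto_inner_mean_self hβ hβ1 hh hn hsn).sub (tendsto_finsetSum Finset.univ
    fun t _ => (hphi (t : Fin (s + 1)) (Nat.le_of_lt_succ t.2)).pow 2)).sqrt
  rw [gammaSum_eq] at h1
  refine h1.congr fun z => ?_
  rw [← nrm_residual_sq]
  exact Real.sqrt_sq (Real.sqrt_nonneg _)

/-- Induction on s along Gram–Schmidt: the numerator tends to ρ - Γ² and the norm to √(q - Γ²),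
which is the recursion defining γ. The limit does not depend on l because the overlaps of the means
do not. -/
theorem tendsto_inner_mean_phi (hβ : 0 < β) (hβ1 : β ^ 2 < 1) (hh : 0 < h) {n : ℕ} (hn : NonDegenerate β h n) {l s : ℕ} (hsl : s ≤ l)
    (hln : l < n) : Tendsto (fun z : Σ N : ℕ, Matrix (Fin N) (Fin N) ℝ =>
      inner (mean β h z.2 l) (phi β h z.2 s)) hp (𝓝 (gammaSeq β h s)) := by
  induction s using Nat.strong_induction_on generalizing l with
  | _ s ih =>
    cases s with
    | zero => exact tendsto_inner_mean_phi_zero hβ hβ1 hh hn hln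
    | succ s =>
      have hs : ∀ t ≤ s, Tendsto (fun z : Σ N : ℕ, Matrix (Fin N) (Fin N) ℝ =>
          inner (mean β h z.2 s) (phi β h z.2 t)) hp (𝓝 (gammaSeq β h t)) := fun t ht =>
        ih t (by omega) ht (by omega)
      have hl : ∀ t ≤ s, Tendsto (fun z : Σ N : ℕ, Matrix (Fin N) (Fin N) ℝ =>
          inner (mean β h z.2 l) (phi β h z.2 t)) hp (𝓝 (gammaSeq β h t)) := fun t ht =>
        ih t (by omega) (by omega) hln
      have h1 := tendsto_nrm_residual hβ hβ1 hh hn (by omega) hs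
      have hpos := Real.sqrt_pos.2 (sub_pos.2 (gammaSum_lt hβ hβ1 hh (s + 1)))
      have h2 := (tendsto_inner_mean_of_lt hβ hβ1 hh hn (Nat.lt_of_succ_le hsl) hln).sub
        (tendsto_finsetSum Finset.univ fun (t : Fin (s + 1)) _ =>
          (hs t (Nat.le_of_lt_succ t.2)).mul (hl t (Nat.le_of_lt_succ t.2)))
      have h3 := (h1.inv₀ hpos.ne').mul h2
      have e : (√(overlap β h - gammaSum β h (s + 1)))⁻¹ * (rhoSeq β h (s + 1) -
          ∑ t : Fin (s + 1), gammaSeq β h t * gammaSeq β h t) = gammaSeq β h (s + 1) := by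
        rw [gammaSeq_succ, ← gammaSum_eq, div_eq_inv_mul]
        simp only [sq]
      rw [e] at h3
      refine h3.congr fun z => ?_
      rw [phi_succ, inner_smul_right, inner_residual]

/-- The law of large numbers for the first n fields needs only the first n directions to be nonzero;
it shows that the next residual has norm close to √(q - Γ²) > 0, and the induction closes. -/
theorem nonDegenerate (hβ : 0 < β) (hβ1 : β ^ 2 < 1) (hh : 0 < h) (n : ℕ) : NonDegenerate β h n := by
  induction n with
  | zero => intro s hs; omega
  | succ n ih =>
    intro s hs
    rcases Nat.lt_succ_iff_lt_or_eq.1 hs with h1 | rfl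
    · exact ih s h1
    cases s with
    | zero =>
      have : ∀ᶠ z : Σ N : ℕ, Matrix (Fin N) (Fin N) ℝ in hp, ¬ phi β h z.2 0 = 0 := by
        filter_upwards [eventually_hp_ne_zero] with z hz h0
        rw [phi_zero] at h0
        exact one_ne_zero (congrFun h0 ⟨0, Nat.pos_of_ne_zero hz⟩)
      simpa [eventually_hp_iff] using this
    | succ s =>
      have h1 := tendsto_nrm_residual hβ hβ1 hh ih (Nat.lt_succ_self s) fun t ht =>
        tendsto_inner_mean_phi hβ hβ1 hh ih ht (Nat.lt_succ_self s)
      have hpos := Real.sqrt_pos.2 (sub_pos.2 (gammaSum_lt hβ hβ1 hh (s + 1)))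
      have : ∀ᶠ z : Σ N : ℕ, Matrix (Fin N) (Fin N) ℝ in hp, ¬ phi β h z.2 (s + 1) = 0 := by
        filter_upwards [h1.eventually_const_lt hpos] with z hz h0
        rw [phi_succ] at h0
        rcases smul_eq_zero.1 h0 with h2 | h2
        · exact hz.ne' (inv_eq_zero.1 h2)
        · rw [h2] at hz
          simp [nrm] at hz
      simpa [eventually_hp_iff] using this

theorem tendsto_inner_zeta_mean (hβ : 0 < β) (hβ1 : β ^ 2 < 1) (hh : 0 < h) (K : ℕ) (s : Fin (K + 1)) :
    Tendsto (fun z : Σ N : ℕ, Matrix (Fin N) (Fin N) ℝ =>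
      inner (zeta β h z.2 s) (mean β h z.2 K)) hp
      (𝓝 (β * coef β h K s * (1 - overlap β h))) := by
  have h1 := tendsto_inner_of_lipschitz (nonDegenerate hβ hβ1 hh (K + 1)) zero_le_one
    (lipConst_nonneg _) (lipschitz_coord s)
    (lipschitz_tanh_linearForm (β := β) (h := h) fun t : Fin (K + 1) => coef β h K t)
  rw [integral_coord_mul_tanh (overlap_pos β hh)
    (sum_coef_sq hβ hβ1 hh (Nat.lt_succ_self K))] at h1
  simp_rw [mean_eq_site (β := β) (h := h) _ (Nat.lt_succ_self K)]
  exact h1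

theorem integral_coord_mul_coord {n : ℕ} (s t : Fin n) :
    ∫ x : Fin n → ℝ, x s * x t ∂(gauss (Fin n) 1) = if s = t then 1 else 0 := by
  have key : ∀ c : Fin n → ℝ, ∫ x, (∑ i, c i * x i) ^ 2 ∂(gauss (Fin n) 1) = ∑ i, c i ^ 2 :=
    fun c => by rw [integral_sq_linearForm_gauss, NNReal.coe_one, one_mul]
  rcases eq_or_ne s t with rfl | hst
  · have h1 := key (Pi.single s 1)
    simpa [Pi.single_apply, sq] using h1
  · have h1 := key (Pi.single s 1 + Pi.single t 1)
    have h2 := key (Pi.single s 1 - Pi.single t 1)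
    have i1 := integrable_sq_linearForm_gauss 1 (Pi.single s 1 + Pi.single t 1 : Fin n → ℝ)
    have i2 := integrable_sq_linearForm_gauss 1 (Pi.single s 1 - Pi.single t 1 : Fin n → ℝ)
    have e : ∀ x : Fin n → ℝ, x s * x t =
        ((∑ i, (Pi.single s 1 + Pi.single t 1 : Fin n → ℝ) i * x i) ^ 2 -
        (∑ i, (Pi.single s 1 - Pi.single t 1 : Fin n → ℝ) i * x i) ^ 2) / 4 := fun x => by
      simp [Pi.single_apply, add_mul, sub_mul, Finset.sum_add_distrib]
      ring
    simp_rw [e]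
    rw [integral_div, integral_sub i1 i2, h1, h2, if_neg hst, ← Finset.sum_sub_distrib,
      Finset.sum_eq_zero, zero_div]
    intro i _
    simp only [Pi.add_apply, Pi.sub_apply, Pi.single_apply]
    split_ifs with h3 h4
    · exact absurd (h3.symm.trans h4) hst
    · norm_num
    · norm_num
    · norm_num

theorem tendsto_inner_zeta_zeta (hβ : 0 < β) (hβ1 : β ^ 2 < 1) (hh : 0 < h) {n : ℕ} (s t : Fin n) :
    Tendsto (fun z : Σ N : ℕ, Matrix (Fin N) (Fin N) ℝ =>
      inner (zeta β h z.2 s) (zeta β h z.2 t)) hp (𝓝 (if s = t then 1 else 0)) := by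
  have h1 := tendsto_inner_of_lipschitz (nonDegenerate hβ hβ1 hh n) zero_le_one zero_le_one
    (lipschitz_coord s) (lipschitz_coord t)
  rw [integral_coord_mul_coord] at h1
  exact h1

theorem tendsto_log_cosh (hβ : 0 < β) (hβ1 : β ^ 2 < 1) (hh : 0 < h) (K : ℕ) :
    Tendsto (fun z : Σ N : ℕ, Matrix (Fin N) (Fin N) ℝ =>
      (∑ i, Real.log (Real.cosh (effField β h (fun s : Fin (K + 1) => zeta β h z.2 s)
        (fun s => coef β h K s) i))) / z.1) hp (𝓝 (logCosh β h (overlap β h))) := by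
  have h1 := tendsto_inner_of_lipschitz (nonDegenerate hβ hβ1 hh (K + 1)) (lipConst_nonneg _) le_rfl
    (lipschitz_log_cosh_linearForm (β := β) (h := h) fun t : Fin (K + 1) => coef β h K t)
    lipschitz_one
  simp_rw [mul_one] at h1
  rw [integral_log_cosh_linearForm β h (sum_coef_sq hβ hβ1 hh (Nat.lt_succ_self K))] at h1
  refine h1.congr fun z => ?_
  simp only [inner, mul_one]
  rfl

theorem tendsto_diagTerm (k : ℕ) :
    Tendsto (fun z : Σ N : ℕ, Matrix (Fin N) (Fin N) ℝ => diagTerm β h k z.2) hp (𝓝 0) := by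
  have h1 : Tendsto (fun z : Σ N : ℕ, Matrix (Fin N) (Fin N) ℝ => diagTerm β h k z.2 ^ 2) hp
      (𝓝 0) := by
    refine tendsto_hp_of_lintegral (fun N => (measurable_inner (measurable_phi β h k)
      (measurable_xi β h k)).pow_const 2) ?_
    have h2 : Tendsto (fun N : ℕ => ENNReal.ofReal (1 / (N : ℝ))) atTop (𝓝 0) := by
      have := ENNReal.tendsto_ofReal (tendsto_const_div_atTop_nhds_zero_nat (1 : ℝ))
      simpa using this
    refine tendsto_of_tendsto_of_tendsto_of_le_of_le' tendsto_const_nhds h2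
      (Eventually.of_forall fun _ => zero_le) ((eventually_ne_atTop 0).mono fun N hN => ?_)
    simp only [abs_of_nonneg (sq_nonneg (diagTerm β h k _))]
    exact lintegral_diagTerm_sq_le β h k hN
  have h3 := h1.sqrt
  rw [Real.sqrt_zero] at h3
  refine (tendsto_zero_iff_abs_tendsto_zero _).2 (h3.congr fun z => ?_)
  rw [Real.sqrt_sq_eq_abs]
  rfl

end Limits

/-! ### Convergence of the conditional second moment -/

section Convergence

variable {β h : ℝ}

/-- The Gram matrix of the fields tends to the identity. Entrywise errors below 1/(n+1) change the
quadratic form by at most n/(n+1) times Σ c², for all c at once. -/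
theorem eventually_gram_le (hβ : 0 < β) (hβ1 : β ^ 2 < 1) (hh : 0 < h) (n : ℕ) :
    ∀ᶠ z : Σ N : ℕ, Matrix (Fin N) (Fin N) ℝ in hp, ∀ c : Fin n → ℝ,
      inner (∑ s, c s • zeta β h z.2 s) (∑ s, c s • zeta β h z.2 s) ≤ 2 * ∑ s, c s ^ 2 := by
  have hε : (0 : ℝ) < 1 / (n + 1) := by positivity
  have h1 : ∀ᶠ z : Σ N : ℕ, Matrix (Fin N) (Fin N) ℝ in hp, ∀ s t : Fin n,
      |inner (zeta β h z.2 s) (zeta β h z.2 t) - if s = t then 1 else 0| < 1 / (n + 1) := by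
    refine eventually_all.2 fun s => eventually_all.2 fun t => ?_
    have := Metric.tendsto_nhds.1 (tendsto_inner_zeta_zeta hβ hβ1 hh s t) _ hε
    simpa only [Real.dist_eq] using this
  filter_upwards [h1] with z hz c
  have e1 : inner (∑ s, c s • zeta β h z.2 s) (∑ s, c s • zeta β h z.2 s) =
      ∑ s : Fin n, ∑ t : Fin n, c s * c t * inner (zeta β h z.2 s) (zeta β h z.2 t) := by
    rw [inner_sum_left]
    refine Finset.sum_congr rfl fun s _ => ?_
    rw [inner_sum_right]
    refine Finset.sum_congr rfl fun t _ => ?_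
    rw [inner_smul_left, inner_smul_right, mul_assoc]
  have e2 : ∑ s : Fin n, ∑ t : Fin n, c s * c t * (if s = t then 1 else 0) = ∑ s, c s ^ 2 :=
    Finset.sum_congr rfl fun s _ => by simp [sq]
  have h2 : ∑ s : Fin n, ∑ t : Fin n, c s * c t * inner (zeta β h z.2 s) (zeta β h z.2 t) -
      ∑ s : Fin n, ∑ t : Fin n, c s * c t * (if s = t then 1 else 0) ≤
      ∑ s : Fin n, ∑ t : Fin n, |c s| * |c t| * (1 / (n + 1)) := by
    rw [← Finset.sum_sub_distrib]
    refine Finset.sum_le_sum fun s _ => ?_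
    rw [← Finset.sum_sub_distrib]
    refine Finset.sum_le_sum fun t _ => ?_
    rw [← mul_sub]
    refine (le_abs_self _).trans ?_
    rw [abs_mul, abs_mul]
    exact mul_le_mul_of_nonneg_left (hz s t).le (by positivity)
  have e3 : ∑ s : Fin n, ∑ t : Fin n, |c s| * |c t| * (1 / ((n : ℝ) + 1)) =
      (∑ s, |c s|) ^ 2 * (1 / (n + 1)) := by
    rw [sq, Finset.sum_mul_sum, Finset.sum_mul]
    exact Finset.sum_congr rfl fun s _ => by rw [Finset.sum_mul]
  have h3 : (∑ s, |c s|) ^ 2 ≤ n * ∑ s, c s ^ 2 := by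
    have := sq_sum_le_card_mul_sum_sq (s := Finset.univ) (f := fun s => |c s|)
    simpa using this
  have h4 : (∑ s, |c s|) ^ 2 * (1 / ((n : ℝ) + 1)) ≤ ∑ s, c s ^ 2 := by
    have h0 : 0 ≤ ∑ s, c s ^ 2 := Finset.sum_nonneg fun s _ => sq_nonneg _
    rw [mul_one_div, div_le_iff₀ (by positivity)]
    nlinarith
  rw [e1]
  linarith

theorem tendsto_fst_hp : Tendsto (fun z : Σ N : ℕ, Matrix (Fin N) (Fin N) ℝ => z.1) hp atTop :=
  tendsto_atTop.2 fun b => eventually_hp_of_eventually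
    ((eventually_ge_atTop b).mono fun _ hN _ => hN)

theorem effMean_coef {N : ℕ} (g : Matrix (Fin N) (Fin N) ℝ) (K : ℕ) :
    effMean β h (fun s : Fin (K + 1) => zeta β h g s) (fun s => coef β h K s) = mean β h g K :=
  funext fun i => (mean_apply β h g (Nat.lt_succ_self K) i).symm

/-- All centerings agree with the limits except in the last direction, where ⟨m, φ_K⟩ tends to γ_K
while the coefficient is √(q - Γ_K²). This is the only error that remains as N → ∞ for fixed K. -/
theorem tendsto_biasTerm (hβ : 0 < β) (hβ1 : β ^ 2 < 1) (hh : 0 < h) (K : ℕ) :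
    Tendsto (fun z : Σ N : ℕ, Matrix (Fin N) (Fin N) ℝ =>
      biasTerm β (overlap β h) (fun s : Fin (K + 1) => phi β h z.2 s)
        (fun s : Fin (K + 1) => zeta β h z.2 s) (fun s => coef β h K s) (mean β h z.2 K)) hp
      (𝓝 ((gammaSeq β h K - √(overlap β h - gammaSum β h K)) ^ 2)) := by
  have h1 := tendsto_finsetSum Finset.univ fun (s : Fin (K + 1)) _ =>
    ((tendsto_inner_mean_phi hβ hβ1 hh (nonDegenerate hβ hβ1 hh (K + 1))
      (Nat.le_of_lt_succ s.2) (Nat.lt_succ_self K)).sub_const (coef β h K s)).pow 2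
  have h2 := tendsto_finsetSum Finset.univ fun (s : Fin (K + 1)) _ =>
    ((tendsto_inner_zeta_mean hβ hβ1 hh K s).sub_const
      (β * coef β h K s * (1 - overlap β h))).pow 2
  have h3 := h1.add h2
  have e : ∑ s : Fin (K + 1), (gammaSeq β h s - coef β h K s) ^ 2 +
      ∑ s : Fin (K + 1), (β * coef β h K s * (1 - overlap β h) -
        β * coef β h K s * (1 - overlap β h)) ^ 2 =
      (gammaSeq β h K - √(overlap β h - gammaSum β h K)) ^ 2 := by
    simp only [sub_self, ne_eq, OfNat.ofNat_ne_zero, not_false_eq_true, zero_pow,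
      Finset.sum_const_zero, add_zero]
    rw [Fin.sum_univ_castSucc, Finset.sum_eq_zero, zero_add, Fin.val_last, coef_self]
    intro s _
    rw [Fin.val_castSucc, coef_of_lt β h s.2, sub_self, zero_pow two_ne_zero]
  rw [e] at h3
  refine h3.congr fun z => ?_
  rw [biasTerm]
  simp_rw [inner_comm (mean β h z.2 K)]

theorem eventually_abs_log_condMoment_sub_lt (hβ : 0 < β) (hβ1 : β ≤ 1 / 2000) (hh : 0 < h) {K : ℕ}
    {ε : ℝ} (hε : 80 * (gammaSeq β h K - √(overlap β h - gammaSum β h K)) ^ 2 < ε) :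
    ∀ᶠ z : Σ N : ℕ, Matrix (Fin N) (Fin N) ℝ in hp,
      |1 / (z.1 : ℝ) * Real.log (condMoment β h (K + 1) z.2) - 2 * RS β h| < ε := by
  have hβ2 : β ^ 2 < 1 := by nlinarith
  have hRS := RS_eq β h (by nlinarith)
  set q := overlap β h with hq
  have l1 := tendsto_biasTerm hβ hβ2 hh K
  have l2 := tendsto_finsetSum Finset.univ fun (s : Fin (K + 1)) _ =>
    (tendsto_diagTerm (β := β) (h := h) s).abs
  have l3 := ((tendsto_inner_mean_self hβ hβ2 hh (nonDegenerate hβ hβ2 hh (K + 1))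
    (Nat.lt_succ_self K)).sub_const q).pow 2
  have l4 : Tendsto (fun z : Σ N : ℕ, Matrix (Fin N) (Fin N) ℝ =>
      4 * expSqMoment ^ (2 * (Fintype.card (Fin (K + 1)) + 1)) / (z.1 : ℝ)) hp (𝓝 0) :=
    (tendsto_const_div_atTop_nhds_zero_nat _).comp tendsto_fst_hp
  have l5 := ((tendsto_log_cosh hβ hβ2 hh K).sub_const (logCosh β h q)).abs
  have l6 := ((((l1.const_mul 80).add (l2.const_mul 2)).add (l3.const_mul 4)).add l4).add
    (l5.const_mul 2)
  have e0 : 80 * (gammaSeq β h K - √(q - gammaSum β h K)) ^ 2 + 2 * ∑ _s : Fin (K + 1), |(0 : ℝ)| +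
      4 * (q - q) ^ 2 + 0 + 2 * |logCosh β h q - logCosh β h q| =
      80 * (gammaSeq β h K - √(q - gammaSum β h K)) ^ 2 := by simp
  rw [e0] at l6
  filter_upwards [l6.eventually_lt_const hε, eventually_gram_le hβ hβ2 hh (K + 1),
    eventually_hp_ne_zero] with z hz hgram hN
  have key := abs_log_replicaSum_sub_le (e := fun s : Fin (K + 1) => diagTerm β h s z.2) hN
    (fun s t hst => inner_phi_of_ne β h z.2 (fun h' => hst (Fin.ext h')))
    (fun s : Fin (K + 1) => inner_phi_self_le β h z.2 s) hgram hβ.le hβ1 (overlap_nonneg β h)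
    (overlap_le_one β h) (sum_coef_sq hβ hβ2 hh (Nat.lt_succ_self K)) (h := h)
  rw [effMean_coef] at key
  set Λ := (∑ i, Real.log (Real.cosh (effField β h (fun s : Fin (K + 1) => zeta β h z.2 s)
    (fun s => coef β h K s) i))) / (z.1 : ℝ)
  have e1 : 1 / (z.1 : ℝ) * Real.log (condMoment β h (K + 1) z.2) - 2 * RS β h =
      (1 / (z.1 : ℝ) * Real.log (condMoment β h (K + 1) z.2) -
        (2 * Λ + β ^ 2 * (1 - q) ^ 2 / 2)) + 2 * (Λ - logCosh β h q) := by
    rw [hRS]; ring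
  rw [e1]
  refine lt_of_le_of_lt ((abs_add_le _ _).trans (add_le_add key (le_of_eq ?_))) hz
  rw [abs_mul, abs_two]

theorem eventually_abs_log_condMoment_sub (hβ : 0 < β) (hβ1 : β ≤ 1 / 2000) (hh : 0 < h)
    {ε : ℝ} (hε : 0 < ε) : ∀ᶠ K : ℕ in atTop, ∀ᶠ z : Σ N : ℕ, Matrix (Fin N) (Fin N) ℝ in hp,
      |1 / (z.1 : ℝ) * Real.log (condMoment β h (K + 1) z.2) - 2 * RS β h| < ε := by
  have hβ2 : β ^ 2 < 1 := by nlinarith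
  obtain ⟨h1, h2⟩ := tendsto_gammaSum hβ hβ2 hh
  have h3 : Tendsto (fun K => 80 * (gammaSeq β h K - √(overlap β h - gammaSum β h K)) ^ 2) atTop
      (𝓝 0) := by
    have := ((h2.sub (h1.const_sub (overlap β h)).sqrt).pow 2).const_mul 80
    simpa using this
  exact (h3.eventually_lt_const hε).mono fun K hK =>
    eventually_abs_log_condMoment_sub_lt hβ hβ1 hh hK

/-! ### From convergence in probability to convergence in mean. -/

/-- A crude bound for the free energy of the conditional second moment. -/
def crudeBound (β h c : ℝ) (k : ℕ) {N : ℕ} (g : Matrix (Fin N) (Fin N) ℝ) : ℝ :=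
  2 * (∑ s : Fin k, nrm (zeta β h g s) + ∑ s : Fin k, |diagTerm β h s g|) + c

theorem crudeBound_sq_le (c : ℝ) (k : ℕ) {N : ℕ} (g : Matrix (Fin N) (Fin N) ℝ) :
    crudeBound β h c k g ^ 2 ≤ 12 * k * (∑ s : Fin k, inner (zeta β h g s) (zeta β h g s) +
      ∑ s : Fin k, diagTerm β h s g ^ 2) + 3 * c ^ 2 := by
  have h1 := sq_sum_le_card_mul_sum_sq (s := Finset.univ) (f := fun s : Fin k => nrm (zeta β h g s))
  have h2 := sq_sum_le_card_mul_sum_sq (s := Finset.univ) (f := fun s : Fin k => |diagTerm β h s g|)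
  simp only [nrm_sq, sq_abs, Finset.card_univ, Fintype.card_fin] at h1 h2
  rw [crudeBound]
  set A := ∑ s : Fin k, nrm (zeta β h g s)
  set E := ∑ s : Fin k, |diagTerm β h s g|
  nlinarith [sq_nonneg (2 * A - 2 * E), sq_nonneg (2 * A - c), sq_nonneg (2 * E - c)]

theorem lintegral_crudeBound_sq_le (c : ℝ) (k : ℕ) {N : ℕ} (hN : N ≠ 0) :
    ∫⁻ g, ENNReal.ofReal (crudeBound β h c k g ^ 2) ∂(matrixLaw N) ≤
      ENNReal.ofReal (12 * k * (∑ s : Fin k, (2 * (s : ℝ) + 8) + k) + 3 * c ^ 2) := by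
  have hz0 : ∀ g : Matrix (Fin N) (Fin N) ℝ, 0 ≤ ∑ s : Fin k, inner (zeta β h g s) (zeta β h g s) :=
    fun g => Finset.sum_nonneg fun s _ => inner_self_nonneg _
  have hd0 : ∀ g : Matrix (Fin N) (Fin N) ℝ, 0 ≤ ∑ s : Fin k, diagTerm β h s g ^ 2 :=
    fun g => Finset.sum_nonneg fun s _ => sq_nonneg _
  have hk : (0 : ℝ) ≤ 12 * k := by positivity
  have hc : 0 ≤ 3 * c ^ 2 := by positivity
  have mz : ∀ s : Fin k, Measurable fun g : Matrix (Fin N) (Fin N) ℝ =>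
      ENNReal.ofReal (inner (zeta β h g s) (zeta β h g s)) := fun s =>
    (measurable_inner (measurable_zeta β h s) (measurable_zeta β h s)).ennreal_ofReal
  have md : ∀ s : Fin k, Measurable fun g : Matrix (Fin N) (Fin N) ℝ =>
      ENNReal.ofReal (diagTerm β h s g ^ 2) := fun s =>
    ((measurable_inner (measurable_phi β h s) (measurable_xi β h s)).pow_const 2).ennreal_ofReal
  have e : ∀ g : Matrix (Fin N) (Fin N) ℝ,
      ENNReal.ofReal (12 * k * (∑ s : Fin k, inner (zeta β h g s) (zeta β h g s) +
        ∑ s : Fin k, diagTerm β h s g ^ 2) + 3 * c ^ 2) =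
      ENNReal.ofReal (12 * k) * (∑ s : Fin k, ENNReal.ofReal
        (inner (zeta β h g s) (zeta β h g s)) +
        ∑ s : Fin k, ENNReal.ofReal (diagTerm β h s g ^ 2)) + ENNReal.ofReal (3 * c ^ 2) :=
    fun g => by
      rw [ENNReal.ofReal_add (mul_nonneg hk (add_nonneg (hz0 g) (hd0 g))) hc, ENNReal.ofReal_mul hk,
        ENNReal.ofReal_add (hz0 g) (hd0 g),
        ENNReal.ofReal_sum_of_nonneg fun s _ => inner_self_nonneg _,
        ENNReal.ofReal_sum_of_nonneg fun s _ => sq_nonneg _]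
  have m1 : Measurable fun g : Matrix (Fin N) (Fin N) ℝ =>
      ∑ s : Fin k, ENNReal.ofReal (inner (zeta β h g s) (zeta β h g s)) :=
    Finset.measurable_sum _ fun s _ => mz s
  have m2 : Measurable fun g : Matrix (Fin N) (Fin N) ℝ =>
      ∑ s : Fin k, ENNReal.ofReal (diagTerm β h s g ^ 2) :=
    Finset.measurable_sum _ fun s _ => md s
  refine (lintegral_mono fun g => ENNReal.ofReal_le_ofReal (crudeBound_sq_le c k g)).trans ?_
  simp_rw [e]
  rw [lintegral_add_right _ measurable_const, lintegral_const_mul' _ _ ENNReal.ofReal_ne_top,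
    lintegral_add_left m1, lintegral_finsetSum _ fun s _ => mz s,
    lintegral_finsetSum _ fun s _ => md s, lintegral_const, measure_univ, mul_one,
    ENNReal.ofReal_add (mul_nonneg hk (add_nonneg (Finset.sum_nonneg fun s _ => by positivity)
      (Nat.cast_nonneg k))) hc, ENNReal.ofReal_mul hk,
    ENNReal.ofReal_add (Finset.sum_nonneg fun s _ => by positivity) (Nat.cast_nonneg k),
    ENNReal.ofReal_sum_of_nonneg fun s _ => by positivity]
  have hd : ∑ s : Fin k, ∫⁻ g, ENNReal.ofReal (diagTerm β h s g ^ 2) ∂(matrixLaw N) ≤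
      ENNReal.ofReal k := by
    have h1 : ENNReal.ofReal (k : ℝ) = ∑ _s : Fin k, 1 := by simp
    rw [h1]
    refine Finset.sum_le_sum fun s _ => (lintegral_diagTerm_sq_le β h s hN).trans ?_
    rw [ENNReal.ofReal_le_one]
    exact div_le_one_of_le₀ (by exact_mod_cast Nat.one_le_iff_ne_zero.2 hN) (Nat.cast_nonneg N)
  gcongr with s
  exact lintegral_zeta_sq_le β h s hN

theorem abs_log_condMoment_sub_le (hβ : 0 < β) (hβ1 : β ≤ 1) (hh : 0 < h) (k : ℕ) {N : ℕ}
    (hN : N ≠ 0) (r : ℝ) (g : Matrix (Fin N) (Fin N) ℝ) :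
    |1 / (N : ℝ) * Real.log (condMoment β h k g) - r| ≤
      crudeBound β h (2 * (h + 1) + 2 + |r|) k g := by
  have key := abs_log_replicaSum_le (e := fun s : Fin k => diagTerm β h s g)
    (ζ := fun s : Fin k => zeta β h g s) hN
    (fun s t hst => inner_phi_of_ne β h g (fun h' => hst (Fin.ext h')))
    (fun s : Fin k => inner_phi_self_le β h g s) hβ.le hβ1 hh.le
  have h1 := abs_sub (1 / (N : ℝ) * Real.log (condMoment β h k g)) r
  rw [crudeBound]
  refine h1.trans ?_
  change |1 / (N : ℝ) * Real.log (condMoment β h k g)| ≤ _ at key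
  linarith

/-- A quantitative form of uniform integrability: where |X| is not small, W ≤ δW² + 1/δ bounds it by
a small multiple of a second moment plus a large multiple of a small probability. -/
theorem lintegral_abs_le_of_split {α : Type*} [MeasurableSpace α] {μ : Measure α}
    [IsProbabilityMeasure μ] {X W : α → ℝ} (hX : Measurable X) {ε δ : ℝ} (hδ : 0 < δ) (hXW : ∀ x, |X x| ≤ W x) :
    ∫⁻ x, ENNReal.ofReal |X x| ∂μ ≤ ENNReal.ofReal ε + ENNReal.ofReal δ *
      ∫⁻ x, ENNReal.ofReal (W x ^ 2) ∂μ + ENNReal.ofReal (1 / δ) * μ {x | ¬ |X x| < ε} := by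
  have hA : MeasurableSet {x | ¬ |X x| < ε} := (measurableSet_lt hX.abs measurable_const).compl
  have hpt : ∀ x, ENNReal.ofReal |X x| ≤ ENNReal.ofReal ε +
      ENNReal.ofReal (δ) * ENNReal.ofReal (W x ^ 2) +
      ENNReal.ofReal (1 / δ) * {x | ¬ |X x| < ε}.indicator 1 x := by
    intro x
    by_cases hx : |X x| < ε
    · exact (ENNReal.ofReal_le_ofReal hx.le).trans (le_add_right (le_add_right le_rfl))
    · have hx' : x ∈ {x | ¬ |X x| < ε} := hx
      rw [Set.indicator_of_mem hx', Pi.one_apply, mul_one, ← ENNReal.ofReal_mul hδ.le, add_assoc,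
        ← ENNReal.ofReal_add (by positivity) (by positivity)]
      refine (ENNReal.ofReal_le_ofReal ((hXW x).trans ?_)).trans le_add_self
      have : 0 ≤ δ * (W x - 1 / δ) ^ 2 := by positivity
      have e : δ * (W x - 1 / δ) ^ 2 = δ * W x ^ 2 - 2 * W x + 1 / δ := by field_simp; ring
      have := (abs_nonneg _).trans (hXW x)
      linarith
  refine (lintegral_mono hpt).trans ?_
  have hB : Measurable fun x => ENNReal.ofReal (1 / δ) * {x | ¬ |X x| < ε}.indicator 1 x :=
    measurable_const.mul (measurable_one.indicator hA)
  rw [lintegral_add_right _ hB,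
    lintegral_add_left measurable_const, lintegral_const_mul' _ _ ENNReal.ofReal_ne_top,
    lintegral_const_mul' _ _ ENNReal.ofReal_ne_top, lintegral_const, measure_univ, mul_one,
    lintegral_indicator_one hA]

theorem eventually_lintegral_le (hβ : 0 < β) (hβ1 : β ≤ 1 / 2000) (hh : 0 < h)
    {ε : ℝ} (hε : 0 < ε) : ∀ᶠ K : ℕ in atTop, ∀ᶠ N : ℕ in atTop,
      ∫⁻ g, ENNReal.ofReal |1 / (N : ℝ) * Real.log (condMoment β h (K + 1) g) - 2 * RS β h|
        ∂(matrixLaw N) ≤ ENNReal.ofReal ε := by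
  filter_upwards [eventually_abs_log_condMoment_sub hβ hβ1 hh (half_pos (half_pos hε))] with K hK
  rw [eventually_hp_iff] at hK
  set c := 2 * (h + 1) + 2 + |2 * RS β h|
  set C := 12 * ((K + 1 : ℕ) : ℝ) * (∑ s : Fin (K + 1), (2 * (s : ℝ) + 8) + ((K + 1 : ℕ) : ℝ)) +
    3 * c ^ 2 with hC
  have hC0 : 0 ≤ C := by
    have : 0 ≤ ∑ s : Fin (K + 1), (2 * (s : ℝ) + 8) := Finset.sum_nonneg fun s _ => by positivity
    positivity
  -- The second moment contributes at most ε/4 and the truncation ε/4, which leaves room for the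
  -- probability term as N grows.
  set δ := ε / 4 / (C + 1) with hδ
  have hδ0 : 0 < δ := by positivity
  have hδC : δ * C ≤ ε / 4 := by
    rw [hδ, div_mul_eq_mul_div, div_le_iff₀ (by positivity)]
    nlinarith
  have hlim := (ENNReal.Tendsto.const_mul hK (Or.inr (ENNReal.ofReal_ne_top (r := 1 / δ)))).const_add
    (ENNReal.ofReal (ε / 2 / 2) + ENNReal.ofReal δ * ENNReal.ofReal C)
  rw [mul_zero, add_zero] at hlim
  have hlt : ENNReal.ofReal (ε / 2 / 2) + ENNReal.ofReal δ * ENNReal.ofReal C <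
      ENNReal.ofReal ε := by
    rw [← ENNReal.ofReal_mul hδ0.le, ← ENNReal.ofReal_add (by positivity) (by positivity),
      ENNReal.ofReal_lt_ofReal_iff hε]
    linarith
  filter_upwards [hlim.eventually_lt_const hlt, eventually_ne_atTop 0] with N h1 hN
  have hm : Measurable fun g : Matrix (Fin N) (Fin N) ℝ =>
      1 / (N : ℝ) * Real.log (condMoment β h (K + 1) g) - 2 * RS β h :=
    (((measurable_condMoment_of β h (K + 1) (G := id) (fun s _ => measurable_xi β h s)
      fun s _ => measurable_eta β h s).log).const_mul _).sub_const _
  refine (lintegral_abs_le_of_split hm (ε := ε / 2 / 2) hδ0 fun g =>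
    abs_log_condMoment_sub_le hβ (hβ1.trans (by norm_num)) hh (K + 1) hN (2 * RS β h) g).trans
    (le_trans ?_ h1.le)
  gcongr
  exact lintegral_crudeBound_sq_le c (K + 1) hN

/-- The conditional second moment, on an arbitrary probability space. -/
theorem lintegral_log_condExp {Ω : Type*} [MeasurableSpace Ω] {P : Measure Ω}
    [IsProbabilityMeasure P] {N : ℕ} {g : Ω → Matrix (Fin N) (Fin N) ℝ} (hg : IsDisorder P g)
    (hN : N ≠ 0) (k : ℕ) (r : ℝ) :
    ∫⁻ ω, ENNReal.ofReal |1 / (N : ℝ) * Real.log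
      ((P[fun ω' => partitionFn β h (g ω') ^ 2 | sigmaField β h g k]) ω) - r| ∂P =
    ∫⁻ A, ENNReal.ofReal |1 / (N : ℝ) * Real.log (condMoment β h k A) - r| ∂(matrixLaw N) := by
  have hm : Measurable fun A : Matrix (Fin N) (Fin N) ℝ =>
      1 / (N : ℝ) * Real.log (condMoment β h k A) - r :=
    (((measurable_condMoment_of β h k (G := id) (fun s _ => measurable_xi β h s)
      fun s _ => measurable_eta β h s).log).const_mul _).sub_const _
  rw [← hg.map_eq, lintegral_map hm.abs.ennreal_ofReal hg.measurable_fun]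
  refine lintegral_congr_ae ?_
  filter_upwards [condExp_partitionFn_sq hg β h hN k] with ω hω
  rw [hω]

end Convergence

end

end SKModel

theorem proposition4 :
    ∃ β₀ : ℝ, 0 < β₀ ∧ ∀ β h : ℝ, 0 < β → β ≤ β₀ → 0 < h →
      ∀ (Ω : Type*) [MeasurableSpace Ω] (P : Measure Ω) [IsProbabilityMeasure P]
        (g : (N : ℕ) → Ω → Matrix (Fin N) (Fin N) ℝ),
        (∀ N, SKModel.IsDisorder P (g N)) →
        Tendsto
          (fun k : ℕ => limsup
            (fun N : ℕ => ∫⁻ ω, ENNReal.ofReal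
              |1 / (N : ℝ) * Real.log
                  ((P[fun ω' => SKModel.partitionFn β h (g N ω') ^ 2 |
                    SKModel.sigmaField β h (g N) k]) ω)
                - 2 * SKModel.RS β h| ∂P)
            atTop)
          atTop (𝓝 0) := by
  -- The threshold is the one imposed by the exponential moments in `abs_log_replicaSum_sub_le`.
  refine ⟨1 / 2000, by norm_num, fun β h hβ hβ1 hh Ω _ P _ g hg => ?_⟩
  -- The estimates are indexed by the last direction K, so the σ-field contains K + 1 steps;
  -- shifting the index does not affect the limit.
  refine (tendsto_add_atTop_iff_nat 1).1 (ENNReal.tendsto_nhds_zero.2 fun ε hε => ?_)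
  rcases eq_or_ne ε ⊤ with rfl | hε'
  · simp
  filter_upwards [SKModel.eventually_lintegral_le hβ hβ1 hh (ENNReal.toReal_pos hε.ne' hε')]
    with K hK
  rw [ENNReal.ofReal_toReal hε'] at hK
  refine limsup_le_of_le (h := ?_)
  filter_upwards [hK, eventually_ne_atTop 0] with N h1 hN
  exact (SKModel.lintegral_log_condExp (hg N) hN (K + 1) _).trans_le h1
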